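/- A \emph{Type-2-Machine} is a finite labelled graph controlling one read-only input tape, two working tapes and one write-only one-way output tape over $\{0,1\}$. On input $x\in\{0,1\}^{\mathbb N}$ it has a valid output if it either reaches an accepting vertex (the output is then the content of the output tape, which is initially $0^{\mathbb N}$) or writes an infinite sequence on the output tape; it \emph{accepts} $x$ if it has a valid output on $x$. An \emph{Oracle-Type-2-Machine} may in addition use vertices labelled $?$: there a copy of the machine with erased output tape is started to compute an infinite query $q$ (from the current tape contents and head positions), and the main computation continues with an answer $y\in\mathcal O(q)$ of the oracle $\mathcal O:\subseteq\{0,1\}^{\mathbb N}\rightrightarrows\{0,1\}^{\mathbb N}$ on its second working tape. A \emph{nondeterministic Type-2-Machine} may in addition use vertices with two successors, either of which may be taken. The multi-valued function $\mathrm{UnProject}:\subseteq\{0,1\}^{\mathbb N}\rightrightarrows\{0,1\}^{\mathbb N}$ takes (a name of) a Type-2-Machine $M$ together with an infinite sequence $x$, coded as $1^k0x$ with $k$ the Gödel number of $M$, to all $y\in\{0,1\}^{\mathbb N}$ such that $M$ accepts $\langle x,y\rangle = x(0)\,y(0)\,x(1)\,y(1)\dots$ \textbf{Theorem.} For every multi-valued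 function $f:\subseteq\{0,1\}^{\mathbb N}\rightrightarrows\{0,1\}^{\mathbb N}$ the following are equivalent: (1) $f$ is computable with a single oracle call to $\mathrm{UnProject}$: there is an Oracle-Type-2-Machine which, with oracle $\mathrm{UnProject}$, visits a vertex labelled $?$ at most once during any run (counting the main computation and the computation of the query), and which, for every single-valued choice $g$ of answers (a function $g$ with $\operatorname{dom} g=\operatorname{dom}\mathrm{UnProject}$ and $g(q)\in\mathrm{UnProject}(q)$ for each $q$ in this domain) and every $x\in\operatorname{dom} f$, computes with oracle $g$ an output in $f(x)$. (2) $f$ is computable by Type-2-nondeterminism: there is a nondeterministic Type-2-Machine such that for every $x\in\operatorname{dom} f$ some computation on input $x$ has a valid output, and each valid output of any computation on input $x$ lies in $f(x)$. -/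

import Mathlib

open Filter Topology

namespace TypeTwo

/-- Cantor space `{0,1}^ℕ` (with its product topology); `false` is `0` and `true` is `1`. -/
abbrev Cantor : Type := ℕ → Bool

/-- A multi-valued partial function `f :⊆ {0,1}^ℕ ⇉ {0,1}^ℕ`; its domain is the set of all
`x` with `f x` nonempty. -/
abbrev Problem : Type := Cantor → Set Cantor

/-- The pair `⟨x, y⟩ = x(0) y(0) x(1) y(1) …`. -/
def pair (x y : Cantor) : Cantor :=
  fun n => if n % 2 = 0 then x (n / 2) else y (n / 2)

/-! ### Machines as finite labelled graphs -/

/-- A vertex of a machine: its label together with its (ordered) outgoing edges, each of them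
given by the number of the vertex it leads to. Tapes: `0` input, `1` and `2` working tapes,
`3` output. -/
inductive Vertex : Type
  /-- label `s` -/
  | start (q : ℕ)
  /-- label `t_i`, `i ∈ {0,1,2}`: branch on the symbol under the head of tape `i` -/
  | test (i : Fin 3) (q0 q1 : ℕ)
  /-- label `l_i`, `i ∈ {0,1,2}` -/
  | left (i : Fin 3) (q : ℕ)
  /-- label `r_i`, `i ∈ {0,1,2}` -/
  | right (i : Fin 3) (q : ℕ)
  /-- label `w_{i+1}^b`, `i + 1 ∈ {1,2,3}`: write `b` on tape `i + 1` and move right -/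
  | write (i : Fin 3) (b : Bool) (q : ℕ)
  /-- label `a`, a sink -/
  | accept
  /-- label `r`, a sink -/
  | reject
  /-- label `?` of oracle machines: `q1` is where the query is computed, `q0` is where the
  computation continues after the answer -/
  | query (q0 q1 : ℕ)
  /-- the additional label of nondeterministic machines: either edge may be taken -/
  | guess (q0 q1 : ℕ)

/-- The vertices that the outgoing edges of a vertex lead to. -/
def Vertex.succs : Vertex → List ℕ
  | .start q => [q]
  | .test _ q0 q1 => [q0, q1]
  | .left _ q => [q]
  | .right _ q => [q]
  | .write _ _ q => [q]
  | .accept => []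
  | .reject => []
  | .query q0 q1 => [q0, q1]
  | .guess q0 q1 => [q0, q1]

/-- A finite labelled graph; vertex number `q` is the `q`-th entry of the list. -/
abbrev Machine : Type := List Vertex

namespace Machine

/-- Vertex `0` is labelled `s`, is the only vertex with this label and has no incoming edge, and
all edges lead to vertices of the graph. -/
structure WellFormed (M : Machine) : Prop where
  start_zero : ∃ q, M[0]? = some (.start q)
  start_unique : ∀ i q, M[i]? = some (.start q) → i = 0
  edges : ∀ v ∈ M, ∀ q ∈ v.succs, 0 < q ∧ q < M.length

/-- A (deterministic) Type-2-Machine: labels `?` and `guess` do not occur. -/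
structure IsType2 (M : Machine) : Prop extends WellFormed M where
  no_query : ∀ q0 q1, Vertex.query q0 q1 ∉ M
  no_guess : ∀ q0 q1, Vertex.guess q0 q1 ∉ M

/-- An Oracle-Type-2-Machine: the label `?` is admitted in addition. -/
structure IsOracleType2 (M : Machine) : Prop extends WellFormed M where
  no_guess : ∀ q0 q1, Vertex.guess q0 q1 ∉ M

/-- A nondeterministic Type-2-Machine: the label `guess` is admitted in addition. -/
structure IsNondetType2 (M : Machine) : Prop extends WellFormed M where
  no_query : ∀ q0 q1, Vertex.query q0 q1 ∉ M

end Machine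

/-! ### Configurations and deterministic steps -/

/-- A configuration: current vertex, contents of the four tapes, positions of the four heads. -/
structure Config : Type where
  vertex : ℕ
  tape : Fin 4 → Cantor
  head : Fin 4 → ℕ

/-- The initial configuration on input `x`, at the vertex labelled `s`. -/
def Config.init (x : Cantor) : Config where
  vertex := 0
  tape := Function.update (fun _ _ => false) 0 x
  head := fun _ => 0

namespace Machine

/-- The single step of a Type-2-Machine (`none`: there is no transition). As for `r`, there is no
transition from a vertex labelled `?` or `guess` here. -/
def step (M : Machine) (c : Config) : Option Config :=
  match M[c.vertex]? with
  | some (.start q) => some { c with vertex := q }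
  | some (.test i q0 q1) =>
      some { c with vertex := if c.tape i.castSucc (c.head i.castSucc) then q1 else q0 }
  | some (.left i q) =>
      if c.head i.castSucc = 0 then none
      else some { c with
        vertex := q
        head := Function.update c.head i.castSucc (c.head i.castSucc - 1) }
  | some (.right i q) =>
      some { c with
        vertex := q
        head := Function.update c.head i.castSucc (c.head i.castSucc + 1) }
  | some (.write i b q) =>
      some { c with
        vertex := q
        tape := Function.update c.tape i.succ
          (Function.update (c.tape i.succ) (c.head i.succ) b)
        head := Function.update c.head i.succ (c.head i.succ + 1) }
  | _ => none

/-- The configuration `c` yields output `w` under the one-step relation `R`: either an accepting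
vertex is reached, with `w` on the output tape, or configurations with each later position of the
output head are reached, and their output tapes converge to `w`. -/
def Yields (M : Machine) (R : Config → Config → Prop) (c : Config) (w : Cantor) : Prop :=
  (∃ c', Relation.ReflTransGen R c c' ∧ M[c'.vertex]? = some .accept ∧ c'.tape 3 = w) ∨
  (∃ d : ℕ → Config,
    (∀ m, c.head 3 ≤ m → Relation.ReflTransGen R c (d m) ∧ (d m).head 3 = m) ∧
    Tendsto (fun m => (d m).tape 3) atTop (𝓝 w))

/-- A Type-2-Machine accepts `x` if it has a valid output on input `x`. -/
def Accepts (M : Machine) (x : Cantor) : Prop :=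
  ∃ w, M.Yields (fun c c' => M.step c = some c') (Config.init x) w

/-! ### Oracle machines -/

end Machine

/-- The configuration in which the computation of an oracle query starts: output tape erased. -/
def Config.spawn (c : Config) (q1 : ℕ) : Config where
  vertex := q1
  tape := Function.update c.tape 3 (fun _ => false)
  head := Function.update c.head 3 0

/-- The configuration after the oracle has written its answer `y` on the second working tape. -/
def Config.answer (c : Config) (q0 : ℕ) (y : Cantor) : Config where
  vertex := q0
  tape := Function.update c.tape 2 y
  head := Function.update c.head 2 0

namespace Machine

/-- The one-step relation of an oracle machine with oracle `O`, for query depth `n`. -/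
def oracleStep (M : Machine) (O : Problem) : ℕ → Config → Config → Prop
  | 0 => fun c c' => M.step c = some c'
  | n + 1 => fun c c' => oracleStep M O n c c' ∨
      ∃ q0 q1 x y, M[c.vertex]? = some (.query q0 q1) ∧
        M.Yields (oracleStep M O n) (c.spawn q1) x ∧ y ∈ O x ∧ c' = c.answer q0 y

/-- The multi-valued function computed with oracle `O` and query depth `n`. -/
def oracleFun (M : Machine) (O : Problem) (n : ℕ) : Problem :=
  fun x => {y | M.Yields (M.oracleStep O n) (Config.init x) y}

/-- The configuration `c` is at a vertex labelled `?`. -/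
def AtQuery (M : Machine) (c : Config) : Prop :=
  ∃ q0 q1, M[c.vertex]? = some (.query q0 q1)

/-- With oracle `O`, a vertex labelled `?` occurs at most once during any run of `M`: there is
at most one on the main thread, and none while the query is computed. -/
structure AtMostOneCall (M : Machine) (O : Problem) : Prop where
  main : ∀ x c c', Relation.ReflTransGen (M.oracleStep O 1) (Config.init x) c → M.AtQuery c →
    Relation.TransGen (M.oracleStep O 1) c c' → ¬ M.AtQuery c'
  nested : ∀ x c q0 q1, Relation.ReflTransGen (M.oracleStep O 1) (Config.init x) c →
    M[c.vertex]? = some (.query q0 q1) →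
    ∀ c', Relation.ReflTransGen (M.oracleStep O 0) (c.spawn q1) c' → ¬ M.AtQuery c'

end Machine

/-- `G` is a single-valued function with the domain of `O` that selects values of `O`. -/
structure IsSelection (O G : Problem) : Prop where
  domain : ∀ x, (G x).Nonempty ↔ (O x).Nonempty
  single : ∀ x, (G x).Subsingleton
  subset : ∀ x, G x ⊆ O x

/-- `f` is computable with a single call to the oracle `O`: some oracle machine which makes at most
one call gives, for each choice `G` of the oracle's answers and each `x` in the domain of `f`,
an output in `f x`. -/
def SingleCallComputable (O f : Problem) : Prop :=
  ∃ M : Machine, M.IsOracleType2 ∧ M.AtMostOneCall O ∧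
    ∀ G, IsSelection O G → ∀ x, (f x).Nonempty → ∃ y ∈ f x, y ∈ M.oracleFun G 1 x

/-! ### Nondeterministic machines -/

namespace Machine

/-- The one-step relation of a nondeterministic machine. -/
def nondetStep (M : Machine) (c c' : Config) : Prop :=
  M.step c = some c' ∨
    ∃ q0 q1, M[c.vertex]? = some (.guess q0 q1) ∧
      (c' = { c with vertex := q0 } ∨ c' = { c with vertex := q1 })

/-- Some computation of the nondeterministic machine `M` on input `x` outputs `w`: a finite one
which ends in an accepting vertex with `w` on the output tape, or an infinite one which
writes the whole of the infinite sequence `w`. -/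
def NondetOutputs (M : Machine) (x w : Cantor) : Prop :=
  (∃ c, Relation.ReflTransGen M.nondetStep (Config.init x) c ∧
    M[c.vertex]? = some .accept ∧ c.tape 3 = w) ∨
  (∃ d : ℕ → Config, d 0 = Config.init x ∧ (∀ t, M.nondetStep (d t) (d (t + 1))) ∧
    (∀ m, ∃ t, (d t).head 3 = m) ∧ Tendsto (fun t => (d t).tape 3) atTop (𝓝 w))

end Machine

/-- `f` is nondeterministically computable: on each `x` in the domain of `f`, some
computation outputs an infinite sequence, and each infinite sequence which is output by some
computation lies in `f x`. -/
def NondetComputable (f : Problem) : Prop :=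
  ∃ M : Machine, M.IsNondetType2 ∧
    ∀ x, (f x).Nonempty → (∃ y, M.NondetOutputs x y) ∧ ∀ y, M.NondetOutputs x y → y ∈ f x

/-! ### Names of machines and the problem UnProject -/

/-- Label and edges of a vertex as numbers. -/
def Vertex.toNats : Vertex → ℕ × ℕ × ℕ
  | .start q => (0, q, 0)
  | .accept => (1, 0, 0)
  | .reject => (2, 0, 0)
  | .test i q0 q1 => (3 + i, q0, q1)
  | .left i q => (6 + i, q, 0)
  | .right i q => (9 + i, q, 0)
  | .write i b q => (12 + 2 * i + b.toNat, q, 0)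
  | .query q0 q1 => (18, q0, q1)
  | .guess q0 q1 => (19, q0, q1)

/-- The Gödel number of a machine. -/
def Machine.code (M : Machine) : ℕ :=
  Encodable.encode (M.map Vertex.toNats)

/-- The sequence `1^k 0 x`, where `k` is the Gödel number of `M`. -/
def instanceName (M : Machine) (x : Cantor) : Cantor :=
  fun n => if n < M.code then true else if n = M.code then false else x (n - M.code - 1)

/-- Given a (name of a) Type-2-Machine `M` and a sequence `x`, find `y` such that `M` accepts
`⟨x, y⟩`. -/
def UnProject : Problem :=
  fun p => {y | ∃ (M : Machine) (x : Cantor),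
    M.IsType2 ∧ p = instanceName M x ∧ M.Accepts (pair x y)}

end TypeTwo

namespace TypeTwo

/-! The common normal form is a primitive recursive `Transducer`, which reads one bit of `x` and one
bit of a second sequence `g` per round and emits at most one bit per round. Transducers become
machines because primitive recursive functions can be evaluated by loop programs over two stacks
kept on the working tapes (`exists_pushes`, `exists_round`). If the bits of `g` are guessed, this
gives a nondeterministic machine (`Transducer.exists_nondet_machine`); if `g` and a proposed output
`v` are part of the input, it gives a Type-2-Machine that accepts exactly when `v` is the output
(`Transducer.exists_verifier`). Conversely, a step of a machine is primitive recursive on a finite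
memory (`rep_simStep`): a head moves by at most one cell per step, so supplying the tapes cell by
cell keeps ahead of the heads.

From nondeterminism to the oracle: a nondeterministic machine is a deterministic one with the
sequence `g` of its guesses as additional input. A verifier `V` accepts `⟨⟨x,0⟩,⟨v,g⟩⟩` if and only
if the guesses `g` on input `x` lead to the output `v`. So the solutions of the instance `(V,
⟨x,0⟩)` of UnProject are the pairs `⟨v,g⟩` of an output and a witness for it. `callMachine` asks for
such a pair and copies `v` to its output; whichever pair is answered, `v` lies in `f x`.

From the oracle to nondeterminism: the answer `y` is guessed bit by bit and verified while it is
used (`Machine.oracleSimulator`). After the query vertex, three computations run in parallel: the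
computation of the query `q`, a universal system which reads `q` and simulates the machine named
there on the sequence in `q` paired with `y`, and the main computation with `y` as the answer. The
main computation makes a step only when the universal system emits a bit. Hence infinitely many bits
are written only if `q` is infinite, `y` solves the instance `q`, and the main computation writes an
infinite output (`oracleSimulator_outputs_iff_of_query`). As there is only one query, the outputs
over all correct guesses are the outputs over all single-valued choices of answers
(`Machine.oracleSimulator_outputs`), and each of these is in `f x`.

Finite and infinite computations are treated alike by letting accepting vertices write zeros
forever: the output tape is blank behind its head, so this does not change the output. -/

/-! ### One-way output and the sequence written along a path -/

/-- Passing from `c` to `c'` either leaves the output tape alone or appends a bit to it. -/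
def OutStep (c c' : Config) : Prop :=
  (c'.head 3 = c.head 3 ∧ c'.tape 3 = c.tape 3) ∨
  ∃ b, c'.head 3 = c.head 3 + 1 ∧ c'.tape 3 = Function.update (c.tape 3) (c.head 3) b

/-- Along `d` the whole of `w` is written on the output tape. -/
def Writes (d : ℕ → Config) (w : Cantor) : Prop :=
  (∀ m, ∃ t, m ≤ (d t).head 3) ∧ ∀ t p, p < (d t).head 3 → (d t).tape 3 p = w p

/-- The output tape is still blank from the position of its head on. -/
def Config.Blank (c : Config) : Prop := ∀ p, c.head 3 ≤ p → c.tape 3 p = false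

/-- Append a `0` to the output and stay at the same vertex. -/
def Config.idle (c : Config) : Config where
  vertex := c.vertex
  tape := Function.update c.tape 3 (Function.update (c.tape 3) (c.head 3) false)
  head := Function.update c.head 3 (c.head 3 + 1)

/-- The relation `R`, with accepting vertices turned into loops which write zeros. -/
def XStep (M : Machine) (R : Config → Config → Prop) (c c' : Config) : Prop :=
  R c c' ∨ (M[c.vertex]? = some .accept ∧ c' = c.idle)

theorem outStep_idle (c : Config) : OutStep c c.idle :=
  Or.inr ⟨false, by simp [Config.idle], by simp [Config.idle]⟩

theorem OutStep.blank {c c' : Config} (h : OutStep c c') (hc : c.Blank) : c'.Blank := by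
  intro p hp
  rcases h with ⟨h1, h2⟩ | ⟨b, h1, h2⟩
  · rw [h2]; exact hc p (by omega)
  · rw [h2, Function.update_of_ne (by omega)]; exact hc p (by omega)

theorem Config.Blank.idle_tape {c : Config} (hc : c.Blank) : c.idle.tape 3 = c.tape 3 := by
  have : Function.update (c.tape 3) (c.head 3) false = c.tape 3 := by
    rw [← hc (c.head 3) le_rfl]; exact Function.update_eq_self _ _
  simp [Config.idle, this]

theorem outStep_head_le {c c' : Config} (h : OutStep c c') : c.head 3 ≤ c'.head 3 := by
  rcases h with ⟨h1, -⟩ | ⟨b, h1, -⟩ <;> omega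

theorem outStep_head_le_succ {c c' : Config} (h : OutStep c c') : c'.head 3 ≤ c.head 3 + 1 := by
  rcases h with ⟨h1, -⟩ | ⟨b, h1, -⟩ <;> omega

theorem outStep_tape {c c' : Config} (h : OutStep c c') {p : ℕ} (hp : p < c.head 3) :
    c'.tape 3 p = c.tape 3 p := by
  rcases h with ⟨-, h2⟩ | ⟨b, -, h2⟩
  · rw [h2]
  · rw [h2, Function.update_of_ne (by omega)]

/-- Cells to the left of the output head are final, since writing takes place at the head and moves
it on. -/
theorem outPath_mono {d : ℕ → Config} (hd : ∀ t, OutStep (d t) (d (t + 1))) {s t : ℕ}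
    (h : s ≤ t) : (d s).head 3 ≤ (d t).head 3 ∧
      ∀ p, p < (d s).head 3 → (d t).tape 3 p = (d s).tape 3 p := by
  induction t, h using Nat.le_induction with
  | base => exact ⟨le_rfl, fun _ _ => rfl⟩
  | succ t _ ih =>
    refine ⟨ih.1.trans (outStep_head_le (hd t)), fun p hp => ?_⟩
    rw [outStep_tape (hd t) (by omega), ih.2 p hp]

/-- The head advances by at most one cell per step, so it skips no position. -/
theorem outPath_hits {d : ℕ → Config} (hd : ∀ t, OutStep (d t) (d (t + 1)))
    (hu : ∀ m, ∃ t, m ≤ (d t).head 3) (m : ℕ) (hm : (d 0).head 3 ≤ m) :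
    ∃ t, (d t).head 3 = m := by
  classical
  have ht : m ≤ (d (Nat.find (hu m))).head 3 := Nat.find_spec (hu m)
  have hmin : ∀ s < Nat.find (hu m), ¬ m ≤ (d s).head 3 := fun s hs => Nat.find_min (hu m) hs
  generalize Nat.find (hu m) = t at ht hmin
  refine ⟨t, ?_⟩
  rcases t with - | s
  · omega
  · have h1 := hmin s (by omega)
    have h2 := outStep_head_le_succ (hd s)
    omega

theorem Writes.tendsto {d : ℕ → Config} {w : Cantor} (hd : ∀ t, OutStep (d t) (d (t + 1)))
    (h : Writes d w) : Tendsto (fun t => (d t).tape 3) atTop (𝓝 w) := by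
  rw [tendsto_pi_nhds]
  intro p
  obtain ⟨t, ht⟩ := h.1 (p + 1)
  apply tendsto_nhds_of_eventually_eq
  filter_upwards [eventually_ge_atTop t] with s hs
  exact h.2 s p (by have := (outPath_mono hd hs).1; omega)

theorem eventually_tape_eq {ι : Type*} {l : Filter ι} {f : ι → Cantor} {w : Cantor}
    (h : Tendsto f l (𝓝 w)) (p : ℕ) : ∀ᶠ i in l, f i p = w p := by
  have := (tendsto_pi_nhds.1 h) p
  rw [nhds_discrete] at this
  simpa using this

/-- A cell does not change once the head has passed it, so its value at that time is already the
limit. -/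
theorem writes_of_tendsto {d : ℕ → Config} {w : Cantor} (hd : ∀ t, OutStep (d t) (d (t + 1)))
    (hu : ∀ m, ∃ t, m ≤ (d t).head 3) (h : Tendsto (fun t => (d t).tape 3) atTop (𝓝 w)) :
    Writes d w := by
  refine ⟨hu, fun t p hp => ?_⟩
  obtain ⟨s, hs, hts⟩ := ((eventually_tape_eq h p).and (eventually_ge_atTop t)).exists
  rw [← hs, (outPath_mono hd hts).2 p hp]

/-! ### Valid outputs as infinite paths -/

section Paths

variable {M : Machine} {R : Config → Config → Prop}

theorem XStep.outStep (hR : ∀ c c', R c c' → OutStep c c') {c c' : Config}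
    (h : XStep M R c c') : OutStep c c' := by
  rcases h with h | ⟨-, rfl⟩
  · exact hR _ _ h
  · exact outStep_idle c

theorem exists_path_of_reflTransGen {c c' : Config} (h : Relation.ReflTransGen R c c') :
    ∃ (n : ℕ) (d : ℕ → Config), d 0 = c ∧ d n = c' ∧ ∀ t < n, R (d t) (d (t + 1)) := by
  induction h with
  | refl => exact ⟨0, fun _ => c, rfl, rfl, by simp⟩
  | @tail b e _ hbe ih =>
    obtain ⟨n, d, h0, hn, hs⟩ := ih
    refine ⟨n + 1, fun t => if t ≤ n then d t else e, by simp [h0], by simp, fun t ht => ?_⟩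
    rcases Nat.lt_succ_iff_lt_or_eq.1 ht with h | rfl
    · simp only [h.le, Nat.succ_le_iff.2 h, if_true]; exact hs t h
    · simpa [hn] using hbe

theorem reflTransGen_of_path {d : ℕ → Config} {n : ℕ} (h : ∀ t < n, R (d t) (d (t + 1))) :
    Relation.ReflTransGen R (d 0) (d n) := by
  induction n with
  | zero => exact .refl
  | succ n ih => exact (ih fun t ht => h t (by omega)).tail (h n (by omega))

/-- The finite path is prolonged by `idle` steps; they put zeros on cells that are already blank, so
the tape stays `w` while the head runs to infinity. -/
theorem exists_xpath_of_accept (hR : ∀ c c', R c c' → OutStep c c') {c c' : Config} {w : Cantor}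
    (hc : c.Blank) (h : Relation.ReflTransGen R c c') (ha : M[c'.vertex]? = some .accept)
    (hw : c'.tape 3 = w) :
    ∃ d : ℕ → Config, d 0 = c ∧ (∀ t, XStep M R (d t) (d (t + 1))) ∧ Writes d w := by
  obtain ⟨n, d, h0, hn, hs⟩ := exists_path_of_reflTransGen h
  let e : ℕ → Config := fun t => if t ≤ n then d t else Config.idle^[t - n] c'
  have he : ∀ k, e (n + k) = Config.idle^[k] c' := by
    intro k
    rcases Nat.eq_zero_or_pos k with rfl | hk
    · simp [e, hn]
    · simp [e, show ¬ k = 0 by omega]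
  have hx : ∀ t, XStep M R (e t) (e (t + 1)) := by
    intro t
    rcases lt_or_ge t n with h | h
    · simp only [e, h.le, Nat.succ_le_iff.2 h, if_true]; exact Or.inl (hs t h)
    · obtain ⟨k, rfl⟩ := Nat.exists_eq_add_of_le h
      rw [add_assoc, he, he, Function.iterate_succ_apply']
      refine Or.inr ⟨?_, rfl⟩
      have : (Config.idle^[k] c').vertex = c'.vertex := by
        clear he h
        induction k with
        | zero => rfl
        | succ k ih =>
          rw [Function.iterate_succ_apply']; exact ih
      rw [this, ha]
  have hout := fun t => (hx t).outStep hR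
  have h00 : e 0 = c := by simp [e, h0]
  have hblank : ∀ t, (e t).Blank := by
    intro t
    induction t with
    | zero => rw [h00]; exact hc
    | succ t ih => exact (hout t).blank ih
  have htape : ∀ k, (e (n + k)).tape 3 = w ∧ (e (n + k)).head 3 = c'.head 3 + k := by
    intro k
    induction k with
    | zero => rw [he]; exact ⟨hw, rfl⟩
    | succ k ih =>
      have := hblank (n + k)
      rw [he] at ih this
      rw [he, Function.iterate_succ_apply']
      refine ⟨this.idle_tape.trans ih.1, ?_⟩
      simp only [Config.idle, Function.update_self]
      rw [ih.2]; rfl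
  refine ⟨e, h00, hx, fun m => ⟨n + m, by rw [(htape m).2]; omega⟩, fun t p hp => ?_⟩
  rw [← (htape t).1, (outPath_mono hout (show t ≤ n + t by omega)).2 p hp]

/-- From the first accepting vertex on, only `idle` steps are possible; they leave the tape
unchanged, so the finite path to this vertex already has `w` on its tape. -/
theorem accept_or_path_of_xpath (hR : ∀ c c', R c c' → OutStep c c')
    (hacc : ∀ c c', R c c' → M[c.vertex]? ≠ some .accept) {d : ℕ → Config} {w : Cantor}
    (hc : (d 0).Blank) (hd : ∀ t, XStep M R (d t) (d (t + 1))) (hw : Writes d w) :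
    (∃ c', Relation.ReflTransGen R (d 0) c' ∧ M[c'.vertex]? = some .accept ∧ c'.tape 3 = w) ∨
      ∀ t, R (d t) (d (t + 1)) := by
  classical
  have hout := fun t => (hd t).outStep hR
  by_cases h : ∃ t, M[(d t).vertex]? = some .accept
  · left
    have hR' : ∀ t < Nat.find h, R (d t) (d (t + 1)) := fun t ht =>
      (hd t).resolve_right fun h' => Nat.find_min h ht h'.1
    have ha := Nat.find_spec h
    generalize Nat.find h = n at hR' ha
    refine ⟨d n, reflTransGen_of_path hR', ha, ?_⟩
    have hblank : ∀ t, (d t).Blank := by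
      intro t
      induction t with
      | zero => exact hc
      | succ t ih => exact (hout t).blank ih
    have hk : ∀ k, M[(d (n + k)).vertex]? = some .accept ∧ (d (n + k)).tape 3 = (d n).tape 3 := by
      intro k
      induction k with
      | zero => exact ⟨ha, rfl⟩
      | succ k ih =>
        have h1 := (hd (n + k)).resolve_left fun h' => hacc _ _ h' ih.1
        rw [← add_assoc, h1.2, (hblank _).idle_tape]
        exact ih
    funext p
    obtain ⟨t, ht⟩ := hw.1 (p + 1)
    have hm := (outPath_mono hout (show t ≤ n + t by omega)).1
    rw [← (hk t).2, hw.2 (n + t) p (by omega)]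
  · exact Or.inr fun t => (hd t).resolve_right fun h' => h ⟨t, h'.1⟩

/-- For a deterministic relation, a valid output is the same as a path that writes it. -/
theorem yields_iff (hR : ∀ c c', R c c' → OutStep c c')
    (hacc : ∀ c c', R c c' → M[c.vertex]? ≠ some .accept)
    (hdet : ∀ c a b, R c a → R c b → a = b) {c : Config} (hc : c.Blank) (w : Cantor) :
    M.Yields R c w ↔
      ∃ d : ℕ → Config, d 0 = c ∧ (∀ t, XStep M R (d t) (d (t + 1))) ∧ Writes d w := by
  classical
  constructor
  · rintro (⟨c', h1, h2, h3⟩ | ⟨d, hd, hw⟩)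
    · exact exists_xpath_of_accept hR hc h1 h2 h3
    -- `Yields` gives configurations for each head position but no path through them. By determinism
    -- all of them lie on the orbit of `c` under this successor function.
    · let nxt : Config → Config := fun c => if h : ∃ c', R c c' then h.choose else c
      have hnxt : ∀ a b, R a b → nxt a = b := by
        intro a b hab
        have h : ∃ c', R a c' := ⟨b, hab⟩
        simp only [nxt, h, dif_pos]
        exact hdet _ _ _ h.choose_spec hab
      let e : ℕ → Config := fun t => nxt^[t] c
      have hes : ∀ t, e (t + 1) = nxt (e t) := fun t => Function.iterate_succ_apply' _ _ _
      have hreach : ∀ c', Relation.ReflTransGen R c c' → ∃ t, e t = c' := by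
        intro c' h
        induction h with
        | refl => exact ⟨0, rfl⟩
        | tail _ hab ih =>
          obtain ⟨t, rfl⟩ := ih
          exact ⟨t + 1, (hes t).trans (hnxt _ _ hab)⟩
      have hout : ∀ t, OutStep (e t) (e (t + 1)) := by
        intro t
        rw [hes]
        by_cases h : ∃ c', R (e t) c'
        · obtain ⟨b, hb⟩ := h
          rw [hnxt _ _ hb]; exact hR _ _ hb
        · simp only [nxt, h, dif_neg, not_false_eq_true]; exact Or.inl ⟨rfl, rfl⟩
      have hu : ∀ m, ∃ t, m ≤ (e t).head 3 := by
        intro m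
        obtain ⟨t, ht⟩ := hreach _ (hd (c.head 3 + m) (by omega)).1
        exact ⟨t, by rw [ht, (hd (c.head 3 + m) (by omega)).2]; omega⟩
      -- If the orbit got stuck, it would be constant from there on, but its output head is
      -- unbounded.
      have hstep : ∀ t, R (e t) (e (t + 1)) := by
        intro t
        by_cases h : ∃ c', R (e t) c'
        · obtain ⟨b, hb⟩ := h
          rw [hes, hnxt _ _ hb]; exact hb
        · exfalso
          have hk : ∀ k, e (t + k) = e t := by
            intro k
            induction k with
            | zero => rfl
            | succ k ih =>
              rw [← add_assoc, hes, ih]; simp only [nxt, h, dif_neg, not_false_eq_true]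
          obtain ⟨s, hs⟩ := hu ((e t).head 3 + 1)
          have := (outPath_mono hout (show s ≤ t + s by omega)).1
          rw [hk] at this
          omega
      refine ⟨e, rfl, fun t => Or.inl (hstep t), hu, fun t p hp => ?_⟩
      -- The position `m` is beyond the head at time `t`, so the orbit reaches `d m` after time `t`,
      -- when cell `p` is final.
      obtain ⟨m, hm, hm'⟩ := ((eventually_tape_eq hw p).and
        (eventually_ge_atTop ((e t).head 3 + c.head 3 + 1))).exists
      obtain ⟨s, hs⟩ := hreach _ (hd m (by omega)).1
      have h2 := (hd m (by omega)).2
      rw [← hs] at h2 hm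
      have hts : t ≤ s := by
        by_contra hlt
        have := (outPath_mono hout (not_le.1 hlt).le).1
        omega
      rw [← hm, (outPath_mono hout hts).2 p hp]
  · rintro ⟨d, rfl, hd, hw⟩
    have hout := fun t => (hd t).outStep hR
    rcases accept_or_path_of_xpath hR hacc hc hd hw with h | h
    · exact Or.inl h
    · refine Or.inr ?_
      choose! s hs using fun m (hm : (d 0).head 3 ≤ m) => outPath_hits hout hw.1 m hm
      refine ⟨fun m => d (s m), fun m hm => ⟨reflTransGen_of_path fun t _ => h t, hs m hm⟩, ?_⟩
      rw [tendsto_pi_nhds]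
      intro p
      apply tendsto_nhds_of_eventually_eq
      filter_upwards [eventually_ge_atTop ((d 0).head 3 + p + 1)] with m hm
      exact hw.2 _ p (by rw [hs m (by omega)]; omega)

end Paths

/-! ### Paths of deterministic and nondeterministic machines -/

namespace Machine

theorem step_outStep (M : Machine) {c c' : Config} (h : M.step c = some c') : OutStep c c' := by
  unfold step at h
  split at h
  · cases h; exact Or.inl ⟨rfl, rfl⟩
  · cases h; exact Or.inl ⟨rfl, rfl⟩
  · rename_i i q hv
    split_ifs at h
    cases h; left; fin_cases i <;> simp
  · rename_i i q hv
    cases h; left; fin_cases i <;> simp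
  · rename_i i b q hv
    cases h
    fin_cases i
    · left; simp
    · left; simp
    · right
      exact ⟨b, by simp [show (Fin.succ 2 : Fin 4) = 3 from rfl],
        by simp [show (Fin.succ 2 : Fin 4) = 3 from rfl]⟩
  · cases h

theorem step_not_accept (M : Machine) {c c' : Config} (h : M.step c = some c') :
    M[c.vertex]? ≠ some .accept := by
  intro h'
  simp [step, h'] at h

theorem nondetStep_outStep (M : Machine) {c c' : Config} (h : M.nondetStep c c') :
    OutStep c c' := by
  rcases h with h | ⟨q0, q1, -, rfl | rfl⟩
  · exact M.step_outStep h
  · exact Or.inl ⟨rfl, rfl⟩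
  · exact Or.inl ⟨rfl, rfl⟩

theorem nondetStep_not_accept (M : Machine) {c c' : Config} (h : M.nondetStep c c') :
    M[c.vertex]? ≠ some .accept := by
  rcases h with h | ⟨q0, q1, h, -⟩
  · exact M.step_not_accept h
  · simp [h]

theorem blank_init (x : Cantor) : (Config.init x).Blank := by
  intro p _; simp [Config.init]

theorem blank_spawn (c : Config) (q : ℕ) : (c.spawn q).Blank := by
  intro p _; simp [Config.spawn]

theorem nondetOutputs_iff (M : Machine) (x w : Cantor) :
    M.NondetOutputs x w ↔ ∃ d : ℕ → Config, d 0 = Config.init x ∧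
      (∀ t, XStep M M.nondetStep (d t) (d (t + 1))) ∧ Writes d w := by
  have hR := fun c c' (h : M.nondetStep c c') => M.nondetStep_outStep h
  constructor
  · rintro (⟨c', h1, h2, h3⟩ | ⟨d, h0, hd, hu, hw⟩)
    · exact exists_xpath_of_accept hR (blank_init x) h1 h2 h3
    · exact ⟨d, h0, fun t => Or.inl (hd t), writes_of_tendsto (fun t => hR _ _ (hd t))
        (fun m => (hu m).imp fun t ht => ht.ge) hw⟩
  · rintro ⟨d, h0, hd, hw⟩
    have hout := fun t => (hd t).outStep hR
    rcases accept_or_path_of_xpath hR (fun c c' h => M.nondetStep_not_accept h)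
      (h0 ▸ blank_init x) hd hw with h | h
    · exact Or.inl (h0 ▸ h)
    · exact Or.inr ⟨d, h0, h, fun m => outPath_hits hout hw.1 m (by rw [h0]; simp [Config.init]),
        hw.tendsto hout⟩

theorem accepts_iff (M : Machine) (p : Cantor) :
    M.Accepts p ↔ ∃ (w : Cantor) (d : ℕ → Config), d 0 = Config.init p ∧
      (∀ t, XStep M (fun c c' => M.step c = some c') (d t) (d (t + 1))) ∧ Writes d w :=
  exists_congr fun w => yields_iff (fun _ _ h => M.step_outStep h)
    (fun _ _ h => M.step_not_accept h)
    (fun _ _ _ h h' => Option.some_injective _ (h.symm.trans h')) (blank_init p) w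

theorem nondetStep_iff_step {M : Machine} (hM : ∀ q0 q1, Vertex.guess q0 q1 ∉ M) (c c' : Config) :
    M.nondetStep c c' ↔ M.step c = some c' := by
  refine ⟨fun h => h.resolve_right ?_, Or.inl⟩
  rintro ⟨q0, q1, h, -⟩
  exact hM q0 q1 (List.mem_of_getElem? h)

/-- With this the analysis of machines working in rounds has to be made only for nondeterministic
runs. -/
theorem accepts_iff_nondetOutputs {M : Machine} (hM : ∀ q0 q1, Vertex.guess q0 q1 ∉ M)
    (p : Cantor) : M.Accepts p ↔ ∃ w, M.NondetOutputs p w := by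
  have : M.nondetStep = fun c c' => M.step c = some c' := by
    funext c c'; exact propext (nondetStep_iff_step hM c c')
  simp only [accepts_iff, nondetOutputs_iff, this]

end Machine

/-! ### A programming language and its compilation to vertices -/

/-- Straight-line programs with loops over two stacks of bits, which are kept on the working
tapes below their heads. -/
inductive Prog : Type
  | skip
  /-- push a bit on a stack -/
  | push (i : Fin 2) (b : Bool)
  /-- pop a bit from a stack; as long as this bit is `1`, run the body and repeat -/
  | whilePop (i : Fin 2) (B : Prog)
  | seq (P Q : Prog)
  /-- push the next bit of the input, as a number, on stack `0` -/
  | readBit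
  /-- append a bit to the output -/
  | out (b : Bool)

namespace Prog

/-- The number of vertices of the compiled program. -/
def size : Prog → ℕ
  | skip => 1
  | push _ _ => 1
  | whilePop _ B => B.size + 2
  | seq P Q => P.size + Q.size
  | readBit => 4
  | out _ => 1

/-- The vertices of the compiled program with entry `a` and exit `e`; the vertices are numbered
from `a` on. -/
def code : Prog → ℕ → ℕ → List Vertex
  -- A test with equal branches serves as a jump.
  | skip, _, e => [.test 0 e e]
  | push i b, _, e => [.write i.castSucc b e]
  -- Popping is moving left and testing; the popped cell need not be erased. The body exits to `a`,
  -- where the next bit is popped.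
  | whilePop i B, a, e => .left i.succ (a + 1) :: .test i.succ e (a + 2) :: B.code (a + 2) a
  | seq P Q, a, e => P.code a (a + P.size) ++ Q.code (a + P.size) e
  -- A number in unary is a block of ones on top of a terminating zero: the zero is pushed first,
  -- then a one if the input bit is `1`.
  | readBit, a, e => [.write 0 false (a + 1), .test 0 (a + 3) (a + 2), .write 0 true (a + 3),
      .right 0 e]
  | out b, _, e => [.write 2 b e]

theorem length_code (P : Prog) (a e : ℕ) : (P.code a e).length = P.size := by
  induction P generalizing a e with
  | whilePop i B ih => simp [code, size, ih]
  | seq P Q ihP ihQ => simp [code, size, ihP, ihQ]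
  | _ => rfl

theorem size_pos (P : Prog) : 0 < P.size := by
  induction P with
  | seq P Q ihP ihQ => simp only [size]; omega
  | _ => simp [size]

theorem succs_code (P : Prog) (a e : ℕ) : ∀ v ∈ P.code a e, ∀ q ∈ v.succs,
    (a ≤ q ∧ q < a + P.size) ∨ q = e := by
  induction P generalizing a e with
  | whilePop i B ih =>
    intro v hv q hq
    have := B.size_pos
    simp only [code, List.mem_cons] at hv
    simp only [size]
    rcases hv with rfl | rfl | hv
    · simp only [Vertex.succs, List.mem_cons, List.not_mem_nil, or_false] at hq; omega
    · simp only [Vertex.succs, List.mem_cons, List.not_mem_nil, or_false] at hq; omega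
    · rcases ih _ _ v hv q hq with h | h <;> omega
  | seq P Q ihP ihQ =>
    intro v hv q hq
    have := Q.size_pos
    simp only [code, List.mem_append] at hv
    simp only [size]
    rcases hv with hv | hv
    · rcases ihP _ _ v hv q hq with h | h <;> omega
    · rcases ihQ _ _ v hv q hq with h | h <;> omega
  | _ =>
    intro v hv q hq
    simp only [code, List.mem_cons, List.not_mem_nil, or_false] at hv
    simp only [size]
    rcases hv with rfl | rfl | rfl | rfl <;>
      (simp only [Vertex.succs, List.mem_cons, List.not_mem_nil, or_false] at hq; omega)

/-- The labels `s`, `?` and `guess` do not occur. -/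
def _root_.TypeTwo.Vertex.IsPlain : Vertex → Prop
  | .start _ => False
  | .query _ _ => False
  | .guess _ _ => False
  | _ => True

theorem isPlain_code (P : Prog) (a e : ℕ) : ∀ v ∈ P.code a e, v.IsPlain := by
  induction P generalizing a e with
  | whilePop i B ih =>
    intro v hv
    simp only [code, List.mem_cons] at hv
    rcases hv with rfl | rfl | hv
    · trivial
    · trivial
    · exact ih _ _ v hv
  | seq P Q ihP ihQ =>
    intro v hv
    simp only [code, List.mem_append] at hv
    rcases hv with hv | hv
    · exact ihP _ _ v hv
    · exact ihQ _ _ v hv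
  | _ =>
    intro v hv
    simp only [code, List.mem_cons, List.not_mem_nil, or_false] at hv
    rcases hv with rfl | rfl | rfl | rfl <;> trivial

theorem accept_notMem_code (P : Prog) (a e : ℕ) : Vertex.accept ∉ P.code a e := by
  induction P generalizing a e with
  | whilePop i B ih => simp [code, ih]
  | seq P Q ihP ihQ => simp [code, ihP, ihQ]
  | _ => simp [code]

end Prog

/-! ### Semantics of programs -/

/-- The cells of the tape below the position `h` hold the stack `l`, its top next to `h`. -/
def Stk (tape : Cantor) : ℕ → List Bool → Prop
  | h, [] => h = 0
  | h, b :: l => ∃ k, h = k + 1 ∧ tape k = b ∧ Stk tape k l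

/-- Only cells below the head matter, so a push and what a pop leaves behind do no harm to the
stack. -/
theorem Stk.congr {t t' : Cantor} {h : ℕ} {l : List Bool} (hs : Stk t h l)
    (ht : ∀ p < h, t' p = t p) : Stk t' h l := by
  induction l generalizing h with
  | nil => exact hs
  | cons b l ih =>
    obtain ⟨k, rfl, hb, hk⟩ := hs
    exact ⟨k, rfl, (ht k (by omega)).trans hb, ih hk fun p hp => ht p (by omega)⟩

/-- What a program sees: two stacks, the input with the position on it, the output so far. -/
structure St : Type where
  stk : Fin 2 → List Bool
  x : Cantor
  pos : ℕ
  out : List Bool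

/-- The first bits of the output tape are `l`, and its head is behind them. -/
def OutRel (c : Config) (l : List Bool) : Prop :=
  c.head 3 = l.length ∧ ∀ p b, l[p]? = some b → c.tape 3 p = b

/-- The configuration `c` represents the state `s`. -/
structure St.Rel (s : St) (c : Config) : Prop where
  inp : c.tape 0 = s.x
  pos : c.head 0 = s.pos
  stk : ∀ i : Fin 2, Stk (c.tape i.castSucc.succ) (c.head i.castSucc.succ) (s.stk i)
  out : OutRel c s.out

/-- Deterministic reachability. -/
def Machine.Reach (M : Machine) : Config → Config → Prop :=
  Relation.ReflTransGen fun c c' => M.step c = some c'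

/-- The list `L` of vertices is found in `M` from number `a` on. -/
def CodeAt (M : Machine) (a : ℕ) (L : List Vertex) : Prop :=
  ∀ k v, L[k]? = some v → M[a + k]? = some v

theorem codeAt_cons {M : Machine} {a : ℕ} {v : Vertex} {L : List Vertex} :
    CodeAt M a (v :: L) ↔ M[a]? = some v ∧ CodeAt M (a + 1) L := by
  constructor
  · intro h
    refine ⟨h 0 v rfl, fun k u hk => ?_⟩
    rw [show a + 1 + k = a + (k + 1) by omega]
    exact h (k + 1) u (by simpa using hk)
  · rintro ⟨h0, h1⟩ k u hk
    cases k with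
    | zero => simp only [List.getElem?_cons_zero] at hk; cases hk; exact h0
    | succ k =>
      rw [show a + (k + 1) = a + 1 + k by omega]
      exact h1 k u (by simpa using hk)

theorem CodeAt.left {M : Machine} {a : ℕ} {L L' : List Vertex} (h : CodeAt M a (L ++ L')) :
    CodeAt M a L := fun k v hk => h k v (by
  rw [List.getElem?_append_left (List.getElem?_eq_some_iff.1 hk).1]; exact hk)

theorem CodeAt.right {M : Machine} {a : ℕ} {L L' : List Vertex} (h : CodeAt M a (L ++ L')) :
    CodeAt M (a + L.length) L' := fun k v hk => by
  rw [add_assoc]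
  exact h _ v (by rw [List.getElem?_append_right (by omega)]; simpa using hk)

theorem codeAt_append_self (L L' L'' : List Vertex) : CodeAt (L ++ L' ++ L'') L.length L' := by
  intro k v hk
  have := (List.getElem?_eq_some_iff.1 hk).1
  rw [List.append_assoc, List.getElem?_append_right (by omega), Nat.add_sub_cancel_left,
    List.getElem?_append_left this, hk]

/-- Wherever it is placed, the program `P` leads from the state `s` to the state `s'`. -/
def Spec (P : Prog) (s s' : St) : Prop :=
  ∀ (M : Machine) (a e : ℕ), CodeAt M a (P.code a e) → ∀ c : Config, c.vertex = a → s.Rel c →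
    ∃ c', M.Reach c c' ∧ c'.vertex = e ∧ s'.Rel c'

theorem step_of_vertex {M : Machine} {c : Config} {v : Vertex} {a : ℕ} (hc : c.vertex = a)
    (h : M[a]? = some v) : M[c.vertex]? = some v := hc ▸ h

theorem St.Rel.congr_out {s : St} {c c' : Config} (h : OutRel c s.out)
    (h1 : c'.head 3 = c.head 3) (h2 : c'.tape 3 = c.tape 3) : OutRel c' s.out := by
  unfold OutRel; rw [h1, h2]; exact h

theorem Machine.step_write {M : Machine} {c : Config} {i : Fin 3} {b : Bool} {q : ℕ}
    (h : M[c.vertex]? = some (.write i b q)) : M.step c = some { c with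
      vertex := q
      tape := Function.update c.tape i.succ
        (Function.update (c.tape i.succ) (c.head i.succ) b)
      head := Function.update c.head i.succ (c.head i.succ + 1) } := by
  simp only [step, h]

theorem Machine.step_right {M : Machine} {c : Config} {i : Fin 3} {q : ℕ}
    (h : M[c.vertex]? = some (.right i q)) : M.step c = some { c with
      vertex := q
      head := Function.update c.head i.castSucc (c.head i.castSucc + 1) } := by
  simp only [step, h]

theorem Machine.step_test {M : Machine} {c : Config} {i : Fin 3} {q0 q1 : ℕ}
    (h : M[c.vertex]? = some (.test i q0 q1)) : M.step c = some { c with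
      vertex := if c.tape i.castSucc (c.head i.castSucc) then q1 else q0 } := by
  simp only [step, h]

theorem spec_skip (s : St) : Spec .skip s s := by
  intro M a e hM c hc hs
  obtain ⟨h0, -⟩ := codeAt_cons.1 hM
  refine ⟨{ c with vertex := e }, .single ?_, rfl, ⟨hs.inp, hs.pos, hs.stk, hs.out⟩⟩
  simp [Machine.step, step_of_vertex hc h0]

theorem spec_push (i : Fin 2) (b : Bool) (s : St) :
    Spec (.push i b) s { s with stk := Function.update s.stk i (b :: s.stk i) } := by
  intro M a e hM c hc hs
  obtain ⟨h0, -⟩ := codeAt_cons.1 hM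
  refine ⟨_, .single (Machine.step_write (step_of_vertex hc h0)), rfl, ?_, ?_, ?_, ?_⟩
  · fin_cases i <;> simpa using hs.inp
  · fin_cases i <;> simpa using hs.pos
  · intro j
    by_cases hj : j = i
    · subst hj
      simp only [Function.update_self]
      exact ⟨_, rfl, by simp, (hs.stk j).congr fun p hp => Function.update_of_ne (by omega) _ _⟩
    · have hj' : (j.castSucc.succ : Fin 4) ≠ i.castSucc.succ := by
        simpa [Fin.ext_iff] using hj
      simp only [Function.update_of_ne hj', Function.update_of_ne hj]
      exact hs.stk j
  · refine St.Rel.congr_out hs.out ?_ ?_ <;> fin_cases i <;> simp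

theorem spec_out (b : Bool) (s : St) : Spec (.out b) s { s with out := s.out ++ [b] } := by
  intro M a e hM c hc hs
  obtain ⟨h0, -⟩ := codeAt_cons.1 hM
  refine ⟨_, .single (Machine.step_write (step_of_vertex hc h0)), rfl, ?_, ?_, ?_, ?_⟩
  · simpa using hs.inp
  · simpa using hs.pos
  · intro j
    have := hs.stk j
    fin_cases j <;> simpa using this
  · have h3 : (Fin.succ 2 : Fin 4) = 3 := rfl
    refine ⟨by simp [h3, hs.out.1], fun p d hp => ?_⟩
    simp only [h3, Function.update_self, hs.out.1]
    rcases lt_trichotomy p s.out.length with h | rfl | h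
    · rw [Function.update_of_ne (by omega)]
      exact hs.out.2 p d (by rwa [List.getElem?_append_left h] at hp)
    · simpa using hp
    · rw [List.getElem?_eq_none (by simp; omega)] at hp; cases hp

theorem spec_readBit (s : St) : Spec .readBit s
    { s with stk := Function.update s.stk 0
               (List.replicate (s.x s.pos).toNat true ++ false :: s.stk 0), pos := s.pos + 1 } := by
  intro M a e hM c hc hs
  simp only [Prog.code] at hM
  -- Each of the two writing vertices is by itself a compiled `push`.
  have hw : ∀ (b' : Bool) (a' e' : ℕ) (s' : St), M[a']? = some (.write 0 b' e') →
      ∀ c : Config, c.vertex = a' →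
      s'.Rel c → ∃ c', M.Reach c c' ∧ c'.vertex = e' ∧
        St.Rel { s' with stk := Function.update s'.stk 0 (b' :: s'.stk 0) } c' :=
    fun b' a' e' s' h => spec_push 0 b' s' M a' e' fun k v hk => by
      cases k with
      | zero => simp only [Prog.code, List.getElem?_cons_zero] at hk; cases hk; exact h
      | succ k => simp [Prog.code] at hk
  rw [codeAt_cons, codeAt_cons, codeAt_cons, codeAt_cons] at hM
  obtain ⟨h0, h1, h2, h3, -⟩ := hM
  obtain ⟨c1, hr1, hv1, hs1⟩ := hw _ _ _ _ h0 c hc hs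
  have hfin : ∀ (c : Config) (s : St), c.vertex = a + 3 → s.Rel c →
      ∃ c', M.Reach c c' ∧ c'.vertex = e ∧ St.Rel { s with pos := s.pos + 1 } c' := by
    intro c s hc hs
    refine ⟨_, .single (Machine.step_right (step_of_vertex hc h3)), rfl, ?_, ?_, ?_, ?_⟩
    · exact hs.inp
    · simp [hs.pos]
    · intro j
      have := hs.stk j
      fin_cases j <;> simpa using this
    · exact St.Rel.congr_out hs.out (by simp) rfl
  have hst : M.step c1 = some { c1 with vertex := if s.x s.pos then a + 2 else a + 3 } := by
    have e1 := hs1.inp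
    have e2 := hs1.pos
    simp [Machine.step, step_of_vertex hv1 h1, e1, e2]
  cases hb : s.x s.pos
  · obtain ⟨c3, hr3, hv3, hs3⟩ := hfin { c1 with vertex := a + 3 } _ rfl
      ⟨hs1.inp, hs1.pos, hs1.stk, hs1.out⟩
    refine ⟨c3, hr1.trans (.head (by simpa [hb] using hst) hr3), hv3, ?_⟩
    simpa using hs3
  · obtain ⟨c2, hr2, hv2, hs2⟩ := hw _ _ _ _ h2 { c1 with vertex := a + 2 } rfl
      ⟨hs1.inp, hs1.pos, hs1.stk, hs1.out⟩
    obtain ⟨c3, hr3, hv3, hs3⟩ := hfin c2 _ hv2 hs2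
    refine ⟨c3, hr1.trans (.head (by simpa [hb] using hst) (hr2.trans hr3)), hv3, ?_⟩
    simpa using hs3

theorem Spec.seq {P Q : Prog} {s s' s'' : St} (hP : Spec P s s') (hQ : Spec Q s' s'') :
    Spec (.seq P Q) s s'' := by
  intro M a e hM c hc hs
  obtain ⟨c1, hr1, hv1, hs1⟩ := hP M a _ hM.left c hc hs
  have h2 := hM.right
  rw [Prog.length_code] at h2
  obtain ⟨c2, hr2, hv2, hs2⟩ := hQ M _ e h2 c1 hv1 hs1
  exact ⟨c2, hr1.trans hr2, hv2, hs2⟩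

theorem reach_pop {M : Machine} {i : Fin 2} {a q q0 q1 : ℕ}
    (h0 : M[a]? = some (.left i.succ q)) (h1 : M[q]? = some (.test i.succ q0 q1)) {c : Config}
    (hc : c.vertex = a) {s : St} (hs : s.Rel c) {b : Bool} {l : List Bool} (hl : s.stk i = b :: l) :
    ∃ c', M.Reach c c' ∧ c'.vertex = (if b then q1 else q0) ∧
      St.Rel { s with stk := Function.update s.stk i l } c' := by
  have hk := hs.stk i
  rw [hl, Fin.succ_castSucc] at hk
  obtain ⟨k, hk, hb, ht⟩ := hk
  refine ⟨⟨if b then q1 else q0, c.tape, Function.update c.head i.succ.castSucc k⟩, ?_, rfl,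
    ?_, ?_, ?_, ?_⟩
  · refine .head (b := { c with vertex := q, head := Function.update c.head i.succ.castSucc k }) ?_
      (.single ?_)
    · simp [Machine.step, step_of_vertex hc h0, hk, -Fin.castSucc_succ]
    · simp [Machine.step, h1, hb, -Fin.castSucc_succ]
  · exact hs.inp
  · have := hs.pos
    fin_cases i <;> simpa using this
  · intro j
    by_cases hj : j = i
    · subst hj
      simp only [Function.update_self, Fin.succ_castSucc]
      exact ht
    · have hj' : (j.castSucc.succ : Fin 4) ≠ i.succ.castSucc := by
        rw [← Fin.succ_castSucc]
        simpa [Fin.ext_iff] using hj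
      simp only [Function.update_of_ne hj', Function.update_of_ne hj]
      exact hs.stk j
  · refine St.Rel.congr_out hs.out ?_ rfl
    fin_cases i <;> simp

theorem spec_whilePop_false {i : Fin 2} {B : Prog} {s : St} {l : List Bool}
    (hl : s.stk i = false :: l) :
    Spec (.whilePop i B) s { s with stk := Function.update s.stk i l } := by
  intro M a e hM c hc hs
  simp only [Prog.code] at hM
  rw [codeAt_cons, codeAt_cons] at hM
  simpa using reach_pop hM.1 hM.2.1 hc hs hl

/-- Together with `spec_whilePop_false` this is a big-step semantics of the loop; termination comes
from inductions over the number of passes. -/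
theorem spec_whilePop_true {i : Fin 2} {B : Prog} {s s' s'' : St} {l : List Bool}
    (hl : s.stk i = true :: l)
    (hB : Spec B { s with stk := Function.update s.stk i l } s')
    (hW : Spec (.whilePop i B) s' s'') : Spec (.whilePop i B) s s'' := by
  intro M a e hM c hc hs
  have hM' := hM
  simp only [Prog.code] at hM'
  rw [codeAt_cons, codeAt_cons] at hM'
  obtain ⟨c1, hr1, hv1, hs1⟩ := reach_pop hM'.1 hM'.2.1 hc hs hl
  obtain ⟨c2, hr2, hv2, hs2⟩ := hB M _ _ hM'.2.2 c1 (by simpa using hv1) hs1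
  obtain ⟨c3, hr3, hv3, hs3⟩ := hW M a e hM c2 hv2 hs2
  exact ⟨c3, hr1.trans (hr2.trans hr3), hv3, hs3⟩

/-! ### Stacks of numbers -/

/-- A stack of numbers, each written in unary, as a stack of bits. -/
def enc : List ℕ → List Bool
  | [] => []
  | n :: l => List.replicate n true ++ false :: enc l

/-- `P` turns the stacks of numbers `u` and `v` into `u'` and `v'`, without touching anything
else. -/
def PSpec (P : Prog) (u v u' v' : List ℕ) : Prop :=
  ∀ x pos out, Spec P ⟨![enc u, enc v], x, pos, out⟩ ⟨![enc u', enc v'], x, pos, out⟩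

theorem update_zero {α : Type*} (a b c : α) : Function.update ![a, b] 0 c = ![c, b] := by
  funext i; fin_cases i <;> rfl

theorem update_one {α : Type*} (a b c : α) : Function.update ![a, b] 1 c = ![a, c] := by
  funext i; fin_cases i <;> rfl

theorem PSpec.seq {P Q : Prog} {u v u' v' u'' v'' : List ℕ} (h : PSpec P u v u' v')
    (h' : PSpec Q u' v' u'' v'') : PSpec (.seq P Q) u v u'' v'' :=
  fun x pos out => (h x pos out).seq (h' x pos out)

theorem pspec_skip (u v : List ℕ) : PSpec .skip u v u v := fun _ _ _ => spec_skip _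

theorem pspec_push0 (u v : List ℕ) : PSpec (.push 0 false) u v (0 :: u) v := fun x pos out => by
  simpa [update_zero, enc] using spec_push 0 false ⟨![enc u, enc v], x, pos, out⟩

theorem pspec_push1 (u v : List ℕ) : PSpec (.push 1 false) u v u (0 :: v) := fun x pos out => by
  simpa [update_one, enc] using spec_push 1 false ⟨![enc u, enc v], x, pos, out⟩

theorem pspec_inc0 (n : ℕ) (u v : List ℕ) : PSpec (.push 0 true) (n :: u) v ((n + 1) :: u) v :=
  fun x pos out => by
    simpa [update_zero, enc, List.replicate_succ] using
      spec_push 0 true ⟨![enc (n :: u), enc v], x, pos, out⟩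

theorem pspec_inc1 (n : ℕ) (u v : List ℕ) : PSpec (.push 1 true) u (n :: v) u ((n + 1) :: v) :=
  fun x pos out => by
    simpa [update_one, enc, List.replicate_succ] using
      spec_push 1 true ⟨![enc u, enc (n :: v)], x, pos, out⟩

/-- The loop counter is the top number itself. The families `u` and `v` are indexed by the number of
passes still to come, which the body finds on top and must leave there. -/
theorem pspec_while0 {B : Prog} {n : ℕ} (u v : ℕ → List ℕ)
    (hB : ∀ k < n, PSpec B (k :: u (k + 1)) (v (k + 1)) (k :: u k) (v k)) :
    PSpec (.whilePop 0 B) (n :: u n) (v n) (u 0) (v 0) := by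
  induction n with
  | zero =>
    intro x pos out
    simpa [update_zero] using spec_whilePop_false (i := 0) (B := B)
      (s := ⟨![enc (0 :: u 0), enc (v 0)], x, pos, out⟩) (l := enc (u 0)) rfl
  | succ n ih =>
    intro x pos out
    refine spec_whilePop_true (l := enc (n :: u (n + 1))) rfl ?_
      (ih (fun k hk => hB k (by omega)) x pos out)
    simpa [update_zero] using hB n (by omega) x pos out

theorem pspec_while1 {B : Prog} {n : ℕ} (u v : ℕ → List ℕ)
    (hB : ∀ k < n, PSpec B (u (k + 1)) (k :: v (k + 1)) (u k) (k :: v k)) :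
    PSpec (.whilePop 1 B) (u n) (n :: v n) (u 0) (v 0) := by
  induction n with
  | zero =>
    intro x pos out
    simpa [update_one] using spec_whilePop_false (i := 1) (B := B)
      (s := ⟨![enc (u 0), enc (0 :: v 0)], x, pos, out⟩) (l := enc (v 0)) rfl
  | succ n ih =>
    intro x pos out
    refine spec_whilePop_true (l := enc (n :: v (n + 1))) rfl ?_
      (ih (fun k hk => hB k (by omega)) x pos out)
    simpa [update_one] using hB n (by omega) x pos out

namespace Prog

/-- Move the top number from stack `0` to stack `1`. -/
def move01 : Prog := seq (push 1 false) (whilePop 0 (push 1 true))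

/-- Move the top number from stack `1` to stack `0`. -/
def move10 : Prog := seq (push 0 false) (whilePop 1 (push 0 true))

/-- Remove the top number of stack `0`. -/
def drop : Prog := whilePop 0 skip

/-- Remove the number below the top of stack `0`. -/
def nip : Prog := seq move01 (seq drop move10)

/-- Increment the number below the top of stack `0`. -/
def incBelow : Prog := seq move01 (seq (push 0 true) move10)

/-- Duplicate the top number of stack `0`. -/
def dup : Prog :=
  seq move01 (seq (push 0 false) (seq (push 0 false) (whilePop 1 (seq (push 0 true) incBelow))))

/-- Move the top number of stack `1` below the top of stack `0`. -/
def insertBelow : Prog :=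
  seq move01 (seq (push 0 false) (seq move10 (whilePop 1 incBelow)))

/-- Push a copy of the `k`-th number of stack `0`. -/
def copy : ℕ → Prog
  | 0 => dup
  | k + 1 => seq move01 (seq (copy k) insertBelow)

/-- Remove the `k` numbers below the top of stack `0`. -/
def nips : ℕ → Prog
  | 0 => skip
  | k + 1 => seq nip (nips k)

end Prog

open Prog

theorem pspec_move01 (n : ℕ) (u v : List ℕ) : PSpec move01 (n :: u) v u (n :: v) := by
  refine (pspec_push1 _ _).seq ?_
  simpa using pspec_while0 (n := n) (fun _ => u) (fun k => (n - k) :: v) fun k hk => by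
    have := pspec_inc1 (n - (k + 1)) (k :: u) v
    rwa [show n - (k + 1) + 1 = n - k by omega] at this

theorem pspec_move10 (n : ℕ) (u v : List ℕ) : PSpec move10 u (n :: v) (n :: u) v := by
  refine (pspec_push0 _ _).seq ?_
  simpa using pspec_while1 (n := n) (fun k => (n - k) :: u) (fun _ => v) fun k hk => by
    have := pspec_inc0 (n - (k + 1)) u (k :: v)
    rwa [show n - (k + 1) + 1 = n - k by omega] at this

theorem pspec_drop (n : ℕ) (u v : List ℕ) : PSpec drop (n :: u) v u v :=
  pspec_while0 (n := n) (fun _ => u) (fun _ => v) fun _ _ => pspec_skip _ _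

theorem pspec_nip (m n : ℕ) (u v : List ℕ) : PSpec nip (m :: n :: u) v (m :: u) v :=
  (pspec_move01 _ _ _).seq ((pspec_drop _ _ _).seq (pspec_move10 _ _ _))

theorem pspec_incBelow (m n : ℕ) (u v : List ℕ) :
    PSpec incBelow (m :: n :: u) v (m :: (n + 1) :: u) v :=
  (pspec_move01 _ _ _).seq ((pspec_inc0 _ _ _).seq (pspec_move10 _ _ _))

theorem pspec_dup (n : ℕ) (u v : List ℕ) : PSpec dup (n :: u) v (n :: n :: u) v := by
  refine (pspec_move01 _ _ _).seq ((pspec_push0 _ _).seq ((pspec_push0 _ _).seq ?_))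
  simpa using pspec_while1 (n := n) (fun k => (n - k) :: (n - k) :: u) (fun _ => v) fun k hk => by
    have h := (pspec_inc0 (n - (k + 1)) ((n - (k + 1)) :: u) (k :: v)).seq
      (pspec_incBelow _ _ _ _)
    rwa [show n - (k + 1) + 1 = n - k by omega] at h

theorem pspec_insertBelow (m n : ℕ) (u v : List ℕ) :
    PSpec insertBelow (m :: u) (n :: v) (m :: n :: u) v := by
  refine (pspec_move01 _ _ _).seq ((pspec_push0 _ _).seq ((pspec_move10 _ _ _).seq ?_))
  simpa using pspec_while1 (n := n) (fun k => m :: (n - k) :: u) (fun _ => v) fun k hk => by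
    have h := pspec_incBelow m (n - (k + 1)) u (k :: v)
    rwa [show n - (k + 1) + 1 = n - k by omega] at h

theorem pspec_copy (k n : ℕ) (u v : List ℕ) (h : u[k]? = some n) :
    PSpec (copy k) u v (n :: u) v := by
  induction k generalizing u v with
  | zero =>
    cases u with
    | nil => simp at h
    | cons a u => simp only [List.getElem?_cons_zero] at h; cases h; exact pspec_dup _ _ _
  | succ k ih =>
    cases u with
    | nil => simp at h
    | cons a u =>
      exact (pspec_move01 _ _ _).seq ((ih u _ (by simpa using h)).seq (pspec_insertBelow _ _ _ _))

theorem pspec_nips (m : ℕ) (l u v : List ℕ) :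
    PSpec (nips l.length) (m :: (l ++ u)) v (m :: u) v := by
  induction l with
  | nil => exact pspec_skip _ _
  | cons a l ih => exact (pspec_nip _ _ _ _).seq ih

/-! ### Compilation of primitive recursive functions -/

/-- `P` pushes the value of `f` at the numbers found at the places `idx` of stack `0`. -/
def Pushes {n : ℕ} (f : List.Vector ℕ n → ℕ) (idx : Fin n → ℕ) (P : Prog) : Prop :=
  ∀ (w : List.Vector ℕ n) (u v : List ℕ), (∀ j, u[idx j]? = some (w.get j)) →
    PSpec P u v (f w :: u) v

theorem exists_pushes_ofFn {m : ℕ} : ∀ {n : ℕ} (g : Fin n → List.Vector ℕ m → ℕ),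
    (∀ i idx, ∃ P, Pushes (g i) idx P) → ∀ idx : Fin m → ℕ, ∃ P : Prog,
    ∀ (w : List.Vector ℕ m) (u v : List ℕ), (∀ j, u[idx j]? = some (w.get j)) →
    PSpec P u v ((List.ofFn fun i => g i w).reverse ++ u) v
  | 0, _, _, _ => ⟨skip, fun _ u v _ => by simpa using pspec_skip u v⟩
  | n + 1, g, hg, idx => by
    obtain ⟨P, hP⟩ := exists_pushes_ofFn (fun i : Fin n => g i.castSucc) (fun i => hg _) idx
    -- The `n` values computed before lie on top of the arguments.
    obtain ⟨Q, hQ⟩ := hg (Fin.last n) fun j => n + idx j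
    refine ⟨seq P Q, fun w u v hw => ?_⟩
    rw [List.ofFn_succ', List.concat_eq_append, List.reverse_append]
    refine (hP w u v hw).seq (hQ w _ v fun j => ?_)
    rw [List.getElem?_append_right (by simp)]
    simpa using hw j

/-- Induction on the construction of `f`. Allowing arbitrary places `idx` for the arguments lets the
parts run while intermediate values lie on top of them. -/
theorem exists_pushes {n : ℕ} {f : List.Vector ℕ n → ℕ} (hf : Nat.Primrec' f) :
    ∀ idx : Fin n → ℕ, ∃ P, Pushes f idx P := by
  induction hf with
  | zero => exact fun _ => ⟨push 0 false, fun w u v _ => pspec_push0 u v⟩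
  | succ =>
    refine fun idx => ⟨seq (copy (idx 0)) (push 0 true), fun w u v hw => ?_⟩
    have := (pspec_copy (idx 0) _ u v (hw 0)).seq (pspec_inc0 _ _ _)
    rwa [List.Vector.get_zero] at this
  | get i => exact fun idx => ⟨copy (idx i), fun w u v hw => pspec_copy _ _ _ _ (hw i)⟩
  | @comp m n f g _ _ ihf ihg =>
    intro idx
    obtain ⟨P, hP⟩ := exists_pushes_ofFn g ihg idx
    -- The values of `g` were pushed one after the other, so the last one is on top.
    obtain ⟨Q, hQ⟩ := ihf fun j => n - 1 - j
    refine ⟨seq P (seq Q (nips n)), fun w u v hw => ?_⟩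
    refine (hP w u v hw).seq ((hQ (List.Vector.ofFn fun i => g i w) _ v fun j => ?_).seq ?_)
    · rw [List.getElem?_append_left (by simp; omega), List.getElem?_reverse (by simp; omega)]
      simp only [List.length_ofFn, List.Vector.get_ofFn]
      rw [List.getElem?_ofFn, dif_pos (by omega)]
      congr 2
      ext; simp; omega
    · have := pspec_nips (f (List.Vector.ofFn fun i => g i w))
        (List.ofFn fun i => g i w).reverse u v
      simpa using this
  | @prec n f g _ _ ihf ihg =>
    intro idx
    obtain ⟨P, hP⟩ := ihf fun j => idx j.succ + 1
    -- In the loop, stack `0` holds the value of the recursion at place `0`, the stage reached at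
    -- place `1`, and the arguments below these; stack `1` counts the passes to come.
    obtain ⟨Q, hQ⟩ := ihg (Fin.cons 1 (Fin.cons 0 fun j => idx j.succ + 2))
    refine ⟨seq (push 0 false) (seq P (seq (copy (idx 0 + 2)) (seq move01
      (seq (whilePop 1 (seq Q (seq nip incBelow))) nip)))), fun w u v hw => ?_⟩
    have hP' := hP w.tail (0 :: u) v fun j => by
      rw [List.Vector.get_tail_succ]; simpa using hw j.succ
    -- The value of the recursion at stage `k`; with `k` passes to come, the stage is `w.head - k`.
    let r : ℕ → ℕ := fun k => Nat.rec (f w.tail) (fun y IH => g (y ::ᵥ IH ::ᵥ w.tail)) k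
    refine (pspec_push0 _ _).seq (hP'.seq ((pspec_copy _ (w.get 0) _ _ (by simpa using hw 0)).seq
      ((pspec_move01 _ _ _).seq (PSpec.seq (u' := r w.head :: w.head :: u) (v' := v) ?_ ?_))))
    · rw [List.Vector.get_zero]
      have := pspec_while1 (B := seq Q (seq nip incBelow)) (n := w.head)
        (fun k => r (w.head - k) :: (w.head - k) :: u) (fun _ => v) fun k hk => by
          have e : w.head - k = w.head - (k + 1) + 1 := by omega
          generalize w.head - (k + 1) = m at e
          rw [e]
          have h1 := hQ (m ::ᵥ r m ::ᵥ w.tail) (r m :: m :: u) (k :: v) fun j => by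
            refine Fin.cases ?_ (fun j => Fin.cases ?_ (fun j => ?_) j) j
            · simp
            · rw [List.Vector.get_cons_succ]; simp
            · simp only [Fin.cons_succ, List.Vector.get_cons_succ, List.Vector.get_tail_succ]
              simpa using hw j.succ
          exact h1.seq ((pspec_nip _ _ _ _).seq (pspec_incBelow _ _ _ _))
      simpa [r] using this
    · exact pspec_nip _ _ _ _

/-! ### Spelled sequences and runs composed of rounds -/

/-- The increasing lists `L n` grow to the infinite sequence `w`. -/
def Spells (L : ℕ → List Bool) (w : Cantor) : Prop :=
  (∀ m, ∃ n, m ≤ (L n).length) ∧ ∀ n p b, (L n)[p]? = some b → w p = b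

theorem writes_iff_spells {d : ℕ → Config} {L : ℕ → List Bool} (h : ∀ t, OutRel (d t) (L t))
    (w : Cantor) : Writes d w ↔ Spells L w := by
  refine and_congr (forall_congr' fun m => exists_congr fun t => by rw [(h t).1])
    (forall_congr' fun t => ⟨fun H p b hp => ?_, fun H p hp => ?_⟩)
  · rw [← (h t).2 p b hp, H p (by rw [(h t).1]; exact (List.getElem?_eq_some_iff.1 hp).1)]
  · rw [(h t).1] at hp
    rw [(h t).2 p _ (List.getElem?_eq_getElem hp), H p _ (List.getElem?_eq_getElem hp)]

section Rounds

/-- The segments from `C n` to `C (n + 1)` are nonempty, so their concatenation is an infinite path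
which is at `C n` not before time `n`. -/
theorem exists_glued_path {R : Config → Config → Prop} {C : ℕ → Config}
    (h : ∀ n, Relation.TransGen R (C n) (C (n + 1))) :
    ∃ d : ℕ → Config, d 0 = C 0 ∧ (∀ t, R (d t) (d (t + 1))) ∧ ∀ n, ∃ t ≥ n, d t = C n := by
  have hp : ∀ n, ∃ (l : ℕ) (p : ℕ → Config), 0 < l ∧ p 0 = C n ∧ p l = C (n + 1) ∧
      ∀ i < l, R (p i) (p (i + 1)) := by
    intro n
    obtain ⟨b, hb, hr⟩ := Relation.TransGen.head'_iff.1 (h n)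
    obtain ⟨l, e, h0, hl, hs⟩ := exists_path_of_reflTransGen hr
    refine ⟨l + 1, fun i => Nat.casesOn i (C n) e, by omega, rfl, hl, fun i hi => ?_⟩
    cases i with
    | zero => rw [← h0] at hb; exact hb
    | succ i => exact hs i (by omega)
  choose l p hl h0 h1 hR using hp
  -- A time is represented by the number of a segment and the offset in it.
  let nxt : ℕ × ℕ → ℕ × ℕ := fun s => if s.2 + 1 < l s.1 then (s.1, s.2 + 1) else (s.1 + 1, 0)
  let q : ℕ → ℕ × ℕ := fun t => nxt^[t] (0, 0)
  have hq : ∀ t, q (t + 1) = nxt (q t) := fun t => Function.iterate_succ_apply' _ _ _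
  have hlt : ∀ t, (q t).2 < l (q t).1 := by
    intro t
    induction t with
    | zero => exact hl 0
    | succ t ih =>
      rw [hq]
      simp only [nxt]
      split_ifs with hi
      · exact hi
      · exact hl _
  have hin : ∀ t n, q t = (n, 0) → ∀ i < l n, q (t + i) = (n, i) := by
    intro t n ht i hi
    induction i with
    | zero => exact ht
    | succ i ih =>
      rw [← add_assoc, hq, ih (by omega)]
      simp [nxt, hi]
  have hto : ∀ n, ∃ t ≥ n, q t = (n, 0) := by
    intro n
    induction n with
    | zero => exact ⟨0, le_rfl, rfl⟩
    | succ n ih =>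
      obtain ⟨t, ht, hqt⟩ := ih
      have hln := hl n
      refine ⟨t + (l n - 1) + 1, by omega, ?_⟩
      rw [hq, hin t n hqt _ (by omega)]
      simp [nxt, Nat.sub_add_cancel hln]
  refine ⟨fun t => p (q t).1 (q t).2, h0 0, fun t => ?_, fun n => ?_⟩
  · have := hR _ _ (hlt t)
    simp only [hq, nxt]
    split_ifs with hi
    · exact this
    · have hle := hlt t
      rw [show (q t).2 + 1 = l (q t).1 by omega, h1] at this
      simpa only [h0] using this
  · obtain ⟨t, ht, hqt⟩ := hto n
    exact ⟨t, ht, by simp only [hqt, h0]⟩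

/-- Where a deterministic step exists there is no choice, so every infinite nondeterministic run
follows it. -/
theorem exists_eq_of_reach {M : Machine} {d : ℕ → Config}
    (hd : ∀ t, M.nondetStep (d t) (d (t + 1))) {c c' : Config} (h : M.Reach c c') {t : ℕ}
    (ht : d t = c) : ∃ t' ≥ t, d t' = c' := by
  induction h with
  | refl => exact ⟨t, le_rfl, ht⟩
  | @tail b e _ hbe ih =>
    obtain ⟨s, hs, rfl⟩ := ih
    refine ⟨s + 1, by omega, ?_⟩
    rcases hd s with h | ⟨q0, q1, h, -⟩
    · exact Option.some_injective _ (h.symm.trans hbe)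
    · simp [Machine.step, h] at hbe

/-- The states of a system in which the `n`-th round is controlled by the bit `g n`. -/
def iter {σ : Type*} (δ : ℕ → Bool → σ → σ) (s0 : σ) (g : Cantor) : ℕ → σ
  | 0 => s0
  | n + 1 => δ n (g n) (iter δ s0 g n)

/-- The list of all outputs before round `n`. -/
def collect {σ : Type*} (o : σ → List Bool) (run : ℕ → σ) : ℕ → List Bool
  | 0 => []
  | n + 1 => collect o run n ++ o (run (n + 1))

/-- If the runs of `M` are composed of rounds, each of which begins with a choice of a bit and
simulates one round of a system, then `M` outputs what this system outputs. -/
theorem nondetOutputs_iff_of_rounds {M : Machine} (hM : Vertex.accept ∉ M) {x : Cantor}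
    {σ : Type*} {δ : ℕ → Bool → σ → σ} {s0 : σ} {o : σ → List Bool}
    {Mac : ℕ → σ → List Bool → Config → Prop}
    (hinit : ∃ c c', M.step (Config.init x) = some c ∧ M.Reach c c' ∧ Mac 0 s0 [] c')
    (hout : ∀ n s L c, Mac n s L c → OutRel c L)
    (h1 : ∀ n s L c, Mac n s L c → ∀ c1, M.nondetStep c c1 → ∃ γ c2, M.Reach c1 c2 ∧
      Mac (n + 1) (δ n γ s) (L ++ o (δ n γ s)) c2)
    (h2 : ∀ n s L c, Mac n s L c → ∀ γ, ∃ c1 c2, M.nondetStep c c1 ∧ M.Reach c1 c2 ∧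
      Mac (n + 1) (δ n γ s) (L ++ o (δ n γ s)) c2) (w : Cantor) :
    M.NondetOutputs x w ↔ ∃ g, Spells (collect o (iter δ s0 g)) w := by
  rw [Machine.nondetOutputs_iff]
  obtain ⟨c0, c0', hi1, hi2, hi3⟩ := hinit
  have hreach : ∀ c c', M.Reach c c' → Relation.ReflTransGen M.nondetStep c c' :=
    fun c c' h => Relation.ReflTransGen.mono (fun _ _ h => Or.inl h) _ _ h
  constructor
  · rintro ⟨d, hd0, hd, hw⟩
    -- Without accepting vertices no step is an `idle` one.
    replace hd : ∀ t, M.nondetStep (d t) (d (t + 1)) := fun t =>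
      (hd t).resolve_right fun h => hM (List.mem_of_getElem? h.1)
    have hmono := fun s t => outPath_mono (fun t => M.nondetStep_outStep (hd t)) (s := s) (t := t)
    obtain ⟨t0, -, ht0⟩ := exists_eq_of_reach hd
      (Relation.ReflTransGen.head (r := fun c c' => M.step c = some c') hi1 hi2) hd0
    have hnext : ∀ n t s L, Mac n s L (d t) → ∃ γ t', t < t' ∧
        Mac (n + 1) (δ n γ s) (L ++ o (δ n γ s)) (d t') := by
      intro n t s L h
      obtain ⟨γ, c2, hr, hm⟩ := h1 n s L _ h _ (hd t)
      obtain ⟨t', ht', rfl⟩ := exists_eq_of_reach hd hr rfl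
      exact ⟨γ, t', ht', hm⟩
    choose! γ t' hlt hmac using hnext
    -- The beginning of round `n` in the given run: the time, the state of the system, and the
    -- output so far. The bits `g` are those chosen by the run.
    let Q : ℕ → ℕ × σ × List Bool := fun n => Nat.rec (t0, s0, []) (fun n q =>
      (t' n q.1 q.2.1 q.2.2, δ n (γ n q.1 q.2.1 q.2.2) q.2.1,
        q.2.2 ++ o (δ n (γ n q.1 q.2.1 q.2.2) q.2.1))) n
    let g : Cantor := fun n => γ n (Q n).1 (Q n).2.1 (Q n).2.2
    have hQ : ∀ n, (Q n).2.1 = iter δ s0 g n ∧ (Q n).2.2 = collect o (iter δ s0 g) n ∧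
        Mac n (Q n).2.1 (Q n).2.2 (d (Q n).1) ∧ n ≤ (Q n).1 := by
      intro n
      induction n with
      | zero => exact ⟨rfl, rfl, ht0 ▸ hi3, Nat.zero_le _⟩
      | succ n ih =>
        obtain ⟨e1, e2, e3, e4⟩ := ih
        refine ⟨?_, ?_, hmac n _ _ _ e3, ?_⟩
        · simp only [iter, ← e1]; rfl
        · simp only [collect, iter, ← e1, ← e2]; rfl
        · exact Nat.succ_le_of_lt (lt_of_le_of_lt e4 (hlt n _ _ _ e3))
    refine ⟨g, (writes_iff_spells (d := fun n => d (Q n).1) (fun n => ?_) w).1 ⟨fun m => ?_, ?_⟩⟩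
    · rw [← (hQ n).2.1]; exact hout _ _ _ _ (hQ n).2.2.1
    · obtain ⟨t, ht⟩ := hw.1 m
      exact ⟨t, ht.trans (hmono _ _ (hQ t).2.2.2).1⟩
    · exact fun n p hp => hw.2 _ p hp
  · rintro ⟨g, hg⟩
    choose! c1 c2 hc1 hc2 hc3 using h2
    let C : ℕ → Config := fun n => Nat.rec c0' (fun n c =>
      c2 n (iter δ s0 g n) (collect o (iter δ s0 g) n) c (g n)) n
    have hC : ∀ n, Mac n (iter δ s0 g n) (collect o (iter δ s0 g) n) (C n) := by
      intro n
      induction n with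
      | zero => exact hi3
      | succ n ih => exact hc3 _ _ _ _ ih (g n)
    have htr : ∀ n, Relation.TransGen M.nondetStep (C n) (C (n + 1)) := fun n =>
      Relation.TransGen.head' (hc1 _ _ _ _ (hC n) (g n)) (hreach _ _ (hc2 _ _ _ _ (hC n) (g n)))
    -- The initialization is an additional segment in front, so round `n` begins at the glueing
    -- point `n + 1`.
    obtain ⟨d, hd0, hd, hdC⟩ := exists_glued_path
      (C := fun n => Nat.casesOn n (Config.init x) C) (R := M.nondetStep) (by
        intro n
        cases n with
        | zero => exact Relation.TransGen.head' (Or.inl hi1) (hreach _ _ hi2)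
        | succ n => exact htr n)
    have hmono := fun s t => outPath_mono (fun t => M.nondetStep_outStep (hd t)) (s := s) (t := t)
    have hCw := (writes_iff_spells (fun n => hout _ _ _ _ (hC n)) w).2 hg
    refine ⟨d, hd0, fun t => Or.inl (hd t), fun m => ?_, fun t p hp => ?_⟩
    · obtain ⟨n, hn⟩ := hCw.1 m
      obtain ⟨t, -, ht⟩ := hdC (n + 1)
      exact ⟨t, by rw [ht]; exact hn⟩
    · obtain ⟨t', ht', hd'⟩ := hdC (t + 1)
      have := hmono t t' (by omega)
      have h' : d t' = C t := hd'
      rw [h'] at this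
      rw [← this.2 p hp, hCw.2 t p (by omega)]

end Rounds

/-! ### Transducers -/

/-- A primitive recursive system which reads two bits per round and outputs at most one. -/
structure Transducer : Type 1 where
  σ : Type
  [prim : Primcodable σ]
  init : σ
  next : Bool → Bool → σ → σ
  out : σ → Option Bool
  primrec_next : Primrec fun p : Bool × Bool × σ => next p.1 p.2.1 p.2.2
  primrec_out : Primrec out

namespace Transducer

attribute [instance] Transducer.prim

/-- The states of the transducer which reads `x` and `g`. -/
def run (T : Transducer) (x g : Cantor) : ℕ → T.σ :=
  iter (fun n b s => T.next (x n) b s) T.init g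

/-- On reading `x` and `g`, the transducer outputs the infinite sequence `w`. -/
def Outputs (T : Transducer) (x g w : Cantor) : Prop :=
  Spells (collect (fun s => (T.out s).toList) (T.run x g)) w

end Transducer

/-! ### Machines from primitive recursive systems -/

open Prog

theorem spec_whilePop_out (b : Bool) (n : ℕ) (u : List ℕ) (v : List Bool) (x : Cantor) (pos : ℕ)
    (out : List Bool) : Spec (.whilePop 0 (.out b)) ⟨![enc (n :: u), v], x, pos, out⟩
      ⟨![enc u, v], x, pos, out ++ List.replicate n b⟩ := by
  induction n generalizing out with
  | zero =>
    simpa [update_zero] using spec_whilePop_false (i := 0) (B := .out b)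
      (s := ⟨![enc (0 :: u), v], x, pos, out⟩) (l := enc u) rfl
  | succ n ih =>
    refine spec_whilePop_true (l := enc (n :: u)) rfl
      (s' := ⟨![enc (n :: u), v], x, pos, out ++ [b]⟩) ?_ ?_
    · simpa [update_zero] using spec_out b ⟨![enc (n :: u), v], x, pos, out⟩
    · simpa [List.replicate_succ] using ih (out ++ [b])

/-- A program which replaces the numbers on stack `0` by the value of `F` and then outputs as many
zeros and ones as `O₀` and `O₁` prescribe. -/
theorem exists_round {m : ℕ} {F : List.Vector ℕ (m + 1) → ℕ} {O₀ O₁ : ℕ → ℕ}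
    (hF : Primrec F) (h0 : Primrec O₀) (h1 : Primrec O₁) : ∃ P : Prog,
    ∀ (w : List.Vector ℕ (m + 1)) (x : Cantor) (pos : ℕ) (out : List Bool),
      Spec P ⟨![enc w.toList, []], x, pos, out⟩ ⟨![enc [F w], []], x, pos,
        out ++ (List.replicate (O₀ (F w)) false ++ List.replicate (O₁ (F w)) true)⟩ := by
  obtain ⟨P, hP⟩ := exists_pushes (Nat.Primrec'.of_prim hF) fun i => i
  -- The value of `O` is pushed as a loop counter and used up by the output; the number of the state
  -- below it is kept for the next round.
  have hO : ∀ O : ℕ → ℕ, Primrec O → ∀ b, ∃ Q : Prog, ∀ (n : ℕ) (x : Cantor) (pos : ℕ)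
      (out : List Bool), Spec Q ⟨![enc [n], []], x, pos, out⟩
        ⟨![enc [n], []], x, pos, out ++ List.replicate (O n) b⟩ := by
    intro O hO b
    obtain ⟨Q, hQ⟩ := exists_pushes (Nat.Primrec'.prim_iff₁.2 hO) fun _ => 0
    refine ⟨seq Q (whilePop 0 (.out b)), fun n x pos out => Spec.seq (hQ ⟨[n], rfl⟩ [n] [] ?_ x pos
      out) ?_⟩
    · intro j; rw [Subsingleton.elim j 0]; rfl
    · exact spec_whilePop_out b (O n) [n] [] x pos out
  obtain ⟨Q0, hQ0⟩ := hO O₀ h0 false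
  obtain ⟨Q1, hQ1⟩ := hO O₁ h1 true
  refine ⟨seq P (seq (nips (m + 1)) (seq Q0 Q1)), fun w x pos out => ?_⟩
  refine (hP w w.toList [] (fun j => ?_) x pos out).seq (Spec.seq
    (s' := ⟨![enc [F w], []], x, pos, out⟩) ?_ ((hQ0 _ _ _ _).seq ?_))
  · rw [List.Vector.get_eq_get_toList]; simp
  · have := pspec_nips (F w) w.toList [] [] x pos out
    simpa [enc] using this
  · simpa using hQ1 (F w) x pos (out ++ List.replicate (O₀ (F w)) false)

theorem wellFormed_start_cons {L : List Vertex} {q : ℕ} (hL : ∀ v ∈ L, ∀ q, v ≠ .start q)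
    (hq : 0 < q ∧ q < L.length + 1) (he : ∀ v ∈ L, ∀ q ∈ v.succs, 0 < q ∧ q < L.length + 1) :
    Machine.WellFormed (.start q :: L) where
  start_zero := ⟨q, rfl⟩
  start_unique i q' h := by
    cases i with
    | zero => rfl
    | succ i =>
      rw [List.getElem?_cons_succ] at h
      exact (hL _ (List.mem_of_getElem? h) _ rfl).elim
  edges v hv r hr := by
    rw [List.length_cons]
    rcases List.mem_cons.1 hv with rfl | hv
    · simp only [Vertex.succs, List.mem_singleton] at hr; rwa [hr]
    · exact he v hv r hr

theorem succs_code_bounds (P : Prog) {a e n : ℕ} (ha : 0 < a) (he : 0 < e) (hn : a + P.size = n)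
    (hen : e < n) : ∀ v ∈ P.code a e, ∀ q ∈ v.succs, 0 < q ∧ q < n := fun v hv q hq => by
  rcases P.succs_code a e v hv q hq with h | h <;> omega

theorem init_rel (x : Cantor) : St.Rel ⟨![[], []], x, 0, []⟩ (Config.init x) where
  inp := by simp [Config.init]
  pos := rfl
  stk i := by fin_cases i <;> rfl
  out := ⟨rfl, by simp⟩

/-- All machines built here begin by pushing the number `0`. -/
theorem reach_first {M : Machine} (h0 : M[0]? = some (.start 1))
    (h1 : M[1]? = some (.write 0 false 2)) (x : Cantor) :
    ∃ c c', M.step (Config.init x) = some c ∧ M.Reach c c' ∧ c'.vertex = 2 ∧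
      St.Rel ⟨![enc [0], []], x, 0, []⟩ c' := by
  have hr := init_rel x
  obtain ⟨c', h, hv, hs⟩ := spec_push 0 false ⟨![[], []], x, 0, []⟩ M 1 2
    (codeAt_cons.2 ⟨h1, fun k v hk => by simp at hk⟩) { Config.init x with vertex := 1 } rfl
    ⟨hr.inp, hr.pos, hr.stk, hr.out⟩
  refine ⟨_, c', ?_, h, hv, by simpa [update_zero, enc] using hs⟩
  have : M[(Config.init x).vertex]? = some (.start 1) := h0
  simp [Machine.step, this]

theorem collect_prefix {σ : Type*} (o : σ → List Bool) (run : ℕ → σ) {m n : ℕ} (h : m ≤ n) :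
    collect o run m <+: collect o run n := by
  induction n, h using Nat.le_induction with
  | base => exact List.prefix_rfl
  | succ n _ ih => exact ih.trans (List.prefix_append _ _)

theorem getElem?_of_prefix {α : Type*} {l l' : List α} (h : l <+: l') {p : ℕ} {b : α}
    (hp : l[p]? = some b) : l'[p]? = some b := by
  obtain ⟨t, rfl⟩ := h
  rw [List.getElem?_append_left (List.getElem?_eq_some_iff.1 hp).1, hp]

/-- Every sequence of outputs is a prefix of an infinite sequence. -/
theorem exists_extends_collect {σ : Type*} (o : σ → List Bool) (run : ℕ → σ) :
    ∃ w : Cantor, ∀ n p b, (collect o run n)[p]? = some b → w p = b := by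
  classical
  refine ⟨fun p => if h : ∃ n b, (collect o run n)[p]? = some b then h.choose_spec.choose
    else false, fun n p b hb => ?_⟩
  have h : ∃ n b, (collect o run n)[p]? = some b := ⟨n, b, hb⟩
  simp only [h, dif_pos]
  have h' := h.choose_spec.choose_spec
  have h1 := getElem?_of_prefix (collect_prefix o run (le_max_left h.choose n)) h'
  have h2 := getElem?_of_prefix (collect_prefix o run (le_max_right h.choose n)) hb
  exact Option.some_injective _ (h1.symm.trans h2)

/-- The lists are nested, hence consistent; that they become arbitrarily long is the only condition.
-/
theorem exists_spells_iff {σ : Type*} (o : σ → List Bool) (run : ℕ → σ) :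
    (∃ w, Spells (collect o run) w) ↔ ∀ m, ∃ n, m ≤ (collect o run n).length := by
  obtain ⟨w, hw⟩ := exists_extends_collect o run
  exact ⟨fun ⟨_, h⟩ => h.1, fun h => ⟨w, h, hw⟩⟩

section Coding

variable {σ : Type} [Primcodable σ]

/-- The state with number `n`, where `0` stands for the initial state `s0`. -/
def stateOf (s0 : σ) (n : ℕ) : σ := ((Encodable.decode n : Option (Option σ)).join).getD s0

/-- The number `0` encodes `none`, so the default applies. Thus a machine can start with the number
`0`, whatever the encoding of `s0` is. -/
theorem stateOf_zero (s0 : σ) : stateOf s0 0 = s0 := by simp [stateOf]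

theorem stateOf_encode (s0 s : σ) : stateOf s0 (Encodable.encode (some s)) = s := by
  simp [stateOf, Encodable.encodek]

theorem primrec_stateOf (s0 : σ) : Primrec (stateOf s0) := by
  refine Primrec.option_getD.comp (Primrec.option_bind (f := fun n =>
    (Encodable.decode n : Option (Option σ))) (g := fun _ o => o) Primrec.decode
    Primrec₂.right |>.of_eq fun n => ?_) (Primrec.const s0)
  cases (Encodable.decode n : Option (Option σ)) <;> rfl

/-- How many bits `b` are output in the state with number `n`. -/
def outCount (s0 : σ) (o : σ → Option Bool) (b : Bool) (n : ℕ) : ℕ :=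
  if o (stateOf s0 n) = some b then 1 else 0

theorem primrec_outCount (s0 : σ) {o : σ → Option Bool} (ho : Primrec o) (b : Bool) :
    Primrec (outCount s0 o b) :=
  Primrec.ite (Primrec.eq.comp (ho.comp (primrec_stateOf s0)) (Primrec.const _))
    (Primrec.const _) (Primrec.const _)

/-- At most one of the two counts is `1`, so printing zeros before ones puts nothing in the wrong
order. -/
theorem outCount_encode (s0 : σ) (o : σ → Option Bool) (s : σ) :
    List.replicate (outCount s0 o false (Encodable.encode (some s))) false ++
      List.replicate (outCount s0 o true (Encodable.encode (some s))) true = (o s).toList := by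
  simp only [outCount, stateOf_encode]
  rcases o s with - | - | - <;> simp

end Coding

theorem spec_readBit_num (u : List ℕ) (v : List Bool) (x : Cantor) (pos : ℕ) (out : List Bool) :
    Spec .readBit ⟨![enc u, v], x, pos, out⟩
      ⟨![enc ((x pos).toNat :: u), v], x, pos + 1, out⟩ := by
  simpa [update_zero, enc] using spec_readBit ⟨![enc u, v], x, pos, out⟩

theorem primrec_bit {n : ℕ} (i : Fin n) :
    Primrec fun v : List.Vector ℕ n => decide (v.get i = 1) :=
  (Primrec.eq.comp (Primrec.vector_get.comp Primrec.id (Primrec.const i))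
    (Primrec.const 1)).decide

theorem decide_toNat (b : Bool) : decide (b.toNat = 1) = b := by cases b <;> rfl

/-- The bits that a transducer reads in addition to its input may be guessed. -/
theorem Transducer.exists_nondet_machine (T : Transducer) : ∃ N : Machine, N.IsNondetType2 ∧
    ∀ x w, N.NondetOutputs x w ↔ ∃ g, T.Outputs x g w := by
  -- From the top of the stack: the input bit, read last; the guessed bit; the number of the state.
  let F : List.Vector ℕ 3 → ℕ := fun v => Encodable.encode (some
    (T.next (decide (v.get 0 = 1)) (decide (v.get 1 = 1)) (stateOf T.init (v.get 2))))
  have hF : Primrec F := Primrec.encode.comp (Primrec.option_some.comp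
    (T.primrec_next.comp (Primrec.pair (primrec_bit 0) (Primrec.pair (primrec_bit 1)
      ((primrec_stateOf T.init).comp (Primrec.vector_get.comp Primrec.id (Primrec.const 2)))))))
  obtain ⟨P, hP⟩ := exists_round hF (primrec_outCount T.init T.primrec_out false)
    (primrec_outCount T.init T.primrec_out true)
  let R : Prog := .seq .readBit P
  -- Vertex `1` pushes the initial number `0`; vertex `2` guesses; vertices `3` and `4`, `5` push
  -- the guessed bit as a number; the round is placed at `6` and returns to `2`.
  let L : List Vertex := [.write 0 false 2, .guess 3 4, .write 0 false 6, .write 0 false 5,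
    .write 0 true 6]
  let N : Machine := .start 1 :: (L ++ R.code 6 2)
  have hlen : (L ++ R.code 6 2).length = 5 + R.size := by
    rw [List.length_append, Prog.length_code]; rfl
  have hcode : CodeAt N 6 (R.code 6 2) := by
    have := codeAt_append_self (.start 1 :: L) (R.code 6 2) []
    rwa [List.append_nil] at this
  have hsz := R.size_pos
  refine ⟨N, ⟨wellFormed_start_cons (fun v hv q => ?_) (by omega) fun v hv q hq => ?_, ?_⟩, ?_⟩
  · rcases List.mem_append.1 hv with hv | hv
    · simp only [L, List.mem_cons, List.not_mem_nil, or_false] at hv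
      rcases hv with rfl | rfl | rfl | rfl | rfl <;> simp
    · rintro rfl; exact R.isPlain_code _ _ _ hv
  · rcases List.mem_append.1 hv with hv | hv
    · simp only [L, List.mem_cons, List.not_mem_nil, or_false] at hv
      rcases hv with rfl | rfl | rfl | rfl | rfl <;>
        (simp only [Vertex.succs, List.mem_cons, List.not_mem_nil, or_false] at hq; omega)
    · exact succs_code_bounds R (a := 6) (e := 2) (by omega) (by omega) (by omega) (by omega)
        v hv q hq
  · intro q0 q1 hv
    simp only [N, L, List.mem_append, List.mem_cons, List.not_mem_nil, or_false, reduceCtorEq,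
      false_or] at hv
    exact R.isPlain_code _ _ _ hv
  · intro x w
    have hguess : N[2]? = some (.guess 3 4) := rfl
    have hround : ∀ n s l (b : Bool) (c : Config) k, stateOf T.init k = s → c.vertex = 6 →
        St.Rel ⟨![enc [b.toNat, k], []], x, n, l⟩ c → ∃ c2, N.Reach c c2 ∧ c2.vertex = 2 ∧
          ∃ k', stateOf T.init k' = T.next (x n) b s ∧
            St.Rel ⟨![enc [k'], []], x, n + 1, l ++ (T.out (T.next (x n) b s)).toList⟩ c2 := by
      intro n s l b c k hk hv hs
      obtain ⟨c2, hr, hv2, hs2⟩ := ((spec_readBit_num _ _ x n l).seq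
        (hP ⟨[(x n).toNat, b.toNat, k], rfl⟩ x (n + 1) l)) N 6 2 hcode c hv hs
      have hFv : F ⟨[(x n).toNat, b.toNat, k], rfl⟩ = Encodable.encode (some (T.next (x n) b s)) := by
        simp only [F]
        rw [← hk]
        congr 3
        · exact decide_toNat _
        · exact decide_toNat _
      rw [hFv, outCount_encode] at hs2
      exact ⟨c2, hr, hv2, _, stateOf_encode _ _, hs2⟩
    have hpush : ∀ n l (b : Bool) (c : Config) k, c.vertex = (if b then 4 else 3) →
        St.Rel ⟨![enc [k], []], x, n, l⟩ c → ∃ c2, N.Reach c c2 ∧ c2.vertex = 6 ∧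
          St.Rel ⟨![enc [b.toNat, k], []], x, n, l⟩ c2 := by
      intro n l b c k hv hs
      have hw : ∀ b' a' e' (s s' : St), N[a']? = some (.write 0 b' e') → Spec (.push 0 b') s s' →
          ∀ c : Config, c.vertex = a' → s.Rel c → ∃ c', N.Reach c c' ∧ c'.vertex = e' ∧
            s'.Rel c' := fun b' a' e' s s' h hsp => hsp N a' e' (codeAt_cons.2 ⟨h, by
          intro k v hk; simp at hk⟩)
      cases b
      · exact hw false 3 6 _ _ rfl (pspec_push0 [k] [] x n l) c hv hs
      · obtain ⟨c1, hr1, hv1, hs1⟩ := hw false 4 5 _ _ rfl (pspec_push0 [k] [] x n l) c hv hs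
        obtain ⟨c2, hr2, hv2, hs2⟩ := hw true 5 6 _ _ rfl (pspec_inc0 0 [k] [] x n l) c1 hv1 hs1
        exact ⟨c2, hr1.trans hr2, hv2, hs2⟩
    have hmain : ∀ n s l (b : Bool) (c : Config), (c.vertex = 2 ∧ ∃ k, stateOf T.init k = s ∧
        St.Rel ⟨![enc [k], []], x, n, l⟩ c) → ∃ c2,
        N.Reach { c with vertex := if b then 4 else 3 } c2 ∧ (c2.vertex = 2 ∧
          ∃ k', stateOf T.init k' = T.next (x n) b s ∧
            St.Rel ⟨![enc [k'], []], x, n + 1, l ++ (T.out (T.next (x n) b s)).toList⟩ c2) := by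
      rintro n s l b c ⟨-, k, hk, hs⟩
      obtain ⟨c1, hr1, hv1, hs1⟩ := hpush n l b { c with vertex := if b then 4 else 3 } k rfl
        ⟨hs.inp, hs.pos, hs.stk, hs.out⟩
      obtain ⟨c2, hr2, hv2, h⟩ := hround n s l b c1 k hk hv1 hs1
      exact ⟨c2, hr1.trans hr2, hv2, h⟩
    refine nondetOutputs_iff_of_rounds (δ := fun n b s => T.next (x n) b s)
      (o := fun s => (T.out s).toList)
      (Mac := fun n s l c => c.vertex = 2 ∧ ∃ k, stateOf T.init k = s ∧
        St.Rel ⟨![enc [k], []], x, n, l⟩ c) ?_ ?_ ?_ ?_ ?_ w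
    · intro h
      simp only [N, L, List.mem_append, List.mem_cons, List.not_mem_nil, or_false, reduceCtorEq,
        false_or] at h
      exact R.accept_notMem_code _ _ h
    · obtain ⟨c, c', h1, h2, h3, h4⟩ := reach_first (M := N) rfl rfl x
      exact ⟨c, c', h1, h2, h3, 0, stateOf_zero _, h4⟩
    · rintro n s l c ⟨-, k, -, hs⟩
      exact hs.out
    · intro n s l c hm c1 hc1
      have hg := hguess
      rw [← hm.1] at hg
      rcases hc1 with h | ⟨q0, q1, h, hc1⟩
      · simp [Machine.step, hg] at h
      · rw [hg] at h
        cases h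
        rcases hc1 with rfl | rfl
        · exact ⟨false, hmain n s l false c hm⟩
        · exact ⟨true, hmain n s l true c hm⟩
    · intro n s l c hm b
      obtain ⟨c2, h⟩ := hmain n s l b c hm
      have hg := hguess
      rw [← hm.1] at hg
      exact ⟨_, c2, Or.inr ⟨3, 4, hg, by cases b <;> simp⟩, h⟩

theorem pair_even (x y : Cantor) (n : ℕ) : pair x y (2 * n) = x n := by
  simp [pair]

theorem pair_odd (x y : Cantor) (n : ℕ) : pair x y (2 * n + 1) = y n := by
  simp [pair, show (2 * n + 1) / 2 = n by omega, show (2 * n + 1) % 2 = 1 by omega]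

theorem exists_pair (y : Cantor) : ∃ v w, y = pair v w := by
  refine ⟨fun n => y (2 * n), fun n => y (2 * n + 1), funext fun n => ?_⟩
  unfold pair
  split_ifs with h
  · congr 1; omega
  · congr 1; omega

/-- A primitive recursive system is simulated by a Type-2-Machine which accepts if the system
outputs infinitely many bits. -/
theorem exists_type2_machine {σ : Type} [Primcodable σ] (s0 : σ) {next : Bool → Bool → Bool → σ → σ}
    {o : σ → Option Bool}
    (hnext : Primrec fun p : Bool × Bool × Bool × σ => next p.1 p.2.1 p.2.2.1 p.2.2.2)
    (ho : Primrec o) : ∃ M : Machine, M.IsType2 ∧ ∀ x v g,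
      M.Accepts (pair (pair x fun _ => false) (pair v g)) ↔ ∀ m, ∃ n, m ≤
        (collect (fun s => (o s).toList)
          (iter (fun n (_ : Bool) s => next (x n) (v n) (g n) s) s0 (fun _ => false)) n).length := by
  -- A round reads `x n`, `v n`, the padding `0` and `g n`, in this order, so they are at places
  -- `3`, `2`, `1`, `0` above the state; the padding is ignored.
  let F : List.Vector ℕ 5 → ℕ := fun v => Encodable.encode (some
    (next (decide (v.get 3 = 1)) (decide (v.get 2 = 1)) (decide (v.get 0 = 1))
      (stateOf s0 (v.get 4))))
  have hF : Primrec F := Primrec.encode.comp (Primrec.option_some.comp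
    (hnext.comp (Primrec.pair (primrec_bit 3) (Primrec.pair (primrec_bit 2)
      (Primrec.pair (primrec_bit 0)
        ((primrec_stateOf s0).comp (Primrec.vector_get.comp Primrec.id (Primrec.const 4))))))))
  obtain ⟨P, hP⟩ := exists_round hF (primrec_outCount s0 ho false) (primrec_outCount s0 ho true)
  let R : Prog := .seq .readBit (.seq .readBit (.seq .readBit (.seq .readBit P)))
  let M : Machine := .start 1 :: .write 0 false 2 :: R.code 2 2
  have hsz := R.size_pos
  have hcode : CodeAt M 2 (R.code 2 2) := by
    have := codeAt_append_self [.start 1, .write 0 false 2] (R.code 2 2) []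
    rwa [List.append_nil] at this
  have hlen : (Vertex.write 0 false 2 :: R.code 2 2).length = 1 + R.size := by
    rw [List.length_cons, Prog.length_code, add_comm]
  have hguess : ∀ q0 q1, Vertex.guess q0 q1 ∉ M := by
    intro q0 q1 hv
    simp only [M, List.mem_cons, reduceCtorEq, false_or] at hv
    exact R.isPlain_code _ _ _ hv
  refine ⟨M, ⟨wellFormed_start_cons (fun v hv q => ?_) (by omega) fun v hv q hq => ?_, ?_,
    hguess⟩, ?_⟩
  · rcases List.mem_cons.1 hv with rfl | hv
    · simp
    · rintro rfl; exact R.isPlain_code _ _ _ hv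
  · rcases List.mem_cons.1 hv with rfl | hv
    · simp only [Vertex.succs, List.mem_singleton] at hq; omega
    · exact succs_code_bounds R (a := 2) (e := 2) (by omega) (by omega) (by omega) (by omega)
        v hv q hq
  · intro q0 q1 hv
    simp only [M, List.mem_cons, reduceCtorEq, false_or] at hv
    exact R.isPlain_code _ _ _ hv
  · intro x v g
    set p := pair (pair x fun _ => false) (pair v g) with hp
    have hp0 : ∀ n, p (4 * n) = x n := fun n => by
      rw [show 4 * n = 2 * (2 * n) by ring, hp, pair_even, pair_even]
    have hp1 : ∀ n, p (4 * n + 1) = v n := fun n => by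
      rw [show 4 * n + 1 = 2 * (2 * n) + 1 by ring, hp, pair_odd, pair_even]
    have hp3 : ∀ n, p (4 * n + 1 + 1 + 1) = g n := fun n => by
      rw [show 4 * n + 1 + 1 + 1 = 2 * (2 * n + 1) + 1 by ring, hp, pair_odd, pair_odd]
    have hround : ∀ n s l (c : Config), (c.vertex = 2 ∧ ∃ k, stateOf s0 k = s ∧
        St.Rel ⟨![enc [k], []], p, 4 * n, l⟩ c) → ∃ c2, M.Reach c c2 ∧ (c2.vertex = 2 ∧
          ∃ k', stateOf s0 k' = next (x n) (v n) (g n) s ∧ St.Rel ⟨![enc [k'], []], p,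
            4 * (n + 1), l ++ (o (next (x n) (v n) (g n) s)).toList⟩ c2) := by
      rintro n s l c ⟨hv, k, hk, hs⟩
      obtain ⟨c2, hr, hv2, hs2⟩ := ((spec_readBit_num _ _ p (4 * n) l).seq
        ((spec_readBit_num _ _ p _ l).seq ((spec_readBit_num _ _ p _ l).seq
          ((spec_readBit_num _ _ p _ l).seq (hP ⟨[(p (4 * n + 1 + 1 + 1)).toNat,
            (p (4 * n + 1 + 1)).toNat, (p (4 * n + 1)).toNat, (p (4 * n)).toNat, k], rfl⟩ p _ l)))))
        M 2 2 hcode c hv hs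
      have hFv : F ⟨[(p (4 * n + 1 + 1 + 1)).toNat, (p (4 * n + 1 + 1)).toNat,
          (p (4 * n + 1)).toNat, (p (4 * n)).toNat, k], rfl⟩ =
          Encodable.encode (some (next (x n) (v n) (g n) s)) := by
        simp only [F]
        rw [← hk, ← hp0 n, ← hp1 n, ← hp3 n]
        congr 3
        · exact decide_toNat _
        · exact decide_toNat _
        · exact decide_toNat _
      rw [hFv, outCount_encode] at hs2
      exact ⟨c2, hr, hv2, _, stateOf_encode _ _, hs2⟩
    have hstep : ∀ n s l (c : Config), (c.vertex = 2 ∧ ∃ k, stateOf s0 k = s ∧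
        St.Rel ⟨![enc [k], []], p, 4 * n, l⟩ c) → ∃ c1 c2, M.step c = some c1 ∧ M.Reach c1 c2 ∧
          (c2.vertex = 2 ∧ ∃ k', stateOf s0 k' = next (x n) (v n) (g n) s ∧
            St.Rel ⟨![enc [k'], []], p, 4 * (n + 1),
              l ++ (o (next (x n) (v n) (g n) s)).toList⟩ c2) := by
      intro n s l c hc
      obtain ⟨c2, hr, h⟩ := hround n s l c hc
      -- A round is not an empty path, since it moves the input head by four cells.
      rcases Relation.ReflTransGen.cases_head hr with rfl | ⟨c1, h1, h2⟩
      · exfalso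
        obtain ⟨-, k, -, hs⟩ := hc
        obtain ⟨-, k', -, hs'⟩ := h
        have e1 := hs.pos
        have e2 := hs'.pos
        simp only at e1 e2
        omega
      · exact ⟨c1, c2, h1, h2, h⟩
    rw [Machine.accepts_iff_nondetOutputs hguess]
    -- The deterministic machine is treated as a system of rounds which ignores the bit chosen.
    have key := nondetOutputs_iff_of_rounds (M := M) (x := p) (s0 := s0)
      (δ := fun n (_ : Bool) s => next (x n) (v n) (g n) s) (o := fun s => (o s).toList)
      (Mac := fun n s l c => c.vertex = 2 ∧ ∃ k, stateOf s0 k = s ∧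
        St.Rel ⟨![enc [k], []], p, 4 * n, l⟩ c) ?_ ?_ ?_ ?_ ?_
    · have hiter : ∀ γ, iter (fun n (_ : Bool) s => next (x n) (v n) (g n) s) s0 γ =
          iter (fun n (_ : Bool) s => next (x n) (v n) (g n) s) s0 (fun _ => false) := by
        intro γ
        funext n
        induction n with
        | zero => rfl
        | succ n ih => simp only [iter, ih]
      simp only [key, hiter, exists_const]
      exact exists_spells_iff _ _
    · intro h
      simp only [M, List.mem_cons, reduceCtorEq, false_or] at h
      exact R.accept_notMem_code _ _ h
    · obtain ⟨c, c', h1, h2, h3, h4⟩ := reach_first (M := M) rfl rfl p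
      exact ⟨c, c', h1, h2, h3, 0, stateOf_zero _, h4⟩
    · rintro n s l c ⟨-, k, -, hs⟩
      exact hs.out
    · intro n s l c hm c1 hc1
      obtain ⟨c1', c2, h1, h2, h3⟩ := hstep n s l c hm
      rw [Machine.nondetStep_iff_step hguess, h1] at hc1
      cases hc1
      exact ⟨false, c2, h2, h3⟩
    · intro n s l c hm b
      obtain ⟨c1, c2, h1, h2, h3⟩ := hstep n s l c hm
      exact ⟨c1, c2, Or.inl h1, h2, h3⟩

/-! ### Verification of the output of a transducer -/

theorem length_collect_le {σ : Type*} (o : σ → Option Bool) (run : ℕ → σ) (n : ℕ) :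
    (collect (fun s => (o s).toList) run n).length ≤ n := by
  induction n with
  | zero => simp [collect]
  | succ n ih =>
    have : (o (run (n + 1))).toList.length ≤ 1 := by cases o (run (n + 1)) <;> simp
    simp only [collect, List.length_append]
    omega

namespace Transducer

variable (T : Transducer)

/-- Comparing the output bit of `s`, if there is one, with the first of the prescribed bits `q`. -/
def compare (s : T.σ) (q : List Bool) : Option (T.σ × List Bool × Bool) :=
  Option.casesOn (T.out s) (some (s, q, false)) fun b =>
    List.casesOn q none fun c q' => if b = c then some (s, q', true) else none

/-- A round of the system which runs `T` and compares its output with prescribed bits. The state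
consists of the state of `T`, the queue of the bits not yet compared, and a flag telling that a
comparison was made in this round. There is no state after a failed comparison. -/
def checkNext (a v g : Bool) (st : Option (T.σ × List Bool × Bool)) :
    Option (T.σ × List Bool × Bool) :=
  st.bind fun p => T.compare (T.next a g p.1) (p.2.1 ++ [v])

/-- Successful comparisons are reported as output. -/
def checkOut (st : Option (T.σ × List Bool × Bool)) : Option Bool :=
  st.bind fun p => if p.2.2 = true then some true else none

theorem primrec_compare : Primrec₂ T.compare := by
  refine Primrec.option_casesOn (T.primrec_out.comp Primrec.fst)
    (Primrec.option_some.comp (Primrec.pair Primrec.fst (Primrec.pair Primrec.snd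
      (Primrec.const false)))) ?_
  refine Primrec.list_casesOn (α := (T.σ × List Bool) × Bool)
    (σ := Option (T.σ × List Bool × Bool))
    (h := fun p r => if p.2 = r.1 then some (p.1.1, r.2, true) else none)
    (Primrec.snd.comp Primrec.fst) (Primrec.const none) ?_
  refine Primrec.ite (Primrec.eq.comp (Primrec.snd.comp Primrec.fst)
    (Primrec.fst.comp Primrec.snd)) (Primrec.option_some.comp (Primrec.pair
      (Primrec.fst.comp (Primrec.fst.comp Primrec.fst)) (Primrec.pair
        (Primrec.snd.comp Primrec.snd) (Primrec.const true)))) (Primrec.const none)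

theorem primrec_checkNext : Primrec fun p : Bool × Bool × Bool × Option (T.σ × List Bool × Bool) =>
    T.checkNext p.1 p.2.1 p.2.2.1 p.2.2.2 := by
  refine Primrec.option_bind (Primrec.snd.comp (Primrec.snd.comp Primrec.snd)) ?_
  refine T.primrec_compare.comp (T.primrec_next.comp (Primrec.pair (Primrec.fst.comp Primrec.fst)
    (Primrec.pair (Primrec.fst.comp (Primrec.snd.comp (Primrec.snd.comp Primrec.fst)))
      (Primrec.fst.comp Primrec.snd)))) ?_
  exact Primrec.list_append.comp (Primrec.fst.comp (Primrec.snd.comp Primrec.snd))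
    (Primrec.list_cons.comp (Primrec.fst.comp (Primrec.snd.comp Primrec.fst)) (Primrec.const []))

theorem primrec_checkOut : Primrec T.checkOut := by
  refine Primrec.option_bind Primrec.id ?_
  exact Primrec.ite (Primrec.eq.comp (Primrec.snd.comp (Primrec.snd.comp Primrec.snd))
    (Primrec.const true)) (Primrec.const _) (Primrec.const _)

section

variable (x v g : Cantor)

/-- The run of the comparing system. -/
def checkRun : ℕ → Option (T.σ × List Bool × Bool) :=
  iter (fun n (_ : Bool) s => T.checkNext (x n) (v n) (g n) s) (some (T.init, [], false))
    (fun _ => false)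

theorem checkRun_succ (n : ℕ) :
    T.checkRun x v g (n + 1) = T.checkNext (x n) (v n) (g n) (T.checkRun x v g n) := rfl

theorem run_succ (n : ℕ) : T.run x g (n + 1) = T.next (x n) (g n) (T.run x g n) := rfl

/-- The output before round `n`. -/
def written (n : ℕ) : List Bool := collect (fun s => (T.out s).toList) (T.run x g) n

/-- The successful comparisons before round `n`. -/
def checked (n : ℕ) : List Bool :=
  collect (fun s => (T.checkOut s).toList) (T.checkRun x v g) n

theorem written_succ (n : ℕ) : T.written x g (n + 1) =
    T.written x g n ++ (T.out (T.run x g (n + 1))).toList := rfl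

theorem checked_succ (n : ℕ) : T.checked x v g (n + 1) =
    T.checked x v g n ++ (T.checkOut (T.checkRun x v g (n + 1))).toList := rfl

/-- As long as no comparison failed, the queue consists of the bits of `v` read so far without those
already compared. It does not run empty before a comparison, because `T` outputs at most one bit per
round while one bit of `v` arrives in each. -/
theorem checkRun_invariant (n : ℕ) :
    ((∀ p b, (T.written x g n)[p]? = some b → v p = b) ∧
      (∃ f, T.checkRun x v g n = some (T.run x g n,
        ((List.range n).map v).drop (T.written x g n).length, f)) ∧
      (T.checked x v g n).length = (T.written x g n).length) ∨
    (T.checkRun x v g n = none ∧ ∃ p b, (T.written x g n)[p]? = some b ∧ v p ≠ b) := by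
  induction n with
  | zero => exact Or.inl ⟨by simp [written, collect], ⟨false, rfl⟩, rfl⟩
  | succ n ih =>
    rcases ih with ⟨h1, ⟨f, h2⟩, h3⟩ | ⟨h1, p, b, hp, hb⟩
    · have hle : (T.written x g n).length ≤ n := length_collect_le _ _ n
      have hq : ((List.range n).map v).drop (T.written x g n).length ++ [v n] =
          ((List.range (n + 1)).map v).drop (T.written x g n).length := by
        rw [List.range_succ, List.map_append, List.drop_append_of_le_length (by simpa using hle)]
        rfl
      have hc : T.checkRun x v g (n + 1) = T.compare (T.run x g (n + 1))
          (((List.range (n + 1)).map v).drop (T.written x g n).length) := by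
        rw [checkRun_succ, h2, ← hq]; rfl
      -- At most `n` bits were compared before, so after the arrival of `v n` the queue has a first
      -- bit, namely the one to be compared with the next output.
      have hcons : ((List.range (n + 1)).map v).drop (T.written x g n).length =
          v (T.written x g n).length ::
            ((List.range (n + 1)).map v).drop ((T.written x g n).length + 1) := by
        rw [List.drop_eq_getElem_cons (by simp; omega)]
        simp
      rw [checked_succ, written_succ]
      rcases ho : T.out (T.run x g (n + 1)) with - | b
      · have : T.checkRun x v g (n + 1) = some (T.run x g (n + 1),
            ((List.range (n + 1)).map v).drop (T.written x g n).length, false) := by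
          rw [hc, compare, ho]
        left
        rw [this]
        simpa [checkOut, h3] using h1
      · by_cases hb : b = v (T.written x g n).length
        · have : T.checkRun x v g (n + 1) = some (T.run x g (n + 1),
              ((List.range (n + 1)).map v).drop ((T.written x g n).length + 1), true) := by
            rw [hc, compare, ho, hcons]
            simp [hb]
          left
          rw [this]
          refine ⟨fun p b' hp => ?_, ⟨true, by simp⟩, by simp [checkOut, h3]⟩
          rcases lt_trichotomy p (T.written x g n).length with h | rfl | h
          · exact h1 p b' (by rwa [List.getElem?_append_left h] at hp)
          · simpa [hb] using hp
          · rw [List.getElem?_eq_none (by simp; omega)] at hp; cases hp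
        · right
          refine ⟨by rw [hc, compare, ho, hcons]; simp [hb], (T.written x g n).length, b, by simp,
            fun h => hb h.symm⟩
    · exact Or.inr ⟨by rw [checkRun_succ, h1]; rfl, p, b,
        getElem?_of_prefix (List.prefix_append _ _) hp, hb⟩

/-- A failed comparison ends all reports; without failures there are as many reports as output bits,
and these agree with `v`. -/
theorem checked_unbounded_iff : (∀ m, ∃ n, m ≤ (T.checked x v g n).length) ↔
    T.Outputs x g v := by
  constructor
  · intro h
    have halive : ∀ n, T.checkRun x v g n ≠ none := by
      intro n hn
      have hk : ∀ k, T.checkRun x v g (n + k) = none ∧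
          T.checked x v g (n + k) = T.checked x v g n := by
        intro k
        induction k with
        | zero => exact ⟨hn, rfl⟩
        | succ k ih =>
          have : T.checkRun x v g (n + k + 1) = none := by rw [checkRun_succ, ih.1]; rfl
          exact ⟨this, by rw [← add_assoc, checked_succ, this, ih.2]; simp [checkOut]⟩
      obtain ⟨m, hm⟩ := h ((T.checked x v g n).length + 1)
      have h1 := (collect_prefix (fun s => (T.checkOut s).toList) (T.checkRun x v g)
        (show m ≤ n + m by omega)).length_le
      have h2 := congrArg List.length (hk m).2
      simp only [checked] at h1 h2 hm
      omega
    have hinv := fun n => (T.checkRun_invariant x v g n).resolve_right fun h => halive n h.1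
    refine ⟨fun m => ?_, fun n p b hp => (hinv n).1 p b hp⟩
    obtain ⟨n, hn⟩ := h m
    exact ⟨n, by rw [(hinv n).2.2] at hn; exact hn⟩
  · rintro ⟨h1, h2⟩ m
    obtain ⟨n, hn⟩ := h1 m
    have hinv := (T.checkRun_invariant x v g n).resolve_right fun ⟨_, p, b, hp, hb⟩ =>
      hb (h2 n p b hp)
    exact ⟨n, by rw [hinv.2.2]; exact hn⟩

end

/-- The outputs of a transducer can be verified by a Type-2-Machine. -/
theorem exists_verifier : ∃ M : Machine, M.IsType2 ∧ ∀ x v g,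
    M.Accepts (pair (pair x fun _ => false) (pair v g)) ↔ T.Outputs x g v := by
  obtain ⟨M, hM, h⟩ := exists_type2_machine (some (T.init, [], false)) T.primrec_checkNext
    T.primrec_checkOut
  exact ⟨M, hM, fun x v g => (h x v g).trans (T.checked_unbounded_iff x v g)⟩

end Transducer

/-! ### Total steps -/

namespace Machine

/-- The step of a machine as a total function: at a vertex with label `guess` the bit `b` is used,
accepting vertices write zeros, and nothing happens if there is no transition. -/
def tstep (M : Machine) (b : Bool) (c : Config) : Config :=
  match M[c.vertex]? with
  | some .accept => c.idle
  | some (.guess q0 q1) => { c with vertex := if b then q1 else q0 }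
  | _ => (M.step c).getD c

/-- The bit which is written on the output tape in the next step. -/
def emits (M : Machine) (c : Config) : Option Bool :=
  match M[c.vertex]? with
  | some .accept => some false
  | some (.write i b _) => if i = 2 then some b else none
  | _ => none

/-- The sequence of configurations given by total steps. -/
def trun (M : Machine) (c : Config) (g : Cantor) : ℕ → Config :=
  iter (fun _ b c => M.tstep b c) c g

variable {M : Machine}

theorem tstep_of_step {c c' : Config} (h : M.step c = some c') (b : Bool) :
    M.tstep b c = c' := by
  have h0 := h
  unfold tstep
  split
  · rename_i hv; simp [step, hv] at h
  · rename_i hv; simp [step, hv] at h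
  · simp [h0]

theorem tstep_of_xstep {c c' : Config} (h : XStep M M.nondetStep c c') :
    ∃ b, M.tstep b c = c' := by
  rcases h with (h | ⟨q0, q1, h, rfl | rfl⟩) | ⟨h, rfl⟩
  · exact ⟨false, tstep_of_step h _⟩
  · exact ⟨false, by simp [tstep, h]⟩
  · exact ⟨true, by simp [tstep, h]⟩
  · exact ⟨false, by simp [tstep, h]⟩

theorem tstep_of_xstep_step {c c' : Config} (h : XStep M (fun c c' => M.step c = some c') c c')
    (b : Bool) : M.tstep b c = c' := by
  rcases h with h | ⟨h, rfl⟩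
  · exact tstep_of_step h _
  · simp [tstep, h]

/-- The total step differs from the step relation only by standing still where no transition exists.
-/
theorem xstep_or_stuck (M : Machine) (c : Config) :
    (∀ b, XStep M M.nondetStep c (M.tstep b c)) ∨ ∀ b, M.tstep b c = c := by
  by_cases h1 : M[c.vertex]? = some .accept
  · exact Or.inl fun b => Or.inr ⟨h1, by simp [tstep, h1]⟩
  · by_cases h2 : ∃ q0 q1, M[c.vertex]? = some (.guess q0 q1)
    · obtain ⟨q0, q1, h2⟩ := h2
      exact Or.inl fun b => Or.inl (Or.inr ⟨q0, q1, h2, by cases b <;> simp [tstep, h2]⟩)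
    · have h : ∀ b, M.tstep b c = (M.step c).getD c := by
        intro b
        unfold tstep
        split
        · rename_i hv; exact (h1 hv).elim
        · rename_i hv; exact (h2 ⟨_, _, hv⟩).elim
        · rfl
      rcases hs : M.step c with - | c'
      · exact Or.inr fun b => by rw [h, hs]; rfl
      · exact Or.inl fun b => Or.inl (Or.inl (by rw [h, hs]; rfl))

theorem tstep_outStep (b : Bool) (c : Config) : OutStep c (M.tstep b c) := by
  rcases M.xstep_or_stuck c with h | h
  · exact (h b).outStep fun _ _ h => M.nondetStep_outStep h
  · rw [h]; exact Or.inl ⟨rfl, rfl⟩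

theorem trun_outStep (c : Config) (g : Cantor) (t : ℕ) :
    OutStep (M.trun c g t) (M.trun c g (t + 1)) := tstep_outStep _ _

theorem trun_stuck {c : Config} {g : Cantor} {t : ℕ}
    (h : ∀ b, M.tstep b (M.trun c g t) = M.trun c g t) (k : ℕ) :
    M.trun c g (t + k) = M.trun c g t := by
  induction k with
  | zero => rfl
  | succ k ih =>
    change M.tstep (g (t + k)) (M.trun c g (t + k)) = _
    rw [ih, h]

/-- A run that stands still once does so forever and cannot write an infinite sequence, so making
steps total adds no outputs. -/
theorem xstep_trun {c : Config} {g w : Cantor} (hw : Writes (M.trun c g) w) (t : ℕ) :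
    XStep M M.nondetStep (M.trun c g t) (M.trun c g (t + 1)) := by
  rcases M.xstep_or_stuck (M.trun c g t) with h | h
  · exact h _
  · exfalso
    obtain ⟨s, hs⟩ := hw.1 ((M.trun c g t).head 3 + 1)
    have := (outPath_mono (trun_outStep (M := M) c g) (show s ≤ t + s by omega)).1
    rw [trun_stuck h] at this
    omega

theorem exists_trun {c : Config} {d : ℕ → Config} (h0 : d 0 = c)
    (hd : ∀ t, XStep M M.nondetStep (d t) (d (t + 1))) : ∃ g, M.trun c g = d := by
  choose g hg using fun t => tstep_of_xstep (hd t)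
  refine ⟨g, funext fun t => ?_⟩
  induction t with
  | zero => exact h0.symm
  | succ t ih =>
    change M.tstep (g t) (M.trun c g t) = _
    rw [ih, hg]

/-- All choices of a run are recorded in `g`, with one bit per step even where no choice is made;
the run is then a function of `x` and `g`. -/
theorem nondetOutputs_iff_trun (x w : Cantor) :
    M.NondetOutputs x w ↔ ∃ g, Writes (M.trun (Config.init x) g) w := by
  rw [nondetOutputs_iff]
  constructor
  · rintro ⟨d, h0, hd, hw⟩
    obtain ⟨g, rfl⟩ := exists_trun h0 hd
    exact ⟨g, hw⟩
  · rintro ⟨g, hw⟩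
    exact ⟨_, rfl, xstep_trun hw, hw⟩

/-- Without guesses, the valid outputs are what the run by total steps writes. -/
theorem yields_step_iff (hM : ∀ q0 q1, Vertex.guess q0 q1 ∉ M) {c : Config} (hc : c.Blank)
    (g w : Cantor) :
    M.Yields (fun c c' => M.step c = some c') c w ↔ Writes (M.trun c g) w := by
  rw [yields_iff (fun _ _ h => M.step_outStep h) (fun _ _ h => M.step_not_accept h)
    (fun _ _ _ h h' => Option.some_injective _ (h.symm.trans h')) hc w]
  constructor
  · rintro ⟨d, h0, hd, hw⟩
    have : M.trun c g = d := by
      funext t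
      induction t with
      | zero => exact h0.symm
      | succ t ih =>
        change M.tstep (g t) (M.trun c g t) = _
        rw [ih, tstep_of_xstep_step (hd t)]
    rwa [this]
  · intro hw
    refine ⟨_, rfl, fun t => ?_, hw⟩
    have : M.nondetStep = fun c c' => M.step c = some c' := by
      funext c c'; exact propext (nondetStep_iff_step hM c c')
    rw [← this]
    exact xstep_trun hw t

theorem tstep_outRel {c : Config} {l : List Bool} (h : OutRel c l) (b : Bool) :
    OutRel (M.tstep b c) (l ++ (M.emits c).toList) := by
  have key : ∀ (e : Bool) (c' : Config), c'.head 3 = c.head 3 + 1 →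
      c'.tape 3 = Function.update (c.tape 3) (c.head 3) e → OutRel c' (l ++ [e]) := by
    intro e c' h1 h2
    refine ⟨by simp [h1, h.1], fun p d hp => ?_⟩
    rw [h2, h.1]
    rcases lt_trichotomy p l.length with hl | rfl | hl
    · rw [Function.update_of_ne (by omega)]
      exact h.2 p d (by rwa [List.getElem?_append_left hl] at hp)
    · simpa using hp
    · rw [List.getElem?_eq_none (by simp; omega)] at hp; cases hp
  have key' : ∀ c' : Config, c'.head 3 = c.head 3 → c'.tape 3 = c.tape 3 → OutRel c' (l ++ []) := by
    intro c' h1 h2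
    rw [List.append_nil]
    unfold OutRel; rw [h1, h2]; exact h
  rcases hv : M[c.vertex]? with - | v
  · simpa [tstep, emits, step, hv] using h
  · cases v with
    | accept =>
      simp only [tstep, emits, hv]
      exact key false _ (by simp [Config.idle]) (by simp [Config.idle])
    | guess q0 q1 => simp only [tstep, emits, hv]; exact key' _ rfl rfl
    | start q => simp only [tstep, emits, hv, step]; exact key' _ rfl rfl
    | test i q0 q1 => simp only [tstep, emits, hv, step]; exact key' _ rfl rfl
    | left i q =>
      simp only [tstep, emits, hv, step]
      split_ifs
      · exact key' _ rfl rfl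
      · refine key' _ ?_ rfl
        fin_cases i <;> simp
    | right i q =>
      simp only [tstep, emits, hv, step]
      refine key' _ ?_ rfl
      fin_cases i <;> simp
    | write i e q =>
      simp only [tstep, emits, hv, step]
      split_ifs with hi
      · subst hi
        exact key e _ (by simp [show (Fin.succ 2 : Fin 4) = 3 from rfl])
          (by simp [show (Fin.succ 2 : Fin 4) = 3 from rfl])
      · have : (3 : Fin 4) ≠ i.succ := by
          intro h; apply hi; fin_cases i <;> simp_all [Fin.ext_iff]
        exact key' _ (by simp [Function.update_of_ne this]) (by simp [Function.update_of_ne this])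
    | query q0 q1 => simp only [tstep, emits, hv, step]; exact key' _ rfl rfl
    | reject => simp only [tstep, emits, hv, step]; exact key' _ rfl rfl

end Machine

/-! ### Simulation by primitive recursive functions -/

/-- A finite memory; cell `p` of tape `i` has the address `(i, p + 1)`, the head position on tape
`i` has the address `(i, 0)`, and the vertex the address `(4, 0)`. -/
abbrev Mem : Type := List ((ℕ × ℕ) × ℕ)

/-- The content of an address. -/
def Mem.get (m : Mem) (k : ℕ × ℕ) : ℕ := m.foldr (fun e r => if e.1 = k then e.2 else r) 0

theorem Mem.get_cons (k k' : ℕ × ℕ) (v : ℕ) (m : Mem) :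
    Mem.get ((k', v) :: m) k = if k' = k then v else m.get k := rfl

/-- Execution of the instruction `d` (label and edges of a vertex). -/
def exec (d : ℕ × ℕ × ℕ) (g : Bool) (m : Mem) : Mem :=
  if d.1 = 0 then ((4, 0), d.2.1) :: m
  else if d.1 < 3 then m
  else if d.1 < 6 then
    ((4, 0), if m.get (d.1 - 3, m.get (d.1 - 3, 0) + 1) = 1 then d.2.2 else d.2.1) :: m
  else if d.1 < 9 then
    if m.get (d.1 - 6, 0) = 0 then m
    else ((d.1 - 6, 0), m.get (d.1 - 6, 0) - 1) :: ((4, 0), d.2.1) :: m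
  else if d.1 < 12 then
    ((d.1 - 9, 0), m.get (d.1 - 9, 0) + 1) :: ((4, 0), d.2.1) :: m
  else if d.1 < 18 then
    (((d.1 - 12) / 2 + 1, 0), m.get ((d.1 - 12) / 2 + 1, 0) + 1) ::
      (((d.1 - 12) / 2 + 1, m.get ((d.1 - 12) / 2 + 1, 0) + 1), (d.1 - 12) % 2) ::
        ((4, 0), d.2.1) :: m
  else if d.1 = 19 then ((4, 0), if g = true then d.2.2 else d.2.1) :: m
  else m

/-- The simulation of a step of the machine with the instructions `D`. -/
def simStep (D : List (ℕ × ℕ × ℕ)) (g : Bool) (m : Mem) : Mem :=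
  Option.casesOn D[m.get (4, 0)]? m fun d => exec d g m

/-- The bit which the instruction `d` writes on the output tape. -/
def emitOf (d : ℕ × ℕ × ℕ) : Option Bool :=
  -- Label `1` is `accept`, which writes zeros; `16` and `17` are `12 + 2 * 2 + b`, writing `b` on
  -- the output tape.
  if d.1 = 1 ∨ d.1 = 16 then some false else if d.1 = 17 then some true else none

/-- The bit which is written on the output tape in the next step. -/
def simEmit (D : List (ℕ × ℕ × ℕ)) (m : Mem) : Option Bool :=
  D[m.get (4, 0)]?.bind emitOf

/-- Store one more cell of tapes `0`, `1` and `2`. -/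
def supply (n : ℕ) (b0 b2 : Bool) (m : Mem) : Mem :=
  ((0, n + 1), b0.toNat) :: ((1, n + 1), 0) :: ((2, n + 1), b2.toNat) :: m

/-- The memory `m` represents the configuration `c` on the first `n` cells of the tapes; the cells
from `n` on still hold `Z`, and the heads are at most at `h`. -/
structure Rep (Z : Fin 3 → Cantor) (n h : ℕ) (m : Mem) (c : Config) : Prop where
  vertex : m.get (4, 0) = c.vertex
  head : ∀ i : Fin 3, m.get (i.val, 0) = c.head i.castSucc
  cell : ∀ (i : Fin 3) (p : ℕ), p < n → m.get (i.val, p + 1) = (c.tape i.castSucc p).toNat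
  bound : ∀ i : Fin 3, c.head i.castSucc ≤ h
  fresh : ∀ (i : Fin 3) (p : ℕ), n ≤ p → c.tape i.castSucc p = Z i p

/-- No head has altered the cells from `n` on, so the next cell of each tape still has its original
content. -/
theorem Rep.supply {X Y : Cantor} {n h : ℕ} {m : Mem} {c : Config}
    (hr : Rep ![X, fun _ => false, Y] n h m c) :
    Rep ![X, fun _ => false, Y] (n + 1) h (supply n (X n) (Y n) m) c where
  vertex := by simp [TypeTwo.supply, Mem.get_cons, hr.vertex]
  head i := by rw [← hr.head]; simp [TypeTwo.supply, Mem.get_cons]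
  bound := hr.bound
  fresh i p hp := hr.fresh i p (by omega)
  cell i p hp := by
    rcases Nat.lt_succ_iff_lt_or_eq.1 hp with h | rfl
    · rw [← hr.cell i p h]
      have : n ≠ p := by omega
      simp [TypeTwo.supply, Mem.get_cons, this]
    · rw [hr.fresh i p le_rfl]
      fin_cases i <;> simp [TypeTwo.supply, Mem.get_cons]

theorem simEmit_eq {M : Machine} {Z : Fin 3 → Cantor} {n h : ℕ} {m : Mem} {c : Config}
    (hr : Rep Z n h m c) : simEmit (M.map Vertex.toNats) m = M.emits c := by
  unfold simEmit Machine.emits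
  rw [hr.vertex, List.getElem?_map]
  rcases M[c.vertex]? with - | v
  · rfl
  · cases v with
    | test i q0 q1 => fin_cases i <;> simp [Vertex.toNats, emitOf]
    | left i q => fin_cases i <;> simp [Vertex.toNats, emitOf]
    | right i q => fin_cases i <;> simp [Vertex.toNats, emitOf]
    | write i b q => fin_cases i <;> cases b <;> simp [Vertex.toNats, emitOf]
    | _ => simp [Vertex.toNats, emitOf]

/-- As `h < n`, the cells under the heads are among those stored, and the step neither needs nor
changes another cell. A head moves by at most one, which gives the new bound. -/
theorem rep_simStep {M : Machine} {Z : Fin 3 → Cantor} {n h : ℕ} {m : Mem} {c : Config}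
    (hr : Rep Z n h m c) (hn : h < n) (g : Bool) :
    Rep Z n (h + 1) (simStep (M.map Vertex.toNats) g m) (M.tstep g c) := by
  have hweak : Rep Z n (h + 1) m c :=
    ⟨hr.vertex, hr.head, hr.cell, fun i => (hr.bound i).trans (Nat.le_succ h), hr.fresh⟩
  have hjump : ∀ q, Rep Z n (h + 1) (((4, 0), q) :: m) { c with vertex := q } := fun q =>
    { vertex := by simp [Mem.get_cons]
      head := fun i => by
        rw [← hr.head]; simp only [Mem.get_cons, Prod.mk.injEq]; rw [if_neg (by omega)]
      cell := fun i p hp => by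
        rw [← hr.cell i p hp]; simp [Mem.get_cons]
      bound := hweak.bound
      fresh := hr.fresh }
  have hmove : ∀ q (j : Fin 3) k, k ≤ h + 1 → Rep Z n (h + 1)
      (((j.val, 0), k) :: ((4, 0), q) :: m)
      { c with vertex := q, head := Function.update c.head j.castSucc k } := fun q j k hk =>
    { vertex := by
        simp only [Mem.get_cons, Prod.mk.injEq]; rw [if_neg (by omega)]; simp
      head := fun i => by
        have := (hjump q).head i
        rw [Mem.get_cons, this]
        by_cases hij : j = i
        · subst hij; simp
        · have hne : i.castSucc ≠ j.castSucc := by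
            simpa [Fin.ext_iff] using fun h => hij (Fin.ext h.symm)
          simp only [Function.update_of_ne hne]
          rw [if_neg (by simpa [Fin.ext_iff] using hij)]
      cell := fun i p hp => by
        rw [← (hjump q).cell i p hp]; simp [Mem.get_cons]
      bound := fun i => by
        by_cases hij : j = i
        · subst hij; simpa using hk
        · have hne : i.castSucc ≠ j.castSucc := by
            simpa [Fin.ext_iff] using fun h => hij (Fin.ext h.symm)
          simp only [Function.update_of_ne hne]
          exact hweak.bound i
      fresh := hr.fresh }
  unfold simStep Machine.tstep
  rw [hr.vertex, List.getElem?_map]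
  rcases hv : M[c.vertex]? with - | v
  · simpa [Machine.step, hv] using hweak
  · cases v with
    | accept =>
      simp only [Option.map_some, Vertex.toNats, exec]
      norm_num
      refine ⟨hr.vertex, fun i => ?_, fun i p hp => ?_, fun i => ?_, fun i p hp => ?_⟩
      · rw [hr.head]; fin_cases i <;> simp [Config.idle]
      · rw [hr.cell i p hp]; fin_cases i <;> simp [Config.idle]
      · have := hweak.bound i; fin_cases i <;> simpa [Config.idle] using this
      · rw [← hr.fresh i p hp]; fin_cases i <;> simp [Config.idle]
    | reject => simpa [Vertex.toNats, exec, Machine.step, hv] using hweak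
    | query q0 q1 => simpa [Vertex.toNats, exec, Machine.step, hv] using hweak
    | start q => simpa [Vertex.toNats, exec, Machine.step, hv] using hjump q
    | guess q0 q1 => simpa [Vertex.toNats, exec] using hjump (if g = true then q1 else q0)
    | test i q0 q1 =>
      have hc := hr.cell i (c.head i.castSucc) (lt_of_le_of_lt (hr.bound i) hn)
      have := hjump (if c.tape i.castSucc (c.head i.castSucc) then q1 else q0)
      have e1 : 3 + i.val ≠ 0 := by omega
      have e2 : ¬ 3 + i.val < 3 := by omega
      have e3 : 3 + i.val < 6 := by omega
      simp only [Option.map_some, Vertex.toNats, exec, e1, e2, e3, if_true, if_false,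
        Nat.add_sub_cancel_left, hr.head, hc, Machine.step, hv, Option.getD_some]
      cases hb : c.tape i.castSucc (c.head i.castSucc) <;> simpa [hb] using this
    | left i q =>
      have e1 : 6 + i.val ≠ 0 := by omega
      have e2 : ¬ 6 + i.val < 3 := by omega
      have e3 : ¬ 6 + i.val < 6 := by omega
      have e4 : 6 + i.val < 9 := by omega
      simp only [Option.map_some, Vertex.toNats, exec, e1, e2, e3, e4, if_true, if_false,
        Nat.add_sub_cancel_left, hr.head, Machine.step, hv]
      split_ifs with h0
      · exact hweak
      · exact hmove q i _ (by have := hr.bound i; omega)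
    | right i q =>
      have e1 : 9 + i.val ≠ 0 := by omega
      have e2 : ¬ 9 + i.val < 3 := by omega
      have e3 : ¬ 9 + i.val < 6 := by omega
      have e4 : ¬ 9 + i.val < 9 := by omega
      have e5 : 9 + i.val < 12 := by omega
      simp only [Option.map_some, Vertex.toNats, exec, e1, e2, e3, e4, e5, if_true, if_false,
        Nat.add_sub_cancel_left, hr.head, Machine.step, hv]
      exact hmove q i _ (by have := hr.bound i; omega)
    | write i b q =>
      have hb2 : b.toNat < 2 := by cases b <;> simp
      have e1 : 12 + 2 * i.val + b.toNat ≠ 0 := by omega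
      have e2 : ¬ 12 + 2 * i.val + b.toNat < 3 := by omega
      have e3 : ¬ 12 + 2 * i.val + b.toNat < 6 := by omega
      have e4 : ¬ 12 + 2 * i.val + b.toNat < 9 := by omega
      have e5 : ¬ 12 + 2 * i.val + b.toNat < 12 := by omega
      have e6 : 12 + 2 * i.val + b.toNat < 18 := by omega
      have e7 : (12 + 2 * i.val + b.toNat - 12) / 2 + 1 = i.val + 1 := by omega
      have e8 : (12 + 2 * i.val + b.toNat - 12) % 2 = b.toNat := by omega
      simp only [Option.map_some, Vertex.toNats, exec, e1, e2, e3, e4, e5, e6, e7, e8, if_true,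
        if_false, Machine.step, hv, Option.getD_some]
      -- Writing on the output tape stores entries for tape `3` only, which the representation
      -- ignores.
      by_cases hi : i = 2
      · subst hi
        refine ⟨?_, fun j => ?_, fun j p hp => ?_, fun j => ?_, fun j p hp => ?_⟩
        · simp [Mem.get_cons]
        · refine Eq.trans ?_ (((hjump q).head j).trans ?_)
          · simp only [Mem.get_cons, Prod.mk.injEq]
            rw [if_neg (by simp; omega), if_neg (by simp)]
          · fin_cases j <;> simp
        · have := (hjump q).cell j p hp
          fin_cases j <;> simpa [Mem.get_cons] using this
        · have := hweak.bound j
          fin_cases j <;> simpa using this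
        · have := hr.fresh j p hp
          fin_cases j <;> simpa using this
      · obtain ⟨k, rfl⟩ : ∃ k : Fin 2, i = k.castSucc := by
          fin_cases i
          · exact ⟨0, rfl⟩
          · exact ⟨1, rfl⟩
          · exact (hi rfl).elim
        have hh := hr.head k.succ
        have hk1 : (k.castSucc : Fin 3).val + 1 = (k.succ : Fin 3).val := by simp
        rw [hk1, hh, Fin.succ_castSucc]
        have hb1 : c.head k.succ.castSucc < n := lt_of_le_of_lt (hr.bound k.succ) hn
        have hm := hmove q k.succ (c.head k.succ.castSucc + 1)
          (by have := hr.bound k.succ; omega)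
        refine ⟨?_, fun j => ?_, fun j p hp => ?_, fun j => ?_, fun j p hp => ?_⟩
        · rw [← hm.vertex]
          simp only [Mem.get_cons, Prod.mk.injEq]
          simp
        · rw [← hm.head]
          simp only [Mem.get_cons, Prod.mk.injEq]
          simp
        · by_cases hj : k.succ = j
          · subst hj
            simp only [Function.update_self]
            by_cases hp' : p = c.head k.succ.castSucc
            · subst hp'; simp [Mem.get_cons]
            · rw [Function.update_of_ne hp', ← hm.cell k.succ p hp]
              simp [Mem.get_cons, Ne.symm hp', -Fin.castSucc_succ]
          · have hne : j.castSucc ≠ k.succ.castSucc := fun h => hj (Fin.castSucc_injective _ h).symm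
            simp only [Function.update_of_ne hne]
            rw [← hm.cell j p hp]
            have : ¬ k.val + 1 = j.val := fun h => hj (Fin.ext (by simpa using h))
            simp [Mem.get_cons, this]
        · exact hm.bound j
        · by_cases hj : k.succ = j
          · subst hj
            simp only [Function.update_self]
            rw [Function.update_of_ne (by omega)]
            exact hr.fresh _ p hp
          · have hne : j.castSucc ≠ k.succ.castSucc := fun h => hj (Fin.castSucc_injective _ h).symm
            simp only [Function.update_of_ne hne]
            exact hr.fresh j p hp

theorem rep_init (x : Cantor) :
    Rep ![x, fun _ => false, fun _ => false] 0 0 [] (Config.init x) where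
  vertex := rfl
  head _ := rfl
  cell _ _ hp := by omega
  bound _ := le_rfl
  fresh i p _ := by fin_cases i <;> simp [Config.init]

/-! ### The simulation is primitive recursive -/

section Primrec

variable {α : Type*} [Primcodable α]

theorem primrec_get : Primrec₂ Mem.get :=
  Primrec.list_foldr (α := Mem × (ℕ × ℕ)) (σ := ℕ) (β := (ℕ × ℕ) × ℕ)
    (h := fun a e => if e.1.1 = a.2 then e.1.2 else e.2) Primrec.fst (Primrec.const 0)
    (Primrec.ite (Primrec.eq.comp (Primrec.fst.comp (Primrec.fst.comp Primrec.snd))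
      (Primrec.snd.comp Primrec.fst)) (Primrec.snd.comp (Primrec.fst.comp Primrec.snd))
      (Primrec.snd.comp Primrec.snd))

theorem primrec_cell {m : α → Mem} {i p : α → ℕ} (hm : Primrec m) (hi : Primrec i)
    (hp : Primrec p) : Primrec fun a => (m a).get (i a, p a) :=
  primrec_get.comp hm (Primrec.pair hi hp)

theorem primrec_store {m : α → Mem} {i p v : α → ℕ} (hm : Primrec m) (hi : Primrec i)
    (hp : Primrec p) (hv : Primrec v) :
    Primrec fun a => (((i a, p a), v a) :: m a : Mem) :=
  Primrec.list_cons.comp (Primrec.pair (Primrec.pair hi hp) hv) hm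

theorem primrec_exec {d : α → ℕ × ℕ × ℕ} {g : α → Bool} {m : α → Mem} (hd : Primrec d)
    (hg : Primrec g) (hm : Primrec m) : Primrec fun a => exec (d a) (g a) (m a) := by
  have c := fun n => Primrec.const (α := α) (n : ℕ)
  have hl : Primrec fun a => (d a).1 := Primrec.fst.comp hd
  have h1 : Primrec fun a => (d a).2.1 := Primrec.fst.comp (Primrec.snd.comp hd)
  have h2 : Primrec fun a => (d a).2.2 := Primrec.snd.comp (Primrec.snd.comp hd)
  have hlt : ∀ n, PrimrecPred fun a => (d a).1 < n := fun n => Primrec.nat_lt.comp hl (c n)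
  have heq : ∀ n, PrimrecPred fun a => (d a).1 = n := fun n => Primrec.eq.comp hl (c n)
  have hsub : ∀ n, Primrec fun a => (d a).1 - n := fun n => Primrec.nat_sub.comp hl (c n)
  have hhead : ∀ {i : α → ℕ}, Primrec i → Primrec fun a => (m a).get (i a, 0) :=
    fun hi => primrec_cell hm hi (c 0)
  have hjump : ∀ {q : α → ℕ}, Primrec q → Primrec fun a => (((4, 0), q a) :: m a : Mem) :=
    fun hq => primrec_store hm (c 4) (c 0) hq
  have hi : Primrec fun a => ((d a).1 - 12) / 2 + 1 :=
    Primrec.succ.comp (Primrec.nat_div.comp (hsub 12) (c 2))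
  refine Primrec.ite (heq 0) (hjump h1) (Primrec.ite (hlt 3) hm (Primrec.ite (hlt 6) ?_
    (Primrec.ite (hlt 9) (Primrec.ite ?_ hm ?_) (Primrec.ite (hlt 12) ?_ (Primrec.ite (hlt 18) ?_
      (Primrec.ite (heq 19) (hjump (Primrec.ite (Primrec.eq.comp hg (Primrec.const true)) h2 h1))
        hm))))))
  · exact hjump (Primrec.ite (Primrec.eq.comp (primrec_cell hm (hsub 3)
      (Primrec.succ.comp (hhead (hsub 3)))) (c 1)) h2 h1)
  · exact Primrec.eq.comp (hhead (hsub 6)) (c 0)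
  · exact primrec_store (hjump h1) (hsub 6) (c 0) (Primrec.nat_sub.comp (hhead (hsub 6)) (c 1))
  · exact primrec_store (hjump h1) (hsub 9) (c 0) (Primrec.succ.comp (hhead (hsub 9)))
  · exact primrec_store (primrec_store (hjump h1) hi (Primrec.succ.comp (hhead hi))
      (Primrec.nat_mod.comp (hsub 12) (c 2))) hi (c 0) (Primrec.succ.comp (hhead hi))

theorem primrec_fetch {D : α → List (ℕ × ℕ × ℕ)} {m : α → Mem} (hD : Primrec D)
    (hm : Primrec m) : Primrec fun a => (D a)[(m a).get (4, 0)]? :=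
  Primrec.list_getElem?.comp hD (primrec_cell hm (Primrec.const 4) (Primrec.const 0))

theorem primrec_simStep {D : α → List (ℕ × ℕ × ℕ)} {g : α → Bool} {m : α → Mem} (hD : Primrec D)
    (hg : Primrec g) (hm : Primrec m) : Primrec fun a => simStep (D a) (g a) (m a) :=
  Primrec.option_casesOn (g := fun a d => exec d (g a) (m a)) (primrec_fetch hD hm) hm
    (primrec_exec Primrec.snd (hg.comp Primrec.fst) (hm.comp Primrec.fst))

theorem primrec_simEmit {D : α → List (ℕ × ℕ × ℕ)} {m : α → Mem} (hD : Primrec D)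
    (hm : Primrec m) : Primrec fun a => simEmit (D a) (m a) := by
  refine Primrec.option_bind (g := fun _ d => emitOf d) (primrec_fetch hD hm) ?_
  have hl : Primrec fun p : α × ℕ × ℕ × ℕ => p.2.1 := Primrec.fst.comp Primrec.snd
  have c := fun n => Primrec.eq.comp hl (Primrec.const (α := α × ℕ × ℕ × ℕ) (n : ℕ))
  exact Primrec.ite ((c 1).or (c 16)) (Primrec.const _)
    (Primrec.ite (c 17) (Primrec.const _) (Primrec.const _))

theorem primrec_supply {n : α → ℕ} {b b' : α → Bool} {m : α → Mem} (hn : Primrec n)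
    (hb : Primrec b) (hb' : Primrec b') (hm : Primrec m) :
    Primrec fun a => supply (n a) (b a) (b' a) (m a) := by
  have ht : ∀ {b : α → Bool}, Primrec b → Primrec fun a => (b a).toNat :=
    fun hb => (Primrec.dom_bool Bool.toNat).comp hb
  have hs := Primrec.succ.comp hn
  have c := fun n => Primrec.const (α := α) (n : ℕ)
  exact primrec_store (primrec_store (primrec_store hm (c 2) hs (ht hb')) (c 1) hs (c 0)) (c 0)
    hs (ht hb)

end Primrec

/-! ### Transducers from nondeterministic machines -/

/-- The list of the bits emitted before time `n`. -/
def emitted (e : ℕ → Option Bool) (n : ℕ) : List Bool :=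
  (List.range n).flatMap fun t => (e t).toList

theorem emitted_succ (e : ℕ → Option Bool) (n : ℕ) :
    emitted e (n + 1) = emitted e n ++ (e n).toList := by
  simp [emitted, List.range_succ]

theorem emitted_add (e : ℕ → Option Bool) (m n : ℕ) :
    emitted e (m + n) = emitted e m ++ emitted (fun t => e (m + t)) n := by
  simp [emitted, List.range_add, List.flatMap_map]

theorem emitted_prefix (e : ℕ → Option Bool) {m n : ℕ} (h : m ≤ n) :
    emitted e m <+: emitted e n := by
  obtain ⟨k, rfl⟩ := Nat.exists_eq_add_of_le h
  rw [emitted_add]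
  exact List.prefix_append _ _

theorem length_emitted_le (e : ℕ → Option Bool) (n : ℕ) : (emitted e n).length ≤ n := by
  induction n with
  | zero => simp [emitted]
  | succ n ih =>
    have : (e n).toList.length ≤ 1 := by cases e n <;> simp
    rw [emitted_succ, List.length_append]
    omega

theorem emitted_eq_nil {e : ℕ → Option Bool} {n : ℕ} (h : ∀ t < n, e t = none) :
    emitted e n = [] := by
  simp only [emitted, List.flatMap_eq_nil_iff, List.mem_range]
  intro t ht
  simp [h t ht]

/-- Every stream of bits is a prefix of an infinite sequence. -/
theorem exists_extends_emitted (e : ℕ → Option Bool) :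
    ∃ w : Cantor, ∀ n p b, (emitted e n)[p]? = some b → w p = b := by
  obtain ⟨w, hw⟩ := exists_extends_collect (fun o : Option Bool => o.toList)
    (fun n => Nat.casesOn n none e)
  refine ⟨w, fun n p b hb => hw n p b ?_⟩
  suffices h : collect (fun o : Option Bool => o.toList) (fun n => Nat.casesOn n none e) n =
      emitted e n by rw [h, hb]
  clear hb
  induction n with
  | zero => rfl
  | succ n ih => rw [collect, ih, emitted_succ]

/-- Writing an infinite sequence is a property of the list of the bits emitted. -/
theorem writes_trun_iff (M : Machine) {c : Config} (hc : OutRel c []) (g w : Cantor) :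
    Writes (M.trun c g) w ↔ Spells (fun n => emitted (fun t => M.emits (M.trun c g t)) n) w := by
  refine writes_iff_spells (fun t => ?_) w
  induction t with
  | zero => exact hc
  | succ t ih =>
    rw [emitted_succ]
    exact Machine.tstep_outRel ih (g t)

theorem collect_eq_emitted {σ : Type*} (o : σ → Option Bool) (run : ℕ → σ) (e : ℕ → Option Bool)
    (h : ∀ t, o (run (t + 1)) = e t) (n : ℕ) :
    collect (fun s => (o s).toList) run n = emitted e n := by
  induction n with
  | zero => rfl
  | succ n ih => rw [collect, ih, h, emitted_succ]

/-- The transducer which simulates a nondeterministic machine. -/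
def Machine.simulator (M : Machine) : Transducer where
  -- The time, the memory, and the bit emitted in the last step.
  σ := ℕ × Mem × Option Bool
  init := (0, [], none)
  next a g s :=
    (s.1 + 1, simStep (M.map Vertex.toNats) g (supply s.1 a false s.2.1),
      simEmit (M.map Vertex.toNats) (supply s.1 a false s.2.1))
  out s := s.2.2
  primrec_next := by
    have hs : Primrec fun p : Bool × Bool × ℕ × Mem × Option Bool =>
        supply p.2.2.1 p.1 false p.2.2.2.1 :=
      primrec_supply (Primrec.fst.comp (Primrec.snd.comp Primrec.snd)) Primrec.fst
        (Primrec.const false) (Primrec.fst.comp (Primrec.snd.comp (Primrec.snd.comp Primrec.snd)))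
    exact Primrec.pair (Primrec.succ.comp (Primrec.fst.comp (Primrec.snd.comp Primrec.snd)))
      (Primrec.pair (primrec_simStep (Primrec.const _) (Primrec.fst.comp Primrec.snd) hs)
        (primrec_simEmit (Primrec.const _) hs))
  primrec_out := Primrec.snd.comp Primrec.snd

theorem outRel_init (x : Cantor) : OutRel (Config.init x) [] := ⟨rfl, by simp⟩

/-- Round `t` supplies cell `t` of each tape and then makes a step; the heads are at most at `t` by
then. -/
theorem Machine.simulator_outputs_iff (M : Machine) (x g w : Cantor) :
    M.simulator.Outputs x g w ↔ Writes (M.trun (Config.init x) g) w := by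
  rw [writes_trun_iff M (outRel_init x)]
  have hrep : ∀ t, (M.simulator.run x g t).1 = t ∧ Rep ![x, fun _ => false, fun _ => false] t t
      (M.simulator.run x g t).2.1 (M.trun (Config.init x) g t) := by
    intro t
    induction t with
    | zero => exact ⟨rfl, rep_init x⟩
    | succ t ih =>
      obtain ⟨h1, h2⟩ := ih
      rw [M.simulator.run_succ]
      refine ⟨congrArg (· + 1) h1, ?_⟩
      change Rep _ _ _ (simStep _ (g t) (supply (M.simulator.run x g t).1 (x t) false _)) _
      rw [h1]
      exact rep_simStep h2.supply (Nat.lt_succ_self t) (g t)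
  have he : ∀ t, M.simulator.out (M.simulator.run x g (t + 1)) =
      M.emits (M.trun (Config.init x) g t) := by
    intro t
    obtain ⟨h1, h2⟩ := hrep t
    rw [M.simulator.run_succ]
    change simEmit _ (supply (M.simulator.run x g t).1 (x t) false _) = _
    rw [h1]
    exact simEmit_eq h2.supply
  unfold Transducer.Outputs
  rw [show collect _ _ = _ from funext fun n => collect_eq_emitted _ _ _ he n]

theorem Machine.nondetOutputs_iff_simulator (M : Machine) (x w : Cantor) :
    M.NondetOutputs x w ↔ ∃ g, M.simulator.Outputs x g w := by
  simp only [Machine.nondetOutputs_iff_trun, M.simulator_outputs_iff]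

/-! ### Decoding names of machines -/

/-- The vertex with a given label and edges; the inverse of `Vertex.toNats`. -/
def Vertex.ofNats (d : ℕ × ℕ × ℕ) : Vertex :=
  if d.1 = 0 then .start d.2.1
  else if d.1 = 1 then .accept
  else if d.1 = 2 then .reject
  else if d.1 < 6 then .test (Fin.ofNat 3 (d.1 - 3)) d.2.1 d.2.2
  else if d.1 < 9 then .left (Fin.ofNat 3 (d.1 - 6)) d.2.1
  else if d.1 < 12 then .right (Fin.ofNat 3 (d.1 - 9)) d.2.1
  else if d.1 < 18 then .write (Fin.ofNat 3 ((d.1 - 12) / 2)) (decide ((d.1 - 12) % 2 = 1)) d.2.1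
  else if d.1 = 18 then .query d.2.1 d.2.2
  else .guess d.2.1 d.2.2

theorem Vertex.ofNats_toNats (v : Vertex) : Vertex.ofNats v.toNats = v := by
  cases v with
  | test i q0 q1 => fin_cases i <;> rfl
  | left i q => fin_cases i <;> rfl
  | right i q => fin_cases i <;> rfl
  | write i b q => fin_cases i <;> cases b <;> simp [toNats, ofNats] <;> rfl
  | _ => rfl

theorem Vertex.toNats_injective : Function.Injective Vertex.toNats :=
  Function.LeftInverse.injective Vertex.ofNats_toNats

theorem Machine.code_injective : Function.Injective Machine.code := fun _ _ h =>
  Vertex.toNats_injective.list_map (Encodable.encode_injective h)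

/-- `d` describes a vertex of a Type-2-Machine with `n` vertices. -/
def GoodVertex (d : ℕ × ℕ × ℕ) (n : ℕ) : Prop :=
  ((d.1 = 1 ∨ d.1 = 2) ∧ d.2.1 = 0 ∧ d.2.2 = 0) ∨
  ((¬ d.1 < 3 ∧ d.1 < 6) ∧ (0 < d.2.1 ∧ d.2.1 < n) ∧ 0 < d.2.2 ∧ d.2.2 < n) ∨
  ((d.1 = 0 ∨ (¬ d.1 < 6 ∧ d.1 < 18)) ∧ (0 < d.2.1 ∧ d.2.1 < n) ∧ d.2.2 = 0)

theorem goodVertex_toNats {v : Vertex} {n : ℕ} : GoodVertex v.toNats n ↔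
    (∀ q0 q1, v ≠ .query q0 q1) ∧ (∀ q0 q1, v ≠ .guess q0 q1) ∧ ∀ q ∈ v.succs, 0 < q ∧ q < n := by
  cases v with
  | test i q0 q1 => fin_cases i <;> simp [GoodVertex, Vertex.toNats, Vertex.succs]
  | left i q => fin_cases i <;> simp [GoodVertex, Vertex.toNats, Vertex.succs]
  | right i q => fin_cases i <;> simp [GoodVertex, Vertex.toNats, Vertex.succs]
  | write i b q => fin_cases i <;> cases b <;> simp [GoodVertex, Vertex.toNats, Vertex.succs]
  | _ => simp [GoodVertex, Vertex.toNats, Vertex.succs]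

/-- Unused edges are required to be `0`, so a good description is recovered from its vertex. -/
theorem GoodVertex.toNats_ofNats {d : ℕ × ℕ × ℕ} {n : ℕ} (h : GoodVertex d n) :
    (Vertex.ofNats d).toNats = d := by
  obtain ⟨l, a, b⟩ := d
  simp only [GoodVertex] at h
  have hl : l < 18 := by omega
  interval_cases l <;> simp [Vertex.ofNats, Vertex.toNats] at h ⊢ <;> omega

/-- `D` describes a Type-2-Machine. -/
def GoodProgram (D : List (ℕ × ℕ × ℕ)) : Prop :=
  0 < D.length ∧ D.headI.1 = 0 ∧ (∀ d ∈ D.tail, d.1 ≠ 0) ∧ ∀ d ∈ D, GoodVertex d D.length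

theorem Vertex.toNats_fst_eq_zero {v : Vertex} : v.toNats.1 = 0 ↔ ∃ q, v = .start q := by
  cases v <;> simp [Vertex.toNats]

theorem goodProgram_iff {M : Machine} : GoodProgram (M.map Vertex.toNats) ↔ M.IsType2 := by
  cases M with
  | nil =>
    refine ⟨fun h => absurd h.1 (by simp), fun h => ?_⟩
    obtain ⟨q, hq⟩ := h.start_zero
    simp at hq
  | cons v M =>
    simp only [GoodProgram, List.map_cons, List.headI_cons, List.tail_cons, List.length_cons,
      List.length_map, List.mem_map, forall_exists_index, and_imp, forall_apply_eq_imp_iff₂,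
      Nat.succ_pos, true_and, ne_eq, Vertex.toNats_fst_eq_zero]
    constructor
    · rintro ⟨⟨q, rfl⟩, h2, h3⟩
      have h3' : ∀ u ∈ Vertex.start q :: M, GoodVertex u.toNats (M.length + 1) := by
        intro u hu
        rcases List.mem_cons.1 hu with rfl | hu
        · exact h3 _ (by simp)
        · exact h3 _ (by simp only [List.mem_cons, List.mem_map]; exact Or.inr ⟨u, hu, rfl⟩)
      refine ⟨⟨⟨q, rfl⟩, fun i q' hi => ?_, fun u hu q' hq => ?_⟩, fun q0 q1 hu => ?_,
        fun q0 q1 hu => ?_⟩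
      · cases i with
        | zero => rfl
        | succ i =>
          rw [List.getElem?_cons_succ] at hi
          exact (h2 _ (List.mem_of_getElem? hi) ⟨q', rfl⟩).elim
      · exact (goodVertex_toNats.1 (h3' u hu)).2.2 q' hq
      · exact (goodVertex_toNats.1 (h3' _ hu)).1 _ _ rfl
      · exact (goodVertex_toNats.1 (h3' _ hu)).2.1 _ _ rfl
    · intro h
      obtain ⟨q, hq⟩ := h.start_zero
      refine ⟨⟨q, by simpa using hq⟩, fun u hu => ?_, fun d hd => ?_⟩
      · rintro ⟨q', rfl⟩
        obtain ⟨i, hi⟩ := List.getElem?_of_mem hu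
        have := h.start_unique (i + 1) q' (by simpa using hi)
        omega
      · obtain ⟨u, hu, rfl⟩ : ∃ u ∈ v :: M, u.toNats = d := by
          rwa [← List.mem_map, List.map_cons]
        refine goodVertex_toNats.2 ⟨?_, ?_, h.edges u hu⟩
        · rintro q0 q1 rfl; exact h.no_query _ _ hu
        · rintro q0 q1 rfl; exact h.no_guess _ _ hu

theorem GoodProgram.exists_machine {D : List (ℕ × ℕ × ℕ)} (h : GoodProgram D) :
    ∃ M : Machine, M.IsType2 ∧ M.map Vertex.toNats = D := by
  have : (D.map Vertex.ofNats).map Vertex.toNats = D := by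
    rw [List.map_map]
    conv_rhs => rw [← List.map_id D]
    exact List.map_congr_left fun d hd => (h.2.2.2 d hd).toNats_ofNats
  exact ⟨D.map Vertex.ofNats, goodProgram_iff.1 (this.symm ▸ h), this⟩

theorem primrec_goodVertex : PrimrecRel GoodVertex := by
  have hl : Primrec fun p : (ℕ × ℕ × ℕ) × ℕ => p.1.1 := Primrec.fst.comp Primrec.fst
  have ha : Primrec fun p : (ℕ × ℕ × ℕ) × ℕ => p.1.2.1 :=
    Primrec.fst.comp (Primrec.snd.comp Primrec.fst)
  have hb : Primrec fun p : (ℕ × ℕ × ℕ) × ℕ => p.1.2.2 :=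
    Primrec.snd.comp (Primrec.snd.comp Primrec.fst)
  have c := fun n => Primrec.const (α := (ℕ × ℕ × ℕ) × ℕ) (n : ℕ)
  have hz : ∀ {u : (ℕ × ℕ × ℕ) × ℕ → ℕ}, Primrec u → ∀ n, PrimrecPred fun p => u p = n :=
    fun hu n => Primrec.eq.comp hu (c n)
  have hlt : ∀ n, PrimrecPred fun p : (ℕ × ℕ × ℕ) × ℕ => p.1.1 < n :=
    fun n => Primrec.nat_lt.comp hl (c n)
  have hr : ∀ {u : (ℕ × ℕ × ℕ) × ℕ → ℕ}, Primrec u → PrimrecPred fun p => 0 < u p ∧ u p < p.2 :=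
    fun hu => (Primrec.nat_lt.comp (c 0) hu).and (Primrec.nat_lt.comp hu Primrec.snd)
  exact (((hz hl 1).or (hz hl 2)).and ((hz ha 0).and (hz hb 0))).or
    ((((hlt 3).not.and (hlt 6)).and ((hr ha).and (hr hb))).or
      (((hz hl 0).or ((hlt 6).not.and (hlt 18))).and ((hr ha).and (hz hb 0))))

/-- Only names of Type-2-Machines give instances of `UnProject`, so the universal system has to
check well-formedness. -/
theorem primrec_goodProgram : PrimrecPred GoodProgram := by
  have h0 : PrimrecPred fun d : ℕ × ℕ × ℕ => d.1 ≠ 0 :=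
    (Primrec.eq.comp Primrec.fst (Primrec.const 0)).not
  exact (Primrec.nat_lt.comp (Primrec.const 0) Primrec.list_length).and
    ((Primrec.eq.comp (Primrec.fst.comp Primrec.list_headI) (Primrec.const 0)).and
      ((h0.forall_mem_list.comp Primrec.list_tail).and
        (primrec_goodVertex.forall_mem_list.comp Primrec.id Primrec.list_length)))

open Classical in
/-- The program with Gödel number `k`; it is empty if this is not the number of a
Type-2-Machine. -/
noncomputable def programOf (k : ℕ) : List (ℕ × ℕ × ℕ) :=
  -- `decode₂` yields a list only if `k` is its exact code, so no other number can stand for a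
  -- program.
  if GoodProgram ((Encodable.decode₂ _ k).getD []) then (Encodable.decode₂ _ k).getD [] else []

theorem primrec_programOf : Primrec programOf := by
  classical
  have h : Primrec fun k : ℕ => (Encodable.decode₂ (List (ℕ × ℕ × ℕ)) k).getD [] :=
    Primrec.option_getD.comp Primrec.decode₂ (Primrec.const [])
  exact Primrec.ite (primrec_goodProgram.comp h) h (Primrec.const [])

theorem programOf_code {M : Machine} (hM : M.IsType2) :
    programOf M.code = M.map Vertex.toNats := by
  simp [programOf, Machine.code, goodProgram_iff, hM]

theorem programOf_cases (k : ℕ) : programOf k = [] ∨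
    ∃ M : Machine, M.IsType2 ∧ M.code = k ∧ programOf k = M.map Vertex.toNats := by
  classical
  unfold programOf
  split_ifs with h
  · obtain ⟨M, hM, hD⟩ := h.exists_machine
    refine Or.inr ⟨M, hM, ?_, hD.symm⟩
    rcases hd : Encodable.decode₂ (List (ℕ × ℕ × ℕ)) k with - | D
    · rw [hd] at h; exact absurd h.1 (by simp)
    · rw [hd, Option.getD_some] at hD
      rw [Machine.code, hD]
      exact Encodable.decode₂_eq_some.1 hd
  · exact Or.inl rfl

/-! ### A universal machine -/

/-- The states of the universal system: the number of leading ones found in the name, the program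
once it is known, the number of steps simulated so far, the memory of the simulation. -/
abbrev UState : Type := ℕ × Option (List (ℕ × ℕ × ℕ)) × ℕ × Mem

/-- The memory for the next simulated step, when the next bits of `⟨x, y⟩` are `b` and `c`. -/
def uSupply (b c : Bool) (s : UState) : Mem :=
  supply (2 * s.2.2.1 + 1) c false (supply (2 * s.2.2.1) b false s.2.2.2)

/-- The universal system reads the next bit `b` of the name of an instance of `UnProject` and the
next bit `c` of a possible solution. -/
noncomputable def uNext (b c : Bool) (s : UState) : UState :=
  Option.casesOn s.2.1
    (if b = true then (s.1 + 1, none, 0, []) else (s.1, some (programOf s.1), 0, []))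
    fun D => (s.1, some D, s.2.2.1 + 1, simStep D false (uSupply b c s))

/-- The output of the universal system when it reads `b` and `c`. -/
def uOut (b c : Bool) (s : UState) : Option Bool :=
  s.2.1.bind fun D => simEmit D (uSupply b c s)

section

variable {α : Type*} [Primcodable α] {b c : α → Bool} {s : α → UState}

theorem primrec_uSupply (hb : Primrec b) (hc : Primrec c) (hs : Primrec s) :
    Primrec fun a => uSupply (b a) (c a) (s a) := by
  have hj : Primrec fun a => 2 * (s a).2.2.1 := Primrec.nat_double.comp
    (Primrec.fst.comp (Primrec.snd.comp (Primrec.snd.comp hs)))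
  exact primrec_supply (Primrec.succ.comp hj) hc (Primrec.const _)
    (primrec_supply hj hb (Primrec.const _) (Primrec.snd.comp (Primrec.snd.comp
      (Primrec.snd.comp hs))))

theorem primrec_uNext (hb : Primrec b) (hc : Primrec c) (hs : Primrec s) :
    Primrec fun a => uNext (b a) (c a) (s a) := by
  have h1 : Primrec fun a => (s a).1 := Primrec.fst.comp hs
  refine Primrec.option_casesOn (g := fun a D => ((s a).1, some D, (s a).2.2.1 + 1,
    simStep D false (uSupply (b a) (c a) (s a)))) (Primrec.fst.comp (Primrec.snd.comp hs)) ?_ ?_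
  · exact Primrec.ite (Primrec.eq.comp hb (Primrec.const true))
      (Primrec.pair (Primrec.succ.comp h1) (Primrec.const _))
      (Primrec.pair h1 (Primrec.pair (Primrec.option_some.comp (primrec_programOf.comp h1))
        (Primrec.const _)))
  · exact Primrec.pair (h1.comp Primrec.fst) (Primrec.pair
      (Primrec.option_some.comp Primrec.snd) (Primrec.pair (Primrec.succ.comp
        ((Primrec.fst.comp (Primrec.snd.comp (Primrec.snd.comp hs))).comp Primrec.fst))
        (primrec_simStep Primrec.snd (Primrec.const _)
          ((primrec_uSupply hb hc hs).comp Primrec.fst))))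

theorem primrec_uOut (hb : Primrec b) (hc : Primrec c) (hs : Primrec s) :
    Primrec fun a => uOut (b a) (c a) (s a) :=
  Primrec.option_bind (g := fun a D => simEmit D (uSupply (b a) (c a) (s a)))
    (Primrec.fst.comp (Primrec.snd.comp hs))
    (primrec_simEmit Primrec.snd ((primrec_uSupply hb hc hs).comp Primrec.fst))

end

/-- The run of the universal system on the possible instance `q` and the possible solution `y`. -/
noncomputable def uRun (q y : Cantor) : ℕ → UState
  | 0 => (0, none, 0, [])
  | n + 1 => uNext (q n) (y (uRun q y n).2.2.1) (uRun q y n)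

/-- The bits emitted by the universal system. -/
noncomputable def uEmits (q y : Cantor) (n : ℕ) : Option Bool :=
  uOut (q n) (y (uRun q y n).2.2.1) (uRun q y n)

section

variable {q y : Cantor}

theorem uRun_ones {n : ℕ} (h : ∀ i < n, q i = true) : uRun q y n = (n, none, 0, []) := by
  induction n with
  | zero => rfl
  | succ n ih =>
    rw [uRun, ih fun i hi => h i (by omega)]
    simp [uNext, h n (by omega)]

theorem uEmits_ones {n : ℕ} (h : ∀ i < n, q i = true) : uEmits q y n = none := by
  rw [uEmits, uRun_ones h]; rfl

theorem uRun_zero {k : ℕ} (h : ∀ i < k, q i = true) (hk : q k = false) :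
    uRun q y (k + 1) = (k, some (programOf k), 0, []) := by
  rw [uRun, uRun_ones h]
  simp [uNext, hk]

/-- The first `k + 1` rounds read `1^k 0`; from then on, each round stores two cells of `⟨x, y⟩` and
makes one step, so the stored part stays ahead of the heads. -/
theorem uRun_simulates {M : Machine} {k : ℕ} (h : ∀ i < k, q i = true) (hk : q k = false)
    (hM : programOf k = M.map Vertex.toNats) (i : ℕ) :
    ∃ m, uRun q y (k + 1 + i) = (k, some (M.map Vertex.toNats), i, m) ∧
      Rep ![pair (fun n => q (k + 1 + n)) y, fun _ => false, fun _ => false] (2 * i) i m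
        (M.trun (Config.init (pair (fun n => q (k + 1 + n)) y)) (fun _ => false) i) ∧
      uEmits q y (k + 1 + i) =
        M.emits (M.trun (Config.init (pair (fun n => q (k + 1 + n)) y)) (fun _ => false) i) := by
  set p := pair (fun n => q (k + 1 + n)) y with hp
  have hsup : ∀ i m c, Rep ![p, fun _ => false, fun _ => false] (2 * i) i m c →
      Rep ![p, fun _ => false, fun _ => false] (2 * (i + 1)) i
        (uSupply (q (k + 1 + i)) (y i) (k, some (M.map Vertex.toNats), i, m)) c := by
    intro i m c hr
    have := hr.supply.supply
    rw [hp, pair_odd, pair_even] at this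
    exact this
  have hrun : ∃ m, uRun q y (k + 1 + i) = (k, some (M.map Vertex.toNats), i, m) ∧
      Rep ![p, fun _ => false, fun _ => false] (2 * i) i m
        (M.trun (Config.init p) (fun _ => false) i) := by
    induction i with
    | zero => exact ⟨[], by rw [add_zero, uRun_zero h hk, hM], rep_init p⟩
    | succ i ih =>
      obtain ⟨m, h1, h2⟩ := ih
      refine ⟨_, ?_, rep_simStep (hsup i m _ h2) (by omega) false⟩
      rw [← add_assoc, uRun, h1]
      rfl
  obtain ⟨m, h1, h2⟩ := hrun
  refine ⟨m, h1, h2, ?_⟩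
  rw [uEmits, h1]
  exact simEmit_eq (hsup i m _ h2)

theorem uEmits_empty {k : ℕ} (h : ∀ i < k, q i = true) (hk : q k = false)
    (he : programOf k = []) (n : ℕ) : uEmits q y n = none := by
  rcases lt_or_ge n (k + 1) with hn | hn
  · exact uEmits_ones fun i hi => h i (by omega)
  · obtain ⟨i, rfl⟩ := Nat.exists_eq_add_of_le hn
    have : (uRun q y (k + 1 + i)).2.1 = some [] := by
      clear hn
      induction i with
      | zero => rw [add_zero, uRun_zero h hk, he]
      | succ i ih => rw [← add_assoc, uRun, uNext, ih]
    rw [uEmits, uOut, this]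
    simp [simEmit]

/-- Any unbounded stream of emitted bits spells some sequence, so acceptance is unboundedness alone.
-/
theorem accepts_iff_emitted {M : Machine} (hM : M.IsType2) (p : Cantor) :
    M.Accepts p ↔ ∀ m, ∃ n, m ≤ (emitted (fun t =>
      M.emits (M.trun (Config.init p) (fun _ => false) t)) n).length := by
  have h : ∀ w, M.Yields (fun c c' => M.step c = some c') (Config.init p) w ↔ _ := fun w =>
    (Machine.yields_step_iff hM.no_guess (Machine.blank_init p) (fun _ => false) w).trans
      (writes_trun_iff M (outRel_init p) _ w)
  unfold Machine.Accepts
  simp only [h]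
  constructor
  · rintro ⟨w, hw⟩; exact hw.1
  · intro hu
    obtain ⟨w, hw⟩ := exists_extends_emitted fun t =>
      M.emits (M.trun (Config.init p) (fun _ => false) t)
    exact ⟨w, hu, hw⟩

theorem instanceName_eq_iff {M : Machine} {x : Cantor} : q = instanceName M x ↔
    (∀ i < M.code, q i = true) ∧ q M.code = false ∧ x = fun n => q (M.code + 1 + n) := by
  constructor
  · rintro rfl
    refine ⟨fun i hi => by simp [instanceName, hi], by simp [instanceName], funext fun n => ?_⟩
    rw [instanceName, if_neg (by omega), if_neg (by omega)]
    congr 1; omega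
  · rintro ⟨h1, h2, rfl⟩
    funext n
    unfold instanceName
    split_ifs with h h'
    · exact h1 n h
    · rw [h', h2]
    · dsimp only; congr 1; omega

/-- The universal system emits infinitely many bits if and only if it reads an instance of
`UnProject` together with one of its solutions. -/
theorem uEmits_unbounded_iff : (∀ m, ∃ n, m ≤ (emitted (uEmits q y) n).length) ↔
    y ∈ UnProject q := by
  classical
  have hnone : (∀ n, uEmits q y n = none) → ¬ ∀ m, ∃ n, m ≤ (emitted (uEmits q y) n).length := by
    intro h hu
    obtain ⟨n, hn⟩ := hu 1
    rw [emitted_eq_nil fun t _ => h t] at hn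
    simp at hn
  by_cases hz : ∃ k, q k = false
  -- The length `k` of the leading block of ones is the only possible Gödel number; without a zero,
  -- `q` is no name at all.
  · obtain ⟨k, h, hk⟩ : ∃ k, (∀ i < k, q i = true) ∧ q k = false :=
      ⟨Nat.find hz, fun i hi => by simpa using Nat.find_min hz hi, Nat.find_spec hz⟩
    have hcode : ∀ (M : Machine) x, q = instanceName M x → M.code = k := by
      intro M x hM
      obtain ⟨h1, h2, -⟩ := instanceName_eq_iff.1 hM
      rcases lt_trichotomy M.code k with hl | hl | hl
      · simp [h _ hl] at h2
      · exact hl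
      · simp [h1 _ hl] at hk
    have key : ∀ M : Machine, M.IsType2 → programOf k = M.map Vertex.toNats →
        ((∀ m, ∃ n, m ≤ (emitted (uEmits q y) n).length) ↔
          M.Accepts (pair (fun n => q (k + 1 + n)) y)) := by
      intro M hM hD
      rw [accepts_iff_emitted hM]
      have hsim := fun i => (uRun_simulates (y := y) h hk hD i)
      have he : ∀ i, emitted (uEmits q y) (k + 1 + i) = emitted (fun t => M.emits
          (M.trun (Config.init (pair (fun n => q (k + 1 + n)) y)) (fun _ => false) t)) i := by
        intro i
        rw [emitted_add, emitted_eq_nil fun t ht => uEmits_ones fun i hi => h i (by omega),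
          List.nil_append]
        congr 1
        funext t
        obtain ⟨m, -, -, h3⟩ := hsim t
        exact h3
      refine forall_congr' fun m => ⟨fun ⟨n, hn⟩ => ⟨n, ?_⟩, fun ⟨i, hi⟩ => ⟨k + 1 + i, ?_⟩⟩
      · rw [← he]
        exact hn.trans (emitted_prefix _ (by omega)).length_le
      · rwa [he]
    constructor
    · intro hu
      rcases programOf_cases k with hD | ⟨M, hM, hc, hD⟩
      · exact absurd hu (hnone (uEmits_empty h hk hD))
      · exact ⟨M, fun n => q (k + 1 + n), hM,
          instanceName_eq_iff.2 ⟨hc ▸ h, hc ▸ hk, by rw [hc]⟩, (key M hM hD).1 hu⟩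
    · rintro ⟨M, x, hM, hq, hacc⟩
      have hc := hcode M x hq
      obtain ⟨-, -, rfl⟩ := instanceName_eq_iff.1 hq
      rw [hc] at hacc
      exact (key M hM (by rw [← hc]; exact programOf_code hM)).2 hacc
  · have h : ∀ i, q i = true := fun i => by
      by_contra hi; exact hz ⟨i, by simpa using hi⟩
    refine iff_of_false (hnone fun n => uEmits_ones fun i _ => h i) ?_
    rintro ⟨M, x, -, hq, -⟩
    exact hz ⟨_, (instanceName_eq_iff.1 hq).2.1⟩

end

/-! ### Transducers from oracle machines -/

/-- The edges of the current vertex if it has the label `?`. -/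
def queryAt (D : List (ℕ × ℕ × ℕ)) (m : Mem) : Option (ℕ × ℕ) :=
  D[m.get (4, 0)]?.bind fun d => if d.1 = 18 then some d.2 else none

/-- Let the universal system read the bit of the query in `b`, if there is one. -/
noncomputable def uFeed (ys : Mem) (b : Option Bool) (u : UState) : UState × Option Bool :=
  Option.casesOn b (u, none) fun b =>
    (uNext b (decide (ys.get (2, u.2.2.1 + 1) = 1)) u,
      uOut b (decide (ys.get (2, u.2.2.1 + 1) = 1)) u)

/-- Simulate a step if the universal system has emitted a bit. -/
def gatedStep (D : List (ℕ × ℕ × ℕ)) (A : Mem) (b : Option Bool) : Mem × Option Bool :=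
  Option.casesOn b (A, none) fun _ => (simStep D false A, simEmit D A)

/-- The part of the state of the simulation of an oracle machine which changes in a non-uniform
way: the memory of the main computation; the memory of the computation of the query and the state
of the universal system which reads this query, as soon as there is a query; the bit written. -/
abbrev OState : Type := Mem × Option (Mem × UState) × Option Bool

/-- A round before the query, with the memory `A` and the part `ys` of the guessed answer. At a
query, the main computation goes on with the guessed answer. -/
def preRound (D : List (ℕ × ℕ × ℕ)) (ys A : Mem) : OState :=
  Option.casesOn (queryAt D A) (simStep D false A, none, simEmit D A) fun q =>
    -- Newer entries hide older ones: the part of the answer guessed so far replaces the stored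
    -- cells of tape `2`. Later cells of this tape are supplied with the bits guessed later.
    (ys ++ (((2, 0), 0) :: ((4, 0), q.1) :: A), some (((4, 0), q.2) :: A, (0, none, 0, [])), none)

/-- A round after the query. Its computation is continued by one step. Its bits are passed on to
the universal system, in order to verify the answer, and the main computation makes a step only
if the universal system emits a bit. -/
noncomputable def postRound (D : List (ℕ × ℕ × ℕ)) (ys A Q : Mem) (u : UState) : OState :=
  ((gatedStep D A (uFeed ys (simEmit D Q) u).2).1,
    some (simStep D false Q, (uFeed ys (simEmit D Q) u).1),
    (gatedStep D A (uFeed ys (simEmit D Q) u).2).2)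

/-- A round of the simulation of an oracle machine; `a` is the next bit of the input, `g` is the
next bit of the guessed answer. -/
noncomputable def oracleNext (D : List (ℕ × ℕ × ℕ)) (a g : Bool) (s : ℕ × Mem × OState) :
    ℕ × Mem × OState :=
  (s.1 + 1, ((2, s.1 + 1), g.toNat) :: s.2.1,
    Option.casesOn s.2.2.2.1
      (preRound D (((2, s.1 + 1), g.toNat) :: s.2.1) (supply s.1 a false s.2.2.1))
      fun p => postRound D (((2, s.1 + 1), g.toNat) :: s.2.1) (supply s.1 a g s.2.2.1)
        (supply s.1 a false p.1) p.2)

section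

variable {α : Type*} [Primcodable α]

theorem primrec_queryAt (D : List (ℕ × ℕ × ℕ)) {m : α → Mem} (hm : Primrec m) :
    Primrec fun a => queryAt D (m a) :=
  Primrec.option_bind (g := fun (_ : α) (d : ℕ × ℕ × ℕ) => if d.1 = 18 then some d.2 else none)
    (primrec_fetch (Primrec.const D) hm)
    (Primrec.ite (c := fun p : α × ℕ × ℕ × ℕ => p.2.1 = 18)
      (Primrec.eq.comp (Primrec.fst.comp Primrec.snd) (Primrec.const 18))
      (Primrec.option_some.comp (Primrec.snd.comp Primrec.snd)) (Primrec.const none))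

theorem primrec_uFeed {ys : α → Mem} {b : α → Option Bool} {u : α → UState} (hy : Primrec ys)
    (hb : Primrec b) (hu : Primrec u) : Primrec fun a => uFeed (ys a) (b a) (u a) := by
  have hc : Primrec fun a => decide ((ys a).get (2, (u a).2.2.1 + 1) = 1) :=
    (Primrec.eq.comp (primrec_cell hy (Primrec.const 2) (Primrec.succ.comp
      (Primrec.fst.comp (Primrec.snd.comp (Primrec.snd.comp hu))))) (Primrec.const 1)).decide
  exact Primrec.option_casesOn (g := fun a b => (uNext b _ (u a), uOut b _ (u a))) hb
    (Primrec.pair hu (Primrec.const none))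
    (Primrec.pair (primrec_uNext Primrec.snd (hc.comp Primrec.fst) (hu.comp Primrec.fst))
      (primrec_uOut Primrec.snd (hc.comp Primrec.fst) (hu.comp Primrec.fst)))

theorem primrec_gatedStep (D : List (ℕ × ℕ × ℕ)) {A : α → Mem} {b : α → Option Bool}
    (hA : Primrec A) (hb : Primrec b) : Primrec fun a => gatedStep D (A a) (b a) :=
  Primrec.option_casesOn (g := fun a _ => (simStep D false (A a), simEmit D (A a))) hb
    (Primrec.pair hA (Primrec.const none))
    (Primrec.pair (primrec_simStep (Primrec.const D) (Primrec.const _) (hA.comp Primrec.fst))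
      (primrec_simEmit (Primrec.const D) (hA.comp Primrec.fst)))

theorem primrec_preRound (D : List (ℕ × ℕ × ℕ)) {ys A : α → Mem} (hy : Primrec ys)
    (hA : Primrec A) : Primrec fun a => preRound D (ys a) (A a) := by
  have c := fun n => Primrec.const (α := α × ℕ × ℕ) (n : ℕ)
  refine Primrec.option_casesOn (σ := OState) (g := fun a q =>
    (ys a ++ (((2, 0), 0) :: ((4, 0), q.1) :: A a),
      some (((4, 0), q.2) :: A a, ((0, none, 0, []) : UState)), none)) (primrec_queryAt D hA)
    (Primrec.pair (primrec_simStep (Primrec.const D) (Primrec.const _) hA)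
      (Primrec.pair (Primrec.const _) (primrec_simEmit (Primrec.const D) hA))) ?_
  refine Primrec.pair (Primrec.list_append.comp (hy.comp Primrec.fst) (primrec_store
    (primrec_store (hA.comp Primrec.fst) (c 4) (c 0) (Primrec.fst.comp Primrec.snd)) (c 2) (c 0)
      (c 0))) (Primrec.pair (Primrec.option_some.comp (Primrec.pair ?_ (Primrec.const _)))
        (Primrec.const _))
  exact primrec_store (hA.comp Primrec.fst) (c 4) (c 0) (Primrec.snd.comp Primrec.snd)

theorem primrec_postRound (D : List (ℕ × ℕ × ℕ)) {ys A Q : α → Mem} {u : α → UState}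
    (hy : Primrec ys) (hA : Primrec A) (hQ : Primrec Q) (hu : Primrec u) :
    Primrec fun a => postRound D (ys a) (A a) (Q a) (u a) := by
  have hf := primrec_uFeed hy (primrec_simEmit (Primrec.const D) hQ) hu
  have hr := primrec_gatedStep D hA (Primrec.snd.comp hf)
  exact Primrec.pair (Primrec.fst.comp hr) (Primrec.pair (Primrec.option_some.comp (Primrec.pair
    (primrec_simStep (Primrec.const D) (Primrec.const _) hQ) (Primrec.fst.comp hf)))
    (Primrec.snd.comp hr))

theorem primrec_oracleNext (D : List (ℕ × ℕ × ℕ)) :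
    Primrec fun p : Bool × Bool × ℕ × Mem × OState => oracleNext D p.1 p.2.1 p.2.2 := by
  have ha : Primrec fun p : Bool × Bool × ℕ × Mem × OState => p.1 := Primrec.fst
  have hg : Primrec fun p : Bool × Bool × ℕ × Mem × OState => p.2.1 :=
    Primrec.fst.comp Primrec.snd
  have hs : Primrec fun p : Bool × Bool × ℕ × Mem × OState => p.2.2 :=
    Primrec.snd.comp Primrec.snd
  have ht : Primrec fun p : Bool × Bool × ℕ × Mem × OState => p.2.2.1 := Primrec.fst.comp hs
  have hy : Primrec fun p : Bool × Bool × ℕ × Mem × OState =>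
      (((2, p.2.2.1 + 1), p.2.1.toNat) :: p.2.2.2.1 : Mem) :=
    primrec_store (Primrec.fst.comp (Primrec.snd.comp hs)) (Primrec.const 2)
      (Primrec.succ.comp ht) ((Primrec.dom_bool Bool.toNat).comp hg)
  have hA : Primrec fun p : Bool × Bool × ℕ × Mem × OState => p.2.2.2.2.1 :=
    Primrec.fst.comp (Primrec.snd.comp (Primrec.snd.comp hs))
  refine Primrec.pair (Primrec.succ.comp ht) (Primrec.pair hy (Primrec.option_casesOn
    (g := fun p r => postRound D (((2, p.2.2.1 + 1), p.2.1.toNat) :: p.2.2.2.1)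
      (supply p.2.2.1 p.1 p.2.1 p.2.2.2.2.1) (supply p.2.2.1 p.1 false r.1) r.2)
    (Primrec.fst.comp (Primrec.snd.comp (Primrec.snd.comp (Primrec.snd.comp hs))))
    (primrec_preRound D hy (primrec_supply ht ha (Primrec.const _) hA)) ?_))
  exact primrec_postRound D (hy.comp Primrec.fst)
    ((primrec_supply ht ha hg hA).comp Primrec.fst)
    (primrec_supply (ht.comp Primrec.fst) (ha.comp Primrec.fst) (Primrec.const _)
      (Primrec.fst.comp Primrec.snd)) (Primrec.snd.comp Primrec.snd)

end

/-- The transducer which simulates an oracle machine with a single call to `UnProject`, verifying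
a guessed answer of the oracle. -/
noncomputable def Machine.oracleSimulator (M : Machine) : Transducer where
  σ := ℕ × Mem × OState
  init := (0, [], [], none, none)
  next := oracleNext (M.map Vertex.toNats)
  out s := s.2.2.2.2
  primrec_next := primrec_oracleNext _
  primrec_out := Primrec.snd.comp (Primrec.snd.comp (Primrec.snd.comp Primrec.snd))

/-! ### Correctness of the simulation of oracle machines -/

theorem queryAt_eq_some_iff {M : Machine} {Z : Fin 3 → Cantor} {n h : ℕ} {m : Mem} {c : Config}
    (hr : Rep Z n h m c) (q0 q1 : ℕ) : queryAt (M.map Vertex.toNats) m = some (q0, q1) ↔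
      M[c.vertex]? = some (.query q0 q1) := by
  unfold queryAt
  rw [hr.vertex, List.getElem?_map]
  rcases M[c.vertex]? with - | v
  · simp
  · cases v with
    | test i q0 q1 => fin_cases i <;> simp [Vertex.toNats]
    | left i q => fin_cases i <;> simp [Vertex.toNats]
    | right i q => fin_cases i <;> simp [Vertex.toNats]
    | write i b q => fin_cases i <;> cases b <;> simp [Vertex.toNats]
    | _ => simp [Vertex.toNats]

theorem Rep.weaken {Z : Fin 3 → Cantor} {n h : ℕ} {m : Mem} {c : Config} (hr : Rep Z n h m c) :
    Rep Z n (h + 1) m c :=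
  ⟨hr.vertex, hr.head, hr.cell, fun i => (hr.bound i).trans (Nat.le_succ h), hr.fresh⟩

theorem Rep.spawn {Z : Fin 3 → Cantor} {n h : ℕ} {m : Mem} {c : Config} (hr : Rep Z n h m c)
    (q : ℕ) : Rep Z n h (((4, 0), q) :: m) (c.spawn q) where
  vertex := by simp [Mem.get_cons, Config.spawn]
  head i := by
    rw [Mem.get_cons, if_neg (by simp only [Prod.mk.injEq]; omega), hr.head]
    fin_cases i <;> simp [Config.spawn]
  cell i p hp := by
    rw [Mem.get_cons, if_neg (by simp), hr.cell i p hp]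
    fin_cases i <;> simp [Config.spawn]
  bound i := by
    have := hr.bound i
    fin_cases i <;> simpa [Config.spawn] using this
  fresh i p hp := by
    rw [← hr.fresh i p hp]
    fin_cases i <;> simp [Config.spawn]

/-- Storing the entries of `ys` amounts to writing the first `n` bits of `y` on tape `2`. -/
def Overlay (y : Cantor) (n : ℕ) (ys : Mem) : Prop :=
  ∀ m : Mem, (∀ p < n, Mem.get (ys ++ m) (2, p + 1) = (y p).toNat) ∧
    ∀ k, (∀ p, k ≠ (2, p + 1)) → Mem.get (ys ++ m) k = m.get k

theorem Overlay.succ {y : Cantor} {n : ℕ} {ys : Mem} (h : Overlay y n ys) :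
    Overlay y (n + 1) (((2, n + 1), (y n).toNat) :: ys) := by
  intro m
  refine ⟨fun p hp => ?_, fun k hk => ?_⟩
  · rw [List.cons_append, Mem.get_cons]
    by_cases hpn : n = p
    · subst hpn; simp
    · rw [if_neg (by simp [hpn])]
      exact (h m).1 p (by omega)
  · rw [List.cons_append, Mem.get_cons, if_neg (hk n).symm]
    exact (h m).2 k hk

theorem Overlay.bit {y : Cantor} {n : ℕ} {ys : Mem} (h : Overlay y n ys) {p : ℕ} (hp : p < n) :
    decide (ys.get (2, p + 1) = 1) = y p := by
  have := (h []).1 p hp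
  rw [List.append_nil] at this
  rw [this]
  exact decide_toNat _

/-- The first `n` cells of tape `2` come from the overlay, and the cells from `n` on are henceforth
expected to hold `y` instead of `Y`. -/
theorem Rep.answer {X Y y : Cantor} {n h : ℕ} {m ys : Mem} {c : Config}
    (hr : Rep ![X, fun _ => false, Y] n h m c) (hy : Overlay y n ys) (q : ℕ) :
    Rep ![X, fun _ => false, y] n h (ys ++ (((2, 0), 0) :: ((4, 0), q) :: m)) (c.answer q y) where
  vertex := by
    rw [(hy _).2 _ (by simp), Mem.get_cons, Mem.get_cons]; simp [Config.answer]
  head i := by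
    rw [(hy _).2 _ (by simp), Mem.get_cons, Mem.get_cons]
    have := hr.head i
    fin_cases i
    · simpa [Config.answer] using this
    · simpa [Config.answer] using this
    · simp [Config.answer]
  cell i p hp := by
    by_cases hi : i = 2
    · subst hi
      refine ((hy _).1 p hp).trans ?_
      simp [Config.answer]
    · rw [(hy _).2 _ (by
        intro p' h; rw [Prod.mk.injEq] at h; exact hi (Fin.ext h.1)), Mem.get_cons,
        Mem.get_cons]
      have := hr.cell i p hp
      fin_cases i
      · simpa [Config.answer] using this
      · simpa [Config.answer] using this
      · exact absurd rfl hi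
  bound i := by
    have := hr.bound i
    fin_cases i
    · simpa [Config.answer] using this
    · simpa [Config.answer] using this
    · simp [Config.answer]
  fresh i p hp := by
    have := hr.fresh i p hp
    fin_cases i
    · simpa [Config.answer] using this
    · simpa [Config.answer] using this
    · simp [Config.answer]

/-- The number of simulated steps is the position of the next bit of `y` needed, so the universal
system never asks for a bit not yet guessed. -/
theorem uRun_count_le (q y : Cantor) (n : ℕ) : (uRun q y n).2.2.1 ≤ n := by
  induction n with
  | zero => exact le_rfl
  | succ n ih =>
    rw [uRun, uNext]
    rcases (uRun q y n).2.1 with - | D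
    · dsimp only; split_ifs <;> simp
    · dsimp only; omega

namespace Machine

section

variable (M : Machine) (x y : Cantor)

/-- The main computation before the query. -/
def pre : ℕ → Config := M.trun (Config.init x) fun _ => false

theorem oracleSimulator_run_succ (t : ℕ) : M.oracleSimulator.run x y (t + 1) =
    oracleNext (M.map Vertex.toNats) (x t) (y t) (M.oracleSimulator.run x y t) := rfl

/-- The bits which the machine writes from the configuration `c` on. -/
def bits (c : Config) (t : ℕ) : Option Bool := M.emits (M.trun c (fun _ => false) t)

variable {M x y} {q : Cantor}

theorem oracleSimulator_pre {t : ℕ} (h : ∀ s < t, ¬ M.AtQuery (M.pre x s)) :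
    (∃ ys A o, M.oracleSimulator.run x y t = (t, ys, A, none, o) ∧ Overlay y t ys ∧
      Rep ![x, fun _ => false, fun _ => false] t t A (M.pre x t)) ∧
    M.oracleSimulator.written x y t = emitted (fun s => M.emits (M.pre x s)) t := by
  induction t with
  | zero =>
    exact ⟨⟨[], [], none, rfl, fun m => ⟨fun p hp => by omega, fun _ _ => rfl⟩, rep_init x⟩, rfl⟩
  | succ t ih =>
    obtain ⟨⟨ys, A, o, hrun, hys, hA⟩, hw⟩ := ih fun s hs => h s (by omega)
    have hA' := hA.supply
    have hq : queryAt (M.map Vertex.toNats) (supply t (x t) false A) = none := by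
      rcases hq : queryAt (M.map Vertex.toNats) (supply t (x t) false A) with - | ⟨q0, q1⟩
      · rfl
      · exact absurd ⟨q0, q1, (queryAt_eq_some_iff hA' q0 q1).1 hq⟩ (h t (by omega))
    have hrun' : M.oracleSimulator.run x y (t + 1) = (t + 1, ((2, t + 1), (y t).toNat) :: ys,
        simStep (M.map Vertex.toNats) false (supply t (x t) false A), none,
        simEmit (M.map Vertex.toNats) (supply t (x t) false A)) := by
      rw [oracleSimulator_run_succ, hrun, oracleNext, preRound]
      simp only [hq]
      rfl
    refine ⟨⟨_, _, _, hrun', hys.succ, rep_simStep hA' (Nat.lt_succ_self t) false⟩, ?_⟩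
    rw [Transducer.written_succ, hw, emitted_succ, hrun']
    congr 2
    exact simEmit_eq hA'

theorem oracleSimulator_fork {t q0 q1 : ℕ} (h : ∀ s < t, ¬ M.AtQuery (M.pre x s))
    (hq : M[(M.pre x t).vertex]? = some (.query q0 q1)) :
    (∃ ys A Q o, M.oracleSimulator.run x y (t + 1) =
        (t + 1, ys, A, some (Q, uRun q y 0), o) ∧ Overlay y (t + 1) ys ∧
      Rep ![x, fun _ => false, y] (t + 1) (t + 1) A ((M.pre x t).answer q0 y) ∧
      Rep ![x, fun _ => false, fun _ => false] (t + 1) (t + 1) Q ((M.pre x t).spawn q1)) ∧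
    M.oracleSimulator.written x y (t + 1) = emitted (fun s => M.emits (M.pre x s)) t := by
  obtain ⟨⟨ys, A, o, hrun, hys, hA⟩, hw⟩ := oracleSimulator_pre (y := y) h
  have hA' := hA.supply
  have hrun' : M.oracleSimulator.run x y (t + 1) = (t + 1, ((2, t + 1), (y t).toNat) :: ys,
      (((2, t + 1), (y t).toNat) :: ys) ++ (((2, 0), 0) :: ((4, 0), q0) ::
        supply t (x t) false A), some (((4, 0), q1) :: supply t (x t) false A, uRun q y 0),
      none) := by
    rw [oracleSimulator_run_succ, hrun, oracleNext, preRound]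
    simp only [(queryAt_eq_some_iff hA' q0 q1).2 hq]
    rfl
  refine ⟨⟨_, _, _, _, hrun', hys.succ, (hA'.answer hys.succ q0).weaken,
    (hA'.spawn q1).weaken⟩, ?_⟩
  rw [Transducer.written_succ, hw, hrun']
  exact List.append_nil _

/-- When the query computation has made `s` steps, the universal system has made as many rounds as
bits of the query were emitted, and the main computation as many steps as bits were emitted by the
universal system. The sequence `q` need only extend the emitted bits, so the query may turn out to
be finite. -/
theorem oracleSimulator_post {t q0 q1 : ℕ} (h : ∀ s < t, ¬ M.AtQuery (M.pre x s))
    (hq : M[(M.pre x t).vertex]? = some (.query q0 q1))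
    (hext : ∀ n p b, (emitted (M.bits ((M.pre x t).spawn q1)) n)[p]? = some b → q p = b) (s : ℕ) :
    (∃ ys A Q o, M.oracleSimulator.run x y (t + 1 + s) = (t + 1 + s, ys, A,
        some (Q, uRun q y (emitted (M.bits ((M.pre x t).spawn q1)) s).length), o) ∧
      Overlay y (t + 1 + s) ys ∧
      Rep ![x, fun _ => false, y] (t + 1 + s) (t + 1 + s) A
        (M.trun ((M.pre x t).answer q0 y) (fun _ => false)
          (emitted (uEmits q y) (emitted (M.bits ((M.pre x t).spawn q1)) s).length).length) ∧
      Rep ![x, fun _ => false, fun _ => false] (t + 1 + s) (t + 1 + s) Q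
        (M.trun ((M.pre x t).spawn q1) (fun _ => false) s)) ∧
    M.oracleSimulator.written x y (t + 1 + s) = emitted (M.bits (Config.init x)) t ++
      emitted (M.bits ((M.pre x t).answer q0 y))
        (emitted (uEmits q y) (emitted (M.bits ((M.pre x t).spawn q1)) s).length).length := by
  induction s with
  | zero =>
    obtain ⟨h1, h2⟩ := oracleSimulator_fork (y := y) (q := q) h hq
    exact ⟨h1, h2.trans (List.append_nil _).symm⟩
  | succ s ih =>
    obtain ⟨⟨ys, A, Q, o, hrun, hys, hA, hQ⟩, hw⟩ := ih
    have hj := length_emitted_le (M.bits ((M.pre x t).spawn q1)) s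
    -- If the query computation emits a bit now, it is the bit of `q` at position `j`, which is the
    -- one the universal system is about to read.
    have hbit := hext (s + 1) (emitted (M.bits ((M.pre x t).spawn q1)) s).length
    rw [emitted_succ] at hbit ⊢
    set j := (emitted (M.bits ((M.pre x t).spawn q1)) s).length with hjdef
    have hA' := hA.supply
    have hQ' := hQ.supply
    have hys' := hys.succ
    -- The universal system has made at most `j ≤ s` steps, while `t + 1 + s + 1` bits of the answer
    -- are stored.
    have hcount := uRun_count_le q y j
    have hy := hys'.bit (show (uRun q y j).2.2.1 < t + 1 + s + 1 by omega)
    have hrun' : M.oracleSimulator.run x y (t + 1 + (s + 1)) = (t + 1 + s + 1,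
        ((2, t + 1 + s + 1), (y (t + 1 + s)).toNat) :: ys,
        postRound (M.map Vertex.toNats) (((2, t + 1 + s + 1), (y (t + 1 + s)).toNat) :: ys)
          (supply (t + 1 + s) (x (t + 1 + s)) (y (t + 1 + s)) A)
          (supply (t + 1 + s) (x (t + 1 + s)) false Q) (uRun q y j)) := by
      rw [← add_assoc, oracleSimulator_run_succ, hrun, oracleNext]
    have hQ1 := rep_simStep (M := M) hQ' (Nat.lt_succ_self _) false
    have hA1 := rep_simStep (M := M) hA' (Nat.lt_succ_self _) false
    have hout : simEmit (M.map Vertex.toNats) (supply (t + 1 + s) (x (t + 1 + s)) false Q) =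
      M.bits ((M.pre x t).spawn q1) s := simEmit_eq hQ'
    have houtA : simEmit (M.map Vertex.toNats)
      (supply (t + 1 + s) (x (t + 1 + s)) (y (t + 1 + s)) A) =
      M.bits ((M.pre x t).answer q0 y) (emitted (uEmits q y) j).length := simEmit_eq hA'
    rw [← add_assoc, Transducer.written_succ, add_assoc _ s 1, hw, hrun', postRound, hout]
    rcases hb : M.bits ((M.pre x t).spawn q1) s with - | b
    · simp only [Option.toList_none, List.append_nil, ← hjdef]
      exact ⟨⟨_, _, _, _, rfl, hys', hA'.weaken, hQ1⟩, List.append_nil _⟩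
    · rw [hb] at hbit
      have hqj : b = q j := (hbit b (by simp [hjdef])).symm
      have hu : uFeed (((2, t + 1 + s + 1), (y (t + 1 + s)).toNat) :: ys) (some b) (uRun q y j) =
          (uRun q y (j + 1), uEmits q y j) := by
        rw [uFeed, hy, hqj]; rfl
      rw [hu]
      simp only [Option.toList_some, List.length_append, List.length_singleton, ← hjdef]
      rw [emitted_succ (uEmits q y)]
      rcases he : uEmits q y j with - | e
      · simp only [Option.toList_none, List.append_nil]
        exact ⟨⟨_, _, _, _, rfl, hys', hA'.weaken, hQ1⟩, List.append_nil _⟩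
      · simp only [Option.toList_some, List.length_append, List.length_singleton]
        refine ⟨⟨_, _, _, _, rfl, hys', hA1, hQ1⟩, ?_⟩
        rw [emitted_succ, List.append_assoc]
        congr 2
        exact congrArg Option.toList houtA

end

end Machine

/-! ### Outputs of the simulation of oracle machines -/

theorem Spells.of_cofinal {L L' : ℕ → List Bool} {w : Cantor} (h : Spells L w)
    (h1 : ∀ n, ∃ k, L n <+: L' k) (h2 : ∀ n, ∃ k, L' n <+: L k) : Spells L' w := by
  refine ⟨fun m => ?_, fun n p b hb => ?_⟩
  · obtain ⟨n, hn⟩ := h.1 m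
    obtain ⟨k, hk⟩ := h1 n
    exact ⟨k, hn.trans hk.length_le⟩
  · obtain ⟨k, hk⟩ := h2 n
    exact h.2 k p b (getElem?_of_prefix hk hb)

theorem Writes.unique {d : ℕ → Config} {v w : Cantor} (hv : Writes d v) (hw : Writes d w) :
    v = w := by
  funext p
  obtain ⟨t, ht⟩ := hv.1 (p + 1)
  rw [← hv.2 t p ht, ← hw.2 t p ht]

theorem writes_shift {d : ℕ → Config} (hd : ∀ t, OutStep (d t) (d (t + 1))) (k : ℕ) (w : Cantor) :
    Writes (fun i => d (k + i)) w ↔ Writes d w := by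
  constructor
  · rintro ⟨h1, h2⟩
    refine ⟨fun m => (h1 m).imp' (k + ·) fun _ h => h, fun t p hp => ?_⟩
    have := outPath_mono hd (show t ≤ k + t by omega)
    rw [← this.2 p hp, ← h2 t p (lt_of_lt_of_le hp this.1)]
  · rintro ⟨h1, h2⟩
    refine ⟨fun m => ?_, fun t p hp => h2 _ p hp⟩
    obtain ⟨t, ht⟩ := h1 m
    exact ⟨t, ht.trans (outPath_mono hd (by omega)).1⟩

namespace Machine

variable {M : Machine}

theorem outRel_trun {c : Config} {l : List Bool} (hc : OutRel c l) (t : ℕ) :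
    OutRel (M.trun c (fun _ => false) t) (l ++ emitted (M.bits c) t) := by
  induction t with
  | zero => exact (List.append_nil l).symm ▸ hc
  | succ t ih =>
    rw [emitted_succ, ← List.append_assoc]
    exact tstep_outRel ih false

theorem writes_iff_spells_bits {c : Config} {l : List Bool} (hc : OutRel c l) (w : Cantor) :
    Writes (M.trun c fun _ => false) w ↔ Spells (fun t => l ++ emitted (M.bits c) t) w :=
  writes_iff_spells (outRel_trun hc) w

theorem outRel_spawn (c : Config) (q : ℕ) : OutRel (c.spawn q) [] := ⟨rfl, by simp⟩

variable {x y w : Cantor}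

/-- All rounds are rounds before the query, and these do not depend on the guesses. -/
theorem oracleSimulator_outputs_iff_of_no_query (h : ∀ t, ¬ M.AtQuery (M.pre x t)) :
    M.oracleSimulator.Outputs x y w ↔ Writes (M.pre x) w := by
  rw [pre, writes_iff_spells_bits (outRel_init x)]
  unfold Transducer.Outputs
  rw [show collect _ _ = _ from
    funext fun n => (oracleSimulator_pre (y := y) (t := n) fun s _ => h s).2]
  rfl

/-- The output grows forever only if the universal system emits infinitely many bits. This needs
infinitely many bits of the query and, by `uEmits_unbounded_iff`, a correct answer; then the main
computation is never stopped. -/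
theorem oracleSimulator_outputs_iff_of_query (hM : ∀ q0 q1, Vertex.guess q0 q1 ∉ M) {t q0 q1 : ℕ}
    (h : ∀ s < t, ¬ M.AtQuery (M.pre x s)) (hq : M[(M.pre x t).vertex]? = some (.query q0 q1)) :
    M.oracleSimulator.Outputs x y w ↔
      ∃ q, M.Yields (fun c c' => M.step c = some c') ((M.pre x t).spawn q1) q ∧
        y ∈ UnProject q ∧ Writes (M.trun ((M.pre x t).answer q0 y) fun _ => false) w := by
  have hans : OutRel ((M.pre x t).answer q0 y) (emitted (M.bits (Config.init x)) t) :=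
    outRel_trun (M := M) (outRel_init x) t
  have hy : ∀ q, M.Yields (fun c c' => M.step c = some c') ((M.pre x t).spawn q1) q ↔
      Spells (emitted (M.bits ((M.pre x t).spawn q1))) q := fun q =>
    (yields_step_iff hM (blank_spawn _ _) (fun _ => false) q).trans
      (writes_iff_spells_bits (outRel_spawn _ _) q)
  simp only [hy, ← uEmits_unbounded_iff, writes_iff_spells_bits hans]
  set e := M.bits ((M.pre x t).spawn q1)
  set l := emitted (M.bits (Config.init x)) t
  set r := emitted (M.bits ((M.pre x t).answer q0 y))
  have hwritten : ∀ q : Cantor, (∀ n p b, (emitted e n)[p]? = some b → q p = b) → ∀ s,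
      M.oracleSimulator.written x y (t + 1 + s) =
        l ++ r (emitted (uEmits q y) (emitted e s).length).length :=
    fun q hext s => (oracleSimulator_post h hq hext s).2
  have hpre : ∀ {m n}, m ≤ n →
      M.oracleSimulator.written x y m <+: M.oracleSimulator.written x y n :=
    fun hmn => collect_prefix _ _ hmn
  have hback : ∀ q : Cantor, (∀ n p b, (emitted e n)[p]? = some b → q p = b) → ∀ s, ∃ n,
      M.oracleSimulator.written x y s <+: l ++ r n := fun q hext s =>
    ⟨_, (hpre (show s ≤ t + 1 + s by omega)).trans (by rw [hwritten q hext])⟩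
  have hforth : ∀ q : Cantor, (∀ n p b, (emitted e n)[p]? = some b → q p = b) →
      (∀ m, ∃ s, m ≤ (emitted (uEmits q y) (emitted e s).length).length) → ∀ n, ∃ s,
        l ++ r n <+: M.oracleSimulator.written x y s := fun q hext hu n => by
    obtain ⟨s, hs⟩ := hu n
    exact ⟨t + 1 + s, hwritten q hext s ▸ (List.prefix_append_right_inj _).2 (emitted_prefix _ hs)⟩
  constructor
  · intro hw
    -- It is not yet known that the query is infinite, so `q` is at first any extension of it.
    obtain ⟨q, hext⟩ := exists_extends_emitted e
    have hu : ∀ m, ∃ s, m ≤ (emitted (uEmits q y) (emitted e s).length).length := by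
      intro m
      -- At most `t` bits stem from the time before the query, so `m` of these `t + m` bits need as
      -- many steps afterwards, each paid for by a bit of the universal system.
      obtain ⟨s, hs⟩ := hw.1 (t + m)
      have h1 := hs.trans (hpre (show s ≤ t + 1 + s by omega)).length_le
      rw [hwritten q hext, List.length_append] at h1
      have h2 : l.length ≤ t := length_emitted_le _ _
      have h3 := length_emitted_le (M.bits ((M.pre x t).answer q0 y))
        (emitted (uEmits q y) (emitted e s).length).length
      exact ⟨s, by change (r _).length ≤ _ at h3; omega⟩
    -- The universal system emits at most one bit per bit of the query, so the query is infinite as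
    -- well.
    exact ⟨q, ⟨fun m => (hu m).imp fun s hs => hs.trans (length_emitted_le _ _), hext⟩,
      fun m => (hu m).imp' _ fun _ hs => hs, Spells.of_cofinal hw (hback q hext)
        (hforth q hext hu)⟩
  · rintro ⟨q, ⟨hq1, hext⟩, hu, hw⟩
    have hu' : ∀ m, ∃ s, m ≤ (emitted (uEmits q y) (emitted e s).length).length := by
      intro m
      obtain ⟨n, hn⟩ := hu m
      obtain ⟨s, hs⟩ := hq1 n
      exact ⟨s, hn.trans (emitted_prefix _ hs).length_le⟩
    exact Spells.of_cofinal hw (hforth q hext hu') (hback q hext)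

/-! ### Semantics of oracle machines with a single call -/

section

variable {O G : Problem}

theorem oracleStep_mono (h : ∀ p, G p ⊆ O p) {c c' : Config} (hc : M.oracleStep G 1 c c') :
    M.oracleStep O 1 c c' := by
  rcases hc with hc | ⟨q0, q1, p, y, h1, h2, h3, h4⟩
  · exact Or.inl hc
  · exact Or.inr ⟨q0, q1, p, y, h1, h2, h p h3, h4⟩

theorem oracleStep_outStep {c c' : Config} (h : M.oracleStep G 1 c c') : OutStep c c' := by
  rcases h with h | ⟨q0, q1, p, y, -, -, -, rfl⟩
  · exact M.step_outStep h
  · exact Or.inl ⟨rfl, rfl⟩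

theorem oracleStep_not_accept {c c' : Config} (h : M.oracleStep G 1 c c') :
    M[c.vertex]? ≠ some .accept := by
  rcases h with h | ⟨q0, q1, p, y, h, -⟩
  · exact M.step_not_accept h
  · simp [h]

theorem step_of_oracleStep {c c' : Config} (h : M.oracleStep G 1 c c') (hc : ¬ M.AtQuery c) :
    M.step c = some c' :=
  h.resolve_right fun ⟨q0, q1, _, _, h, _⟩ => hc ⟨q0, q1, h⟩

theorem step_eq_none_of_query {c : Config} {q0 q1 : ℕ} (h : M[c.vertex]? = some (.query q0 q1)) :
    M.step c = none := by
  simp [step, h]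

theorem yields_step_unique (hM : ∀ q0 q1, Vertex.guess q0 q1 ∉ M) {c : Config} (hc : c.Blank)
    {v w : Cantor} (hv : M.Yields (fun c c' => M.step c = some c') c v)
    (hw : M.Yields (fun c c' => M.step c = some c') c w) : v = w :=
  ((yields_step_iff hM hc (fun _ => false) v).1 hv).unique
    ((yields_step_iff hM hc (fun _ => false) w).1 hw)

theorem oracleStep_unique (hM : ∀ q0 q1, Vertex.guess q0 q1 ∉ M) (hG : ∀ p, (G p).Subsingleton)
    {c a b : Config} (ha : M.oracleStep G 1 c a) (hb : M.oracleStep G 1 c b) : a = b := by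
  rcases ha with ha | ⟨q0, q1, p, y, h1, h2, h3, rfl⟩
  · have hc : ¬ M.AtQuery c := fun ⟨q0, q1, h⟩ => by
      rw [oracleStep, step_eq_none_of_query h] at ha; cases ha
    exact Option.some_injective _ (ha.symm.trans (step_of_oracleStep hb hc))
  · rcases hb with hb | ⟨q0', q1', p', y', h1', h2', h3', rfl⟩
    · rw [oracleStep, step_eq_none_of_query h1] at hb; cases hb
    · obtain ⟨rfl, rfl⟩ : q0 = q0' ∧ q1 = q1' := by simpa [h1] using h1'
      obtain rfl := yields_step_unique hM (blank_spawn _ _) h2 h2'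
      rw [hG p h3 h3']

theorem mem_oracleFun_iff (hM : ∀ q0 q1, Vertex.guess q0 q1 ∉ M)
    (hG : ∀ p, (G p).Subsingleton) (x w : Cantor) : w ∈ M.oracleFun G 1 x ↔
      ∃ d : ℕ → Config, d 0 = Config.init x ∧
        (∀ t, XStep M (M.oracleStep G 1) (d t) (d (t + 1))) ∧ Writes d w :=
  yields_iff (fun _ _ => oracleStep_outStep) (fun _ _ => oracleStep_not_accept)
    (fun _ _ _ => oracleStep_unique hM hG) (blank_init x) w

theorem eq_trun_of_path {c : Config} {d : ℕ → Config} (h0 : d 0 = c)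
    (hd : ∀ t, XStep M (M.oracleStep G 1) (d t) (d (t + 1))) {n : ℕ}
    (hn : ∀ s < n, ¬ M.AtQuery (d s)) : d n = M.trun c (fun _ => false) n := by
  induction n with
  | zero => exact h0
  | succ n ih =>
    change _ = M.tstep false (M.trun c (fun _ => false) n)
    rw [← ih fun s hs => hn s (by omega)]
    exact (tstep_of_xstep_step ((hd n).imp_left fun h =>
      step_of_oracleStep h (hn n (by omega))) false).symm

/-- An `idle` step stays at an accepting vertex and `R` cannot leave it, so there is none before a
time at a vertex that is not accepting. -/
theorem path_of_not_accept {R : Config → Config → Prop} {d : ℕ → Config}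
    (hacc : ∀ c c', R c c' → M[c.vertex]? ≠ some .accept)
    (hd : ∀ t, XStep M R (d t) (d (t + 1))) {n : ℕ} (hn : M[(d n).vertex]? ≠ some .accept) :
    ∀ s < n, R (d s) (d (s + 1)) := by
  induction n with
  | zero => intro s hs; omega
  | succ n ih =>
    have h := (hd n).resolve_right fun ⟨h1, h2⟩ => hn (by rw [h2]; exact h1)
    intro s hs
    rcases Nat.lt_succ_iff_lt_or_eq.1 hs with hs | rfl
    · exact ih (hacc _ _ h) s hs
    · exact h

theorem xstep_trun_of_writes (hM : ∀ q0 q1, Vertex.guess q0 q1 ∉ M) {c : Config} {g : Cantor}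
    (hw : Writes (M.trun c g) w) (t : ℕ) :
    XStep M (M.oracleStep G 1) (M.trun c g t) (M.trun c g (t + 1)) :=
  (xstep_trun hw t).imp_left fun h => Or.inl ((nondetStep_iff_step hM _ _).1 h)

theorem mem_oracleFun_iff_of_no_query (hM : ∀ q0 q1, Vertex.guess q0 q1 ∉ M)
    (hG : ∀ p, (G p).Subsingleton) (h : ∀ t, ¬ M.AtQuery (M.pre x t)) :
    w ∈ M.oracleFun G 1 x ↔ Writes (M.pre x) w := by
  rw [mem_oracleFun_iff hM hG]
  constructor
  · rintro ⟨d, h0, hd, hw⟩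
    have : d = M.pre x := by
      funext t
      induction t using Nat.strong_induction_on with
      | _ t ih => exact eq_trun_of_path h0 hd fun s hs => ih s hs ▸ h s
    exact this ▸ hw
  · intro hw
    exact ⟨_, rfl, xstep_trun_of_writes hM hw, hw⟩

/-- A run standing still before the query would never arrive at it. -/
theorem xstep_pre_of_query (hM : ∀ q0 q1, Vertex.guess q0 q1 ∉ M) {s t : ℕ} (hst : s < t)
    (h : ¬ M.AtQuery (M.pre x s)) (ht : M.AtQuery (M.pre x t)) :
    XStep M (M.oracleStep G 1) (M.pre x s) (M.pre x (s + 1)) := by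
  rcases M.xstep_or_stuck (M.pre x s) with hs | hs
  · exact (hs false).imp_left fun h => Or.inl ((nondetStep_iff_step hM _ _).1 h)
  · obtain ⟨k, rfl⟩ := Nat.exists_eq_add_of_lt hst
    rw [add_assoc, pre, trun_stuck hs] at ht
    exact (h ht).elim

/-- The path is the run before the query, one step that installs the answer, and a run from there
which by `AtMostOneCall` meets no further query. -/
theorem mem_oracleFun_iff_of_query (hM : ∀ q0 q1, Vertex.guess q0 q1 ∉ M) (hO : M.AtMostOneCall O)
    (hG : ∀ p, (G p).Subsingleton) (hGO : ∀ p, G p ⊆ O p) {t q0 q1 : ℕ}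
    (h : ∀ s < t, ¬ M.AtQuery (M.pre x s)) (hq : M[(M.pre x t).vertex]? = some (.query q0 q1)) :
    w ∈ M.oracleFun G 1 x ↔
      ∃ q, M.Yields (fun c c' => M.step c = some c') ((M.pre x t).spawn q1) q ∧
        ∃ y ∈ G q, Writes (M.trun ((M.pre x t).answer q0 y) fun _ => false) w := by
  rw [mem_oracleFun_iff hM hG]
  constructor
  · rintro ⟨d, h0, hd, hw⟩
    have hpre : ∀ s ≤ t, d s = M.pre x s := by
      intro s
      induction s using Nat.strong_induction_on with
      | _ s ih =>
        exact fun hs => eq_trun_of_path h0 hd fun r hr => ih r hr (by omega) ▸ h r (by omega)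
    have hqt : M[(d t).vertex]? = some (.query q0 q1) := hpre t le_rfl ▸ hq
    -- A second query would be reached without `idle` steps, by steps that are also allowed with the
    -- oracle `O`, for which at most one call is assumed.
    have hnot : ∀ i, ¬ M.AtQuery (d (t + 1 + i)) := by
      rintro i ⟨r0, r1, hi⟩
      have hR := fun s hs => oracleStep_mono hGO (path_of_not_accept
        (fun _ _ => oracleStep_not_accept) hd (n := t + 1 + i) (by simp [hi]) s hs)
      refine hO.main x (d t) (d (t + 1 + i)) (h0 ▸ reflTransGen_of_path fun s hs =>
        hR s (by omega)) ⟨q0, q1, hqt⟩ (Relation.TransGen.head' (hR t (by omega)) ?_) ⟨r0, r1, hi⟩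
      exact reflTransGen_of_path (d := fun j => d (t + 1 + j)) fun s hs => hR _ (by omega)
    rcases hd t with (hs | ⟨r0, r1, p, y, h1, h2, h3, h4⟩) | ⟨ha, -⟩
    · rw [oracleStep, step_eq_none_of_query hqt] at hs; cases hs
    · obtain ⟨rfl, rfl⟩ : q0 = r0 ∧ q1 = r1 := by simpa [hqt] using h1
      rw [hpre t le_rfl] at h2 h4
      refine ⟨p, h2, y, h3, ?_⟩
      have : M.trun ((M.pre x t).answer q0 y) (fun _ => false) = fun i => d (t + 1 + i) := by
        funext i
        exact (eq_trun_of_path (d := fun i => d (t + 1 + i)) h4 (fun s => hd _)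
          fun s _ => hnot s).symm
      rw [this, writes_shift fun s => (hd s).outStep fun _ _ => oracleStep_outStep]
      exact hw
    · simp [hqt] at ha
  · rintro ⟨q, hy, y, hyG, hw⟩
    -- The query is at time `t` and the configuration with the answer at time `t + 1`.
    let d : ℕ → Config := fun s => if s ≤ t then M.pre x s else
      M.trun ((M.pre x t).answer q0 y) (fun _ => false) (s - (t + 1))
    have hd : ∀ s, XStep M (M.oracleStep G 1) (d s) (d (s + 1)) := by
      intro s
      rcases lt_trichotomy s t with hs | rfl | hs
      · simp only [d, if_pos hs.le, if_pos (Nat.succ_le_iff.2 hs)]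
        exact xstep_pre_of_query hM hs (h s hs) ⟨q0, q1, hq⟩
      · simp only [d, le_refl, if_true, if_neg (Nat.not_succ_le_self s), Nat.sub_self]
        exact Or.inl (Or.inr ⟨q0, q1, q, y, hq, hy, hyG, rfl⟩)
      · obtain ⟨k, rfl⟩ := Nat.exists_eq_add_of_lt hs
        simp only [d, if_neg (show ¬ t + k + 1 ≤ t by omega),
          if_neg (show ¬ t + k + 1 + 1 ≤ t by omega), show t + k + 1 - (t + 1) = k by omega,
          show t + k + 1 + 1 - (t + 1) = k + 1 by omega]
        exact xstep_trun_of_writes hM hw k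
    refine ⟨d, by simp [d, pre]; rfl, hd, ?_⟩
    rw [← writes_shift (fun s => (hd s).outStep fun _ _ => oracleStep_outStep) (t + 1)]
    convert hw using 2 with i
    simp [d, show ¬ t + 1 + i ≤ t by omega]

end

end Machine

/-! ### From oracle calls to nondeterminism -/

/-- Any choice function for `O` can be altered at the single argument `p`. -/
theorem exists_isSelection_of_mem {O : Problem} {p y : Cantor} (h : y ∈ O p) :
    ∃ G, IsSelection O G ∧ y ∈ G p := by
  classical
  refine ⟨Function.update (fun q => {v | ∃ h : (O q).Nonempty, v = h.some}) p {y}, ?_, by simp⟩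
  refine ⟨fun q => ?_, fun q => ?_, fun q => ?_⟩ <;> rcases eq_or_ne q p with rfl | hq
  · simpa using ⟨y, h⟩
  · rw [Function.update_of_ne hq]
    exact ⟨fun ⟨_, h, _⟩ => h, fun h => ⟨_, h, rfl⟩⟩
  · simp
  · rw [Function.update_of_ne hq]
    rintro _ ⟨_, rfl⟩ _ ⟨_, rfl⟩
    rfl
  · simpa using h
  · rw [Function.update_of_ne hq]
    rintro _ ⟨h, rfl⟩
    exact h.some_mem

theorem exists_isSelection (O : Problem) : ∃ G, IsSelection O G := by
  by_cases h : ∃ p y, y ∈ O p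
  · obtain ⟨p, y, h⟩ := h
    exact (exists_isSelection_of_mem h).imp fun _ => And.left
  · have h : ∀ p, O p = ∅ := fun p => Set.eq_empty_of_forall_notMem fun y hy => h ⟨p, y, hy⟩
    exact ⟨O, fun _ => Iff.rfl, fun p => by simp [h p], fun _ => subset_rfl⟩

/-- Only the value of `G` at the one query matters, and any solution of this query is the value of
some selection; so guessing `y` and choosing `G` amount to the same. -/
theorem Machine.oracleSimulator_outputs {M : Machine} (hM : M.IsOracleType2)
    (hO : M.AtMostOneCall UnProject) (x w : Cantor) :
    (∃ y, M.oracleSimulator.Outputs x y w) ↔ ∃ G, IsSelection UnProject G ∧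
      w ∈ M.oracleFun G 1 x := by
  classical
  by_cases h : ∃ t, M.AtQuery (M.pre x t)
  · obtain ⟨q0, q1, hq⟩ := Nat.find_spec h
    have hmin : ∀ s < Nat.find h, ¬ M.AtQuery (M.pre x s) := fun s hs => Nat.find_min h hs
    simp only [oracleSimulator_outputs_iff_of_query hM.no_guess hmin hq]
    constructor
    · rintro ⟨y, q, h1, h2, h3⟩
      obtain ⟨G, hG, hy⟩ := exists_isSelection_of_mem h2
      exact ⟨G, hG, (mem_oracleFun_iff_of_query hM.no_guess hO hG.single hG.subset hmin hq).2
        ⟨q, h1, y, hy, h3⟩⟩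
    · rintro ⟨G, hG, hw⟩
      obtain ⟨q, h1, y, h2, h3⟩ := (mem_oracleFun_iff_of_query hM.no_guess hO hG.single
        hG.subset hmin hq).1 hw
      exact ⟨y, q, h1, hG.subset q h2, h3⟩
  · have h : ∀ t, ¬ M.AtQuery (M.pre x t) := fun t ht => h ⟨t, ht⟩
    simp only [oracleSimulator_outputs_iff_of_no_query h]
    constructor
    · rintro ⟨-, hw⟩
      obtain ⟨G, hG⟩ := exists_isSelection UnProject
      exact ⟨G, hG, (mem_oracleFun_iff_of_no_query hM.no_guess hG.single h).2 hw⟩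
    · rintro ⟨G, hG, hw⟩
      exact ⟨fun _ => false, (mem_oracleFun_iff_of_no_query hM.no_guess hG.single h).1 hw⟩

theorem Machine.oracleFun_subsingleton {M : Machine} (hM : M.IsOracleType2) {G : Problem}
    (hG : ∀ p, (G p).Subsingleton) (x : Cantor) : (M.oracleFun G 1 x).Subsingleton := by
  intro v hv w hw
  obtain ⟨d, h0, hd, hv⟩ := (mem_oracleFun_iff hM.no_guess hG x v).1 hv
  obtain ⟨e, h0', he, hw⟩ := (mem_oracleFun_iff hM.no_guess hG x w).1 hw
  have : d = e := by
    funext t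
    induction t with
    | zero => exact h0.trans h0'.symm
    | succ t ih =>
      rcases hd t with h1 | ⟨h1, h2⟩ <;> rcases he t with h3 | ⟨h3, h4⟩
      · rw [← ih] at h3; exact oracleStep_unique hM.no_guess hG h1 h3
      · rw [← ih] at h3; exact (oracleStep_not_accept h1 h3).elim
      · rw [← ih] at h3; exact (oracleStep_not_accept h3 h1).elim
      · rw [h2, h4, ih]
  exact hv.unique (this ▸ hw)

theorem SingleCallComputable.nondetComputable {f : Problem} (h : SingleCallComputable UnProject f) :
    NondetComputable f := by
  obtain ⟨M, hM, hO, hf⟩ := h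
  obtain ⟨N, hN, hout⟩ := M.oracleSimulator.exists_nondet_machine
  refine ⟨N, hN, fun x hx => ⟨?_, fun w hw => ?_⟩⟩
  · obtain ⟨G, hG⟩ := exists_isSelection UnProject
    obtain ⟨w, -, hw⟩ := hf G hG x hx
    exact ⟨w, (hout x w).2 ((Machine.oracleSimulator_outputs hM hO x w).2 ⟨G, hG, hw⟩)⟩
  -- The output comes from some selection `G`; with `G` fixed the oracle machine has a unique
  -- output, and one in `f x` is guaranteed.
  · obtain ⟨G, hG, hw⟩ := (Machine.oracleSimulator_outputs hM hO x w).1 ((hout x w).1 hw)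
    obtain ⟨v, hv, hv'⟩ := hf G hG x hx
    rwa [Machine.oracleFun_subsingleton hM hG.single x hw hv']

/-! ### From nondeterminism to oracle calls -/

/-- The Gödel number is read off as the length of the leading block of ones. -/
theorem instanceName_injective {M N : Machine} {x z : Cantor}
    (h : instanceName M x = instanceName N z) : M = N ∧ x = z := by
  obtain ⟨h1, h2, h5⟩ := instanceName_eq_iff.1 h
  obtain ⟨h3, h4, h6⟩ := instanceName_eq_iff.1 (Eq.refl (instanceName M x))
  have hc : M.code = N.code := by
    rcases lt_trichotomy M.code N.code with hl | hl | hl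
    · simp [h1 _ hl] at h4
    · exact hl
    · simp [h3 _ hl] at h2
  exact ⟨Machine.code_injective hc, by rw [h5, ← hc]; exact h6⟩

/-! ### The machine which makes the call -/

/-- The vertices of `callMachine k` other than the start and the query. -/
def callTail (k : ℕ) : List Vertex :=
  -- Vertices `2` to `6`: copy a bit of the answer and skip the next one.
  [.test 2 3 4, .write 2 false 5, .write 2 true 5, .right 2 6, .right 2 2] ++
    -- From vertex `7` on: write `k` ones and a zero; then, in a loop entered at `k + 8`, copy an
    -- input bit and append the padding zero.
    ((List.range k).map (fun i => .write 2 true (i + 8)) ++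
      [.write 2 false (k + 8), .test 0 (k + 9) (k + 10), .write 2 false (k + 11),
        .write 2 true (k + 11), .right 0 (k + 12), .write 2 false (k + 8)])

/-- A machine which on input `x` makes the query `1^k 0 x(0) 0 x(1) 0 …` and then outputs the bits
of the answer at the even positions. -/
def callMachine (k : ℕ) : Machine := .start 1 :: .query 2 7 :: callTail k

section

variable {k : ℕ}

theorem succs_of_mem_callTail {v : Vertex} (hv : v ∈ callTail k) :
    (∀ q0 q1, v ≠ .query q0 q1) ∧ (∀ q0 q1, v ≠ .guess q0 q1) ∧ (∀ q, v ≠ .start q) ∧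
      ∀ q ∈ v.succs, 2 ≤ q ∧ q < k + 13 := by
  simp only [callTail, List.mem_append, List.mem_cons, List.mem_map, List.mem_range,
    List.not_mem_nil, or_false] at hv
  rcases hv with (rfl | rfl | rfl | rfl | rfl) | ⟨i, hi, rfl⟩ | rfl | rfl | rfl | rfl | rfl | rfl <;>
    (simp [Vertex.succs]; try omega)

theorem isOracleType2_callMachine (k : ℕ) : (callMachine k).IsOracleType2 where
  toWellFormed := by
    have hlen : (Vertex.query 2 7 :: callTail k).length + 1 = k + 13 := by simp [callTail]
    refine wellFormed_start_cons ?_ (by omega) ?_ <;> intro v hv <;>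
      rcases List.mem_cons.1 hv with rfl | hv
    · simp
    · exact (succs_of_mem_callTail hv).2.2.1
    · simp only [Vertex.succs, List.mem_cons, List.not_mem_nil, or_false]; omega
    · intro q hq
      have := (succs_of_mem_callTail hv).2.2.2 q hq
      omega
  no_guess q0 q1 h := by
    simp only [callMachine, List.mem_cons, reduceCtorEq, false_or] at h
    exact (succs_of_mem_callTail h).2.1 q0 q1 rfl

theorem callMachine_query {i q0 q1 : ℕ} (h : (callMachine k)[i]? = some (.query q0 q1)) :
    i = 1 ∧ q0 = 2 ∧ q1 = 7 := by
  match i, h with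
  | 0, h => cases h
  | 1, h => cases h; exact ⟨rfl, rfl, rfl⟩
  | i + 2, h => exact ((succs_of_mem_callTail (List.mem_of_getElem? h)).1 q0 q1 rfl).elim

theorem callMachine_succs {i q : ℕ} {v : Vertex} (hi : i ≠ 0) (h : (callMachine k)[i]? = some v)
    (hq : q ∈ v.succs) : 2 ≤ q := by
  match i, h with
  | 0, h => exact (hi rfl).elim
  | 1, h => cases h; simp [Vertex.succs] at hq; omega
  | i + 2, h => exact ((succs_of_mem_callTail (List.mem_of_getElem? h)).2.2.2 q hq).1

theorem Machine.exists_succs_of_step {M : Machine} {c c' : Config} (h : M.step c = some c') :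
    ∃ v, M[c.vertex]? = some v ∧ c'.vertex ∈ v.succs := by
  unfold step at h
  split at h
  · rename_i hv; cases h; exact ⟨_, hv, by simp [Vertex.succs]⟩
  · rename_i hv; cases h; refine ⟨_, hv, ?_⟩; dsimp only; split_ifs <;> simp [Vertex.succs]
  · rename_i hv; split_ifs at h; cases h; exact ⟨_, hv, by simp [Vertex.succs]⟩
  · rename_i hv; cases h; exact ⟨_, hv, by simp [Vertex.succs]⟩
  · rename_i hv; cases h; exact ⟨_, hv, by simp [Vertex.succs]⟩
  · cases h

theorem callMachine_oracleStep {O : Problem} {c c' : Config}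
    (h : (callMachine k).oracleStep O 1 c c') (hc : c.vertex ≠ 0) : 2 ≤ c'.vertex := by
  rcases h with h | ⟨q0, q1, p, y, h, -, -, rfl⟩
  · obtain ⟨v, hv, hq⟩ := Machine.exists_succs_of_step h
    exact callMachine_succs hc hv hq
  · exact (callMachine_query h).2.1.ge

/-- The only query is vertex `1`, but every edge from a vertex other than `0` leads to a vertex with
number at least `2`. -/
theorem atMostOneCall_callMachine (k : ℕ) (O : Problem) : (callMachine k).AtMostOneCall O where
  main := by
    rintro x c c' - ⟨q0, q1, hq⟩ h ⟨q0', q1', hq'⟩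
    have hc : c.vertex ≠ 0 := by rw [(callMachine_query hq).1]; exact one_ne_zero
    have : 2 ≤ c'.vertex := by
      clear hq hq'
      induction h with
      | single h => exact callMachine_oracleStep h hc
      | tail _ h ih => exact callMachine_oracleStep h (by omega)
    have := (callMachine_query hq').1
    omega
  nested := by
    rintro x c q0 q1 - hq c' h ⟨q0', q1', hq'⟩
    have : 2 ≤ c'.vertex := by
      clear hq'
      induction h with
      | refl => rw [(callMachine_query hq).2.2]; exact (by decide : 2 ≤ 7)
      | tail _ h ih => exact callMachine_oracleStep (O := O) (Or.inl h) (by omega)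
    have := (callMachine_query hq').1
    omega

/-- Written cells are final, so it suffices to look at arbitrarily late times. -/
theorem writes_of_frequently {d : ℕ → Config} {w : Cantor}
    (hd : ∀ t, OutStep (d t) (d (t + 1)))
    (h : ∀ m, ∃ t ≥ m, m ≤ (d t).head 3 ∧ ∀ p < (d t).head 3, (d t).tape 3 p = w p) :
    Writes d w := by
  refine ⟨fun m => (h m).imp fun t ht => ht.2.1, fun s p hp => ?_⟩
  obtain ⟨t, hst, -, ht⟩ := h s
  have := outPath_mono hd hst
  rw [← this.2 p hp, ht p (lt_of_lt_of_le hp this.1)]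

theorem forall_lt_succ_update {u v : Cantor} {n : ℕ} {b : Bool} (h : ∀ p < n, u p = v p)
    (hb : b = v n) : ∀ p < n + 1, Function.update u n b p = v p := by
  intro p hp
  rcases Nat.lt_succ_iff_lt_or_eq.1 hp with hp | rfl
  · rw [Function.update_of_ne hp.ne, h p hp]
  · rw [Function.update_self, hb]

theorem callMachine_getElem? (i : ℕ) (v : Vertex)
    (h : [.write 2 false (k + 8), .test 0 (k + 9) (k + 10), .write 2 false (k + 11),
        .write 2 true (k + 11), .right 0 (k + 12), .write 2 false (k + 8)][i]? = some v) :
    (callMachine k)[k + i + 7]? = some v := by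
  change ((List.range k).map (fun i => Vertex.write 2 true (i + 8)) ++ _)[k + i]? = _
  rw [List.getElem?_append_right (by simp), ← h]
  simp

theorem callMachine_getElem?_of_lt {i : ℕ} (h : i < k) :
    (callMachine k)[i + 7]? = some (.write 2 true (i + 8)) := by
  change ((List.range k).map (fun i => Vertex.write 2 true (i + 8)) ++ _)[i]? = _
  rw [List.getElem?_append_left (by simpa using h)]
  simp [h]

namespace Machine

variable {M : Machine} {a q q0 q1 : ℕ} {T : Fin 4 → Cantor} {H : Fin 4 → ℕ} {i : Fin 3} {b : Bool}

theorem tstep_write (h : M[a]? = some (.write 2 b q)) : M.tstep false ⟨a, T, H⟩ =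
    ⟨q, Function.update T 3 (Function.update (T 3) (H 3) b), Function.update H 3 (H 3 + 1)⟩ :=
  tstep_of_step (step_write (c := ⟨a, T, H⟩) h) false

theorem tstep_right (h : M[a]? = some (.right i q)) : M.tstep false ⟨a, T, H⟩ =
    ⟨q, T, Function.update H i.castSucc (H i.castSucc + 1)⟩ :=
  tstep_of_step (step_right (c := ⟨a, T, H⟩) h) false

/-- A test and two vertices which write its result. -/
theorem tstep_copy (h : M[a]? = some (.test i q0 q1)) (h0 : M[q0]? = some (.write 2 false q))
    (h1 : M[q1]? = some (.write 2 true q)) : M.tstep false (M.tstep false ⟨a, T, H⟩) =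
      ⟨q, Function.update T 3 (Function.update (T 3) (H 3) (T i.castSucc (H i.castSucc))),
        Function.update H 3 (H 3 + 1)⟩ := by
  rw [tstep_of_step (step_test (c := ⟨a, T, H⟩) h) false]
  cases hb : T i.castSucc (H i.castSucc)
  · simp only [hb, Bool.false_eq_true, if_false]
    exact tstep_write h0
  · simp only [hb, if_true]
    exact tstep_write h1

end Machine

/-- Each bit of `v` takes four steps: a test, a write, and two moves past the pair of bits of `v`
and `g`. -/
theorem writes_callMachine_answer {c : Config} (hc : c.head 3 = 0) (v g : Cantor) :
    Writes ((callMachine k).trun (c.answer 2 (pair v g)) fun _ => false) v := by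
  refine writes_of_frequently (Machine.trun_outStep _ _) fun m => ⟨4 * m, by omega, ?_⟩
  suffices h : ∀ n, ∃ T H, (callMachine k).trun (c.answer 2 (pair v g)) (fun _ => false) (4 * n) =
      ⟨2, T, H⟩ ∧ T 2 = pair v g ∧ H 2 = 2 * n ∧ H 3 = n ∧ ∀ p < n, T 3 p = v p by
    obtain ⟨T, H, h, -, -, h3, h4⟩ := h m
    rw [h]
    exact ⟨h3.ge, fun p hp => h4 p (h3 ▸ hp)⟩
  intro n
  induction n with
  | zero =>
    exact ⟨_, _, rfl, by simp, by simp, by simp [hc], fun p hp => by omega⟩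
  | succ n ih =>
    obtain ⟨T, H, h, h2, h2', h3, hv⟩ := ih
    have h4 : (callMachine k).trun (c.answer 2 (pair v g)) (fun _ => false) (4 * (n + 1)) =
      (callMachine k).tstep false ((callMachine k).tstep false ((callMachine k).tstep false
        ((callMachine k).tstep false ((callMachine k).trun _ _ (4 * n))))) := rfl
    rw [h4, h, Machine.tstep_copy (a := 2) (T := T) (H := H) (i := 2) (q0 := 3) (q1 := 4) (q := 5)
      rfl rfl rfl,
      Machine.tstep_right (a := 5) (i := 2) (q := 6) rfl,
      Machine.tstep_right (a := 6) (i := 2) (q := 2) rfl]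
    refine ⟨_, _, rfl, by simpa using h2, ?_, by simp [h3], ?_⟩
    · simp [h2']; omega
    · simp only [Function.update_self, h3]
      exact forall_lt_succ_update hv (by
        rw [show Fin.castSucc 2 = (2 : Fin 4) from rfl, h2, h2', pair_even])

theorem writes_callMachine_spawn {c : Config} {x : Cantor} (hc : c.tape 0 = x) (hc' : c.head 0 = 0)
    (V : Machine) : Writes ((callMachine V.code).trun (c.spawn 7) fun _ => false)
      (instanceName V (pair x fun _ => false)) := by
  set q := instanceName V (pair x fun _ => false) with hq
  obtain ⟨hones, hzero, hpair⟩ := instanceName_eq_iff.1 hq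
  have hx : ∀ n, x n = q (V.code + 1 + 2 * n) := fun n => by
    rw [← congrFun hpair (2 * n), pair_even]
  have hfalse : ∀ n, false = q (V.code + 1 + 2 * n + 1) := fun n => by
    rw [add_assoc _ _ 1, ← congrFun hpair (2 * n + 1), pair_odd]
  set k := V.code
  have h1 : ∀ n ≤ k, ∃ T H, (callMachine k).trun (c.spawn 7) (fun _ => false) n =
      ⟨n + 7, T, H⟩ ∧ T 0 = x ∧ H 0 = 0 ∧ H 3 = n ∧ ∀ p < n, T 3 p = q p := by
    intro n hn
    induction n with
    | zero =>
      exact ⟨_, _, rfl, by simpa using hc, by simpa using hc', by simp, fun p hp => by omega⟩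
    | succ n ih =>
      obtain ⟨T, H, h, h0, h0', h3, hv⟩ := ih (by omega)
      have h4 : (callMachine k).trun (c.spawn 7) (fun _ => false) (n + 1) =
        (callMachine k).tstep false ((callMachine k).trun (c.spawn 7) (fun _ => false) n) := rfl
      rw [h4, h, Machine.tstep_write (callMachine_getElem?_of_lt (by omega))]
      refine ⟨_, _, rfl, by simpa using h0, by simpa using h0', by simp [h3], ?_⟩
      simp only [Function.update_self, h3]
      exact forall_lt_succ_update hv (hones n (by omega)).symm
  -- After the prefix `1^k 0` each input bit takes four steps (test, write, move, write the padding)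
  -- and yields two bits of the query.
  have h2 : ∀ n, ∃ T H, (callMachine k).trun (c.spawn 7) (fun _ => false) (k + 1 + 4 * n) =
      ⟨k + 8, T, H⟩ ∧ T 0 = x ∧ H 0 = n ∧ H 3 = k + 1 + 2 * n ∧
        ∀ p < k + 1 + 2 * n, T 3 p = q p := by
    intro n
    induction n with
    | zero =>
      obtain ⟨T, H, h, h0, h0', h3, hv⟩ := h1 k le_rfl
      have h4 : (callMachine k).trun (c.spawn 7) (fun _ => false) (k + 1 + 4 * 0) =
        (callMachine k).tstep false ((callMachine k).trun (c.spawn 7) (fun _ => false) k) := rfl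
      rw [h4, h, Machine.tstep_write (callMachine_getElem? 0 _ rfl)]
      refine ⟨_, _, rfl, by simpa using h0, by simpa using h0', by simp [h3], ?_⟩
      simp only [Function.update_self, h3]
      exact forall_lt_succ_update hv hzero.symm
    | succ n ih =>
      obtain ⟨T, H, h, h0, h0', h3, hv⟩ := ih
      have h4 : (callMachine k).trun (c.spawn 7) (fun _ => false) (k + 1 + 4 * (n + 1)) =
        (callMachine k).tstep false ((callMachine k).tstep false ((callMachine k).tstep false
          ((callMachine k).tstep false ((callMachine k).trun (c.spawn 7) (fun _ => false)
            (k + 1 + 4 * n))))) := rfl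
      rw [h4, h, Machine.tstep_copy (callMachine_getElem? 1 _ rfl) (callMachine_getElem? 2 _ rfl)
        (callMachine_getElem? 3 _ rfl), Machine.tstep_right (callMachine_getElem? 4 _ rfl),
        Machine.tstep_write (callMachine_getElem? 5 _ rfl)]
      refine ⟨_, _, rfl, by simpa using h0, by simp [h0'], by simp [h3]; omega, ?_⟩
      have h5 := forall_lt_succ_update (forall_lt_succ_update hv (hx n)) (hfalse n)
      rw [show k + 1 + 2 * (n + 1) = k + 1 + 2 * n + 1 + 1 by omega]
      simpa [h3, h0, h0'] using h5
  refine writes_of_frequently (Machine.trun_outStep _ _) fun m => ⟨k + 1 + 4 * m, by omega, ?_⟩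
  obtain ⟨T, H, h, -, -, h3, hv⟩ := h2 m
  rw [h]
  exact ⟨by simp only [h3]; omega, fun p hp => hv p (h3 ▸ hp)⟩

theorem mem_oracleFun_callMachine {O G : Problem} (hG : IsSelection O G) (V : Machine)
    {x v g : Cantor} (h : pair v g ∈ G (instanceName V (pair x fun _ => false))) :
    v ∈ (callMachine V.code).oracleFun G 1 x := by
  have hM := (isOracleType2_callMachine V.code).no_guess
  refine (Machine.mem_oracleFun_iff_of_query (t := 1) (q0 := 2) (q1 := 7) hM
    (atMostOneCall_callMachine _ O) hG.single hG.subset ?_ rfl).2 ⟨_, (Machine.yields_step_iff hM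
      (Machine.blank_spawn _ _) (fun _ => false) _).2 (writes_callMachine_spawn ?_ ?_ V), _, h,
        writes_callMachine_answer ?_ v g⟩
  · rintro s hs ⟨q0, q1, hq⟩
    obtain rfl : s = 0 := by omega
    exact absurd (callMachine_query hq).1 (by decide : ¬ 0 = 1)
  all_goals rfl

end

theorem NondetComputable.singleCallComputable {f : Problem} (h : NondetComputable f) :
    SingleCallComputable UnProject f := by
  obtain ⟨N, -, hf⟩ := h
  obtain ⟨V, hV, hacc⟩ := N.simulator.exists_verifier
  -- By injectivity of names the only machine and input to consider are `V` and `⟨x, 0⟩`.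
  have hmem : ∀ x v g, pair v g ∈ UnProject (instanceName V (pair x fun _ => false)) ↔
      N.simulator.Outputs x g v := by
    intro x v g
    rw [← hacc]
    constructor
    · rintro ⟨M, z, -, hq, hM⟩
      obtain ⟨rfl, rfl⟩ := instanceName_injective hq
      exact hM
    · exact fun h => ⟨V, _, hV, rfl, h⟩
  refine ⟨callMachine V.code, isOracleType2_callMachine _, atMostOneCall_callMachine _ _,
    fun G hG x hx => ?_⟩
  obtain ⟨⟨w, hw⟩, hout⟩ := hf x hx
  obtain ⟨g, hg⟩ := (N.nondetOutputs_iff_simulator x w).1 hw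
  -- An existing output of `N` with its guesses shows that the query is in the domain of the oracle;
  -- the answer may be another pair, but its first half is also an output of `N`.
  obtain ⟨y, hy⟩ := (hG.domain (instanceName V (pair x fun _ => false))).2 ⟨_, (hmem x w g).2 hg⟩
  obtain ⟨v, g, rfl⟩ := exists_pair y
  exact ⟨v, hout v ((N.nondetOutputs_iff_simulator x v).2 ⟨g, (hmem x v g).1 (hG.subset _ hy)⟩),
    mem_oracleFun_callMachine hG V hy⟩

end TypeTwo

theorem theorem32 (f : TypeTwo.Problem) :
    TypeTwo.SingleCallComputable TypeTwo.UnProject f ↔ TypeTwo.NondetComputable f :=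
  ⟨fun h => h.nondetComputable, fun h => h.singleCallComputable⟩
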